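/- Let $d\ge 1$ be an integer, $0<\alpha<2$ and $p>-1$. For $u:\mathbb{R}^d\to\mathbb{R}$ and $x\in\mathbb{R}^d$ let $$\Delta^{\alpha/2}u(x)=\mathcal{A}_{d,-\alpha}\lim_{\varepsilon\to0^+}\int_{\{|y-x|>\varepsilon\}}\frac{u(y)-u(x)}{|x-y|^{d+\alpha}}\,dy,\qquad \mathcal{A}_{d,-\alpha}=\frac{2^\alpha\,\Gamma(\frac{\alpha+d}{2})}{\pi^{d/2}\,|\Gamma(-\frac{\alpha}{2})|},$$ whenever the integrals converge absolutely and the limit exists. Define $u_p(x)=(1-|x|^2)^p$ for $|x|<1$ and $u_p(x)=0$ for $|x|\ge1$, that is, $u_p(x)=(1-|x|^2)_+^p$; let $v_p(x)=x_d\,u_p(x)$ for $x=(x_1,\dots,x_d)\in\mathbb{R}^d$; and, for every integer $n\ge1$ and $0\le t<1$, let $$\Phi^{(n)}_{p,\alpha}(t)=\frac{\mathcal{A}_{n,-\alpha}\,B(-\frac{\alpha}{2},p+1)\,\pi^{n/2}}{\Gamma(\frac n2)}\;{}_2F_1\Big(\frac{\alpha+n}{2},\,-p+\frac{\alpha}{2};\,\frac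 n2;\,t\Big).$$ Here $B(a,b)=\Gamma(a)\Gamma(b)/\Gamma(a+b)$ is Euler's beta function (with $1/\Gamma(0)=0$, so that $B(-\frac\alpha2,p+1)=0$ if $p=\frac\alpha2-1$) and ${}_2F_1$ is Gauss' hypergeometric function. Then, for every $x\in\mathbb{R}^d$ with $|x|<1$, $\Delta^{\alpha/2}u_p(x)$ and $\Delta^{\alpha/2}v_p(x)$ exist and $$\Delta^{\alpha/2}u_p(x)=\Phi^{(d)}_{p,\alpha}(|x|^2),\qquad \Delta^{\alpha/2}v_p(x)=x_d\,\Phi^{(d+2)}_{p,\alpha}(|x|^2).$$ -/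

import Mathlib

namespace FracLap

open MeasureTheory Filter Topology

/-- The normalising constant
`𝒜_{d,-α} = 2^α Γ((α+d)/2) / (π^{d/2} |Γ(-α/2)|)`. -/
noncomputable def normConst (d : ℕ) (α : ℝ) : ℝ :=
  2 ^ α * Real.Gamma ((α + d) / 2) /
    (Real.pi ^ ((d : ℝ) / 2) * |Real.Gamma (-α / 2)|)

/-- The integrand `(u(y) - u(x)) / |x - y|^{d+α}` of the singular integral. -/
noncomputable def integrand (d : ℕ) (α : ℝ) (u : EuclideanSpace ℝ (Fin d) → ℝ)
    (x y : EuclideanSpace ℝ (Fin d)) : ℝ :=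
  (u y - u x) / ‖x - y‖ ^ ((d : ℝ) + α)

/-- The fractional Laplacian `Δ^{α/2} u` exists at the point `x` and has the value `L`: the
integrals over `{|y - x| > ε}` converge absolutely for every `ε > 0`, and `𝒜_{d,-α}` times
these integrals tends to `L` as `ε → 0+`. -/
structure HasFracLaplacianAt (d : ℕ) (α : ℝ) (u : EuclideanSpace ℝ (Fin d) → ℝ)
    (x : EuclideanSpace ℝ (Fin d)) (L : ℝ) : Prop where
  integrableOn : ∀ ε : ℝ, 0 < ε → IntegrableOn (integrand d α u x) {y | ε < ‖y - x‖} volume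
  tendsto : Tendsto
    (fun ε : ℝ => normConst d α * ∫ y in {y | ε < ‖y - x‖}, integrand d α u x y)
    (𝓝[>] 0) (𝓝 L)

open scoped Classical in
/-- The function `u_p(x) = (1 - |x|²)_+^p`, which vanishes outside the open unit ball. -/
noncomputable def powFun (d : ℕ) (p : ℝ) (x : EuclideanSpace ℝ (Fin d)) : ℝ :=
  if ‖x‖ < 1 then (1 - ‖x‖ ^ 2) ^ p else 0

/-- The index of the last coordinate in dimension `d ≥ 1`. -/
def lastIndex (d : ℕ) (hd : 1 ≤ d) : Fin d := ⟨d - 1, by omega⟩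

/-- The function `v_p(x) = (1 - |x|²)_+^p x_d`. -/
noncomputable def powFunLast (d : ℕ) (hd : 1 ≤ d) (p : ℝ) (x : EuclideanSpace ℝ (Fin d)) : ℝ :=
  powFun d p x * x (lastIndex d hd)

/-- The function
`Φ_{p,α}^{(d)}(t) = 𝒜_{d,-α} B(-α/2, p+1) π^{d/2} / Γ(d/2) · ₂F₁((α+d)/2, -p+α/2; d/2; t)`.
Here `ProbabilityTheory.beta a b` is `Γ(a) Γ(b) / Γ(a + b)`, Euler's beta function continued
to negative non-integer `a`; for `p + 1 = α/2` it is `0`, as it should be, because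
`Real.Gamma 0 = 0` and division by zero gives zero. -/
noncomputable def Phi (d : ℕ) (p α t : ℝ) : ℝ :=
  normConst d α * ProbabilityTheory.beta (-α / 2) (p + 1) * Real.pi ^ ((d : ℝ) / 2) /
      Real.Gamma ((d : ℝ) / 2) *
    ordinaryHypergeometric ((α + d) / 2) (-p + α / 2) ((d : ℝ) / 2) t

end FracLap

/-! Inside the ball `powFun` is smooth, so averaging over `y` and `-y` turns the principal value
into half of an absolutely convergent integral of second differences
(`hasFracLaplacianAt_of_integrable_symm`). In polar coordinates around `x` the problem becomes
one-dimensional: on a line through `x` with direction `ω`, `powFun` is a rescaled copy of `(1 -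
y²)_+^p` (`powFun_line`).

In dimension one, the Möbius map of `(-1, 1)` sending `0` to `ξ` turns each half-line integral into
`∫ (1 - w²)^p (1 + ξ w)^(-q) w^s dw` up to a power of `1 - ξ²`. Adding the integrals for `ξ` and
`-ξ` leaves only even powers of `w` in the binomial series. Each integrates to a beta value; the
divergent constant term, regularised, gives `B(-α/2, p+1)`. The sum is a hypergeometric series in
`ξ²`, and Euler's transformation absorbs the power of `1 - ξ²` (`integral_ballPow_even`,
`integral_ballPow_odd`).

It remains to average over directions. For a unit vector `e`, `⟨e, ω⟩²` has on the sphere the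
moments of a beta variable with parameters `1/2` and `(d-1)/2`. Averaging against such moments
raises the first and third hypergeometric parameters by `(d-1)/2` (`integral_mixture`), which yields
`Φ^{(d)}`.

For `v_p`, a discrete product rule writes the second difference as `x_d` times that of `u_p` plus
`y_d` times the first difference `u_p(x + y) - u_p(x - y)`. A reflection reduces the latter to its
component along `x`, and the same method evaluates it with third parameter `d/2 + 1`. A contiguous
relation merges the two terms into `Φ^{(d+2)}` (`Phi_add_two`). -/

namespace FracLap

open MeasureTheory Filter Topology Set

/-! ### Rising factorials and the coefficients of the hypergeometric series -/

/-- The rising factorial `a (a + 1) ⋯ (a + n - 1)`. -/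
noncomputable def poch (a : ℝ) (n : ℕ) : ℝ := (ascPochhammer ℝ n).eval a

@[simp] lemma poch_zero (a : ℝ) : poch a 0 = 1 := by simp [poch]

lemma poch_succ (a : ℝ) (n : ℕ) : poch a (n + 1) = poch a n * (a + n) := by
  simp [poch, ascPochhammer_succ_eval]

lemma poch_pos {a : ℝ} (ha : 0 < a) (n : ℕ) : 0 < poch a n := ascPochhammer_pos n a ha

lemma poch_nonneg {a : ℝ} (ha : 0 ≤ a) (n : ℕ) : 0 ≤ poch a n := by
  induction n with
  | zero => simp
  | succ n ih => rw [poch_succ]; positivity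

lemma poch_succ_left (a : ℝ) (n : ℕ) : poch a (n + 1) = a * poch (a + 1) n := by
  induction n with
  | zero => simp [poch_succ]
  | succ n ih => rw [poch_succ, ih, poch_succ (a + 1)]; push_cast; ring

lemma poch_add (a : ℝ) (m n : ℕ) : poch a (m + n) = poch a m * poch (a + m) n := by
  induction n with
  | zero => simp
  | succ n ih => rw [← add_assoc, poch_succ, ih, poch_succ]; push_cast; ring

lemma abs_poch_le {a b : ℝ} (h : |a| ≤ b) (n : ℕ) : |poch a n| ≤ poch b n := by
  have hb : 0 ≤ b := (abs_nonneg a).trans h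
  induction n with
  | zero => simp
  | succ n ih =>
    rw [poch_succ, poch_succ, abs_mul]
    have : |a + n| ≤ b + n := by
      refine (abs_add_le _ _).trans ?_
      rw [Nat.abs_cast]; linarith
    exact mul_le_mul ih this (abs_nonneg _) (poch_nonneg hb n)

/-- Duplication: the even and odd factors of the product are separated, `2a + 2i = 2(a + i)` and `2a
+ 2i + 1 = 2(a + 1/2 + i)`. -/
lemma poch_double (a : ℝ) (k : ℕ) :
    poch (2 * a) (2 * k) = 4 ^ k * poch a k * poch (a + 1 / 2) k := by
  induction k with
  | zero => simp
  | succ k ih =>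
    rw [show 2 * (k + 1) = 2 * k + 1 + 1 by ring, poch_succ, poch_succ, ih, poch_succ, poch_succ]
    push_cast; ring

lemma Gamma_add_nat {a : ℝ} (ha : ∀ j : ℕ, a + j ≠ 0) (n : ℕ) :
    Real.Gamma (a + n) = poch a n * Real.Gamma a := by
  induction n with
  | zero => simp
  | succ n ih =>
    rw [poch_succ, Nat.cast_succ, ← add_assoc, Real.Gamma_add_one (ha n), ih]; ring

lemma poch_ne_zero {a : ℝ} (ha : ∀ j : ℕ, a + j ≠ 0) (n : ℕ) : poch a n ≠ 0 := by
  induction n with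
  | zero => simp
  | succ n ih => rw [poch_succ]; exact mul_ne_zero ih (ha n)

lemma poch_one (n : ℕ) : poch 1 n = n.factorial := by
  induction n with
  | zero => simp
  | succ n ih => rw [poch_succ, ih, Nat.factorial_succ]; push_cast; ring

lemma factorial_double (n : ℕ) : ((2 * n).factorial : ℝ) = 4 ^ n * poch (1 / 2) n * n.factorial := by
  have h := poch_double (1 / 2) n
  rw [show (2 : ℝ) * (1 / 2) = 1 by norm_num, show (1 / 2 : ℝ) + 1 / 2 = 1 by norm_num,
    poch_one, poch_one] at h
  exact h

lemma factorial_double_add_one (n : ℕ) :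
    ((2 * n + 1).factorial : ℝ) = 4 ^ n * poch (3 / 2) n * n.factorial := by
  have h := poch_double 1 n
  rw [poch_one, show (1 : ℝ) + 1 / 2 = 3 / 2 by norm_num] at h
  rw [← poch_one, poch_succ_left, one_mul, show (1 : ℝ) + 1 = 2 * 1 by norm_num, h]
  ring

/-- The coefficients of the Gauss hypergeometric series. -/
noncomputable def hypCoeff (a b c : ℝ) (n : ℕ) : ℝ :=
  poch a n * poch b n / (poch c n * n.factorial)

@[simp] lemma hypCoeff_zero (a b c : ℝ) : hypCoeff a b c 0 = 1 := by simp [hypCoeff]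

lemma hypCoeff_succ {c : ℝ} (hc : 0 < c) (a b : ℝ) (n : ℕ) :
    ((n : ℝ) + 1) * (n + c) * hypCoeff a b c (n + 1) = (n + a) * (n + b) * hypCoeff a b c n := by
  have h1 := (poch_pos hc n).ne'
  have h2 : (n.factorial : ℝ) ≠ 0 := by positivity
  have h3 : c + n ≠ 0 := by positivity
  have h4 : (n : ℝ) + 1 ≠ 0 := by positivity
  simp only [hypCoeff, poch_succ, Nat.factorial_succ]
  push_cast
  field_simp
  ring

lemma hyp_eq_tsum (a b c t : ℝ) :
    ordinaryHypergeometric a b c t = ∑' n, hypCoeff a b c n * t ^ n := by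
  rw [ordinaryHypergeometric_eq_tsum]
  refine tsum_congr fun n => ?_
  simp only [hypCoeff, poch, smul_eq_mul, div_eq_mul_inv, mul_inv]
  ring

lemma summable_hypCoeff_of_pos {a b c t : ℝ} (ha : 0 < a) (hb : 0 < b) (hc : 0 < c) (ht0 : 0 ≤ t)
    (ht : t < 1) : Summable fun n => hypCoeff a b c n * t ^ n := by
  rcases ht0.eq_or_lt with rfl | ht0
  · exact summable_of_ne_finset_zero (s := {0}) (by
      intro n hn
      have : n ≠ 0 := by simpa using hn
      simp [this])
  have hpos : ∀ n, 0 < hypCoeff a b c n * t ^ n := fun n => by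
    have := poch_pos ha n; have := poch_pos hb n; have := poch_pos hc n
    unfold hypCoeff; positivity
  refine summable_of_ratio_test_tendsto_lt_one ht (Eventually.of_forall fun n => (hpos n).ne') ?_
  have key : ∀ n : ℕ, ‖hypCoeff a b c (n + 1) * t ^ (n + 1)‖ / ‖hypCoeff a b c n * t ^ n‖ =
      ((a + 1 * n) / (1 + 1 * n)) * ((b + 1 * n) / (c + 1 * n)) * t := by
    intro n
    rw [Real.norm_of_nonneg (hpos _).le, Real.norm_of_nonneg (hpos _).le]
    have h := hypCoeff_succ hc a b n
    have h0 : hypCoeff a b c n ≠ 0 := by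
      intro h; have := hpos n; rw [h] at this; simp at this
    have h3 : c + n ≠ 0 := by positivity
    have h4 : (1 : ℝ) + n ≠ 0 := by positivity
    have h5 := (pow_pos ht0 n).ne'
    simp only [one_mul]
    rw [div_mul_div_comm, div_mul_eq_mul_div, div_eq_div_iff (mul_ne_zero h0 h5)
      (mul_ne_zero h4 h3), pow_succ]
    linear_combination (t ^ n * t) * h
  simp_rw [key]
  have h1 := tendsto_add_mul_div_add_mul_atTop_nhds a 1 (1 : ℝ) (one_ne_zero)
  have h2 := tendsto_add_mul_div_add_mul_atTop_nhds b c (1 : ℝ) (one_ne_zero)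
  simpa using (h1.mul h2).mul_const t

/-- The majorant has strictly positive parameters, so the ratio test applies to it even if the
original series terminates and has zero terms. -/
lemma abs_hypCoeff_le {a b c : ℝ} (hc : 0 < c) (n : ℕ) :
    |hypCoeff a b c n| ≤ hypCoeff (|a| + 1) (|b| + 1) c n := by
  have h1 := poch_pos hc n
  unfold hypCoeff
  rw [abs_div, abs_mul, abs_of_pos (by positivity : 0 < poch c n * (n.factorial : ℝ))]
  gcongr
  · exact poch_nonneg (by positivity) n
  · exact abs_poch_le (by linarith) n
  · exact abs_poch_le (by linarith) n

lemma summable_abs_hypCoeff {c t : ℝ} (a b : ℝ) (hc : 0 < c) (ht : |t| < 1) :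
    Summable fun n => ‖hypCoeff a b c n * t ^ n‖ := by
  refine Summable.of_nonneg_of_le (fun _ => norm_nonneg _) (fun n => ?_)
    (summable_hypCoeff_of_pos (a := |a| + 1) (b := |b| + 1) (by positivity) (by positivity) hc
      (abs_nonneg t) ht)
  rw [norm_mul, norm_pow, Real.norm_eq_abs, Real.norm_eq_abs]
  gcongr
  exact abs_hypCoeff_le hc n

lemma hasSum_hyp {c t : ℝ} (a b : ℝ) (hc : 0 < c) (ht : |t| < 1) :
    HasSum (fun n => hypCoeff a b c n * t ^ n) (ordinaryHypergeometric a b c t) := by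
  rw [hyp_eq_tsum]
  exact (summable_abs_hypCoeff a b hc ht).of_norm.hasSum

lemma hypCoeff_self {c : ℝ} (hc : 0 < c) (a : ℝ) (n : ℕ) :
    hypCoeff a c c n = poch a n / n.factorial := by
  have := (poch_pos hc n).ne'
  unfold hypCoeff
  field_simp

lemma multichoose_eq_poch (a : ℝ) (n : ℕ) : Ring.multichoose a n = poch a n / n.factorial := by
  have h := Ring.factorial_nsmul_multichoose_eq_ascPochhammer a n
  rw [Polynomial.ascPochhammer_smeval_eq_eval, nsmul_eq_mul] at h
  rw [poch, ← h]
  field_simp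

/-- The binomial series. -/
lemma hasSum_binomial {x : ℝ} (a : ℝ) (hx : |x| < 1) :
    HasSum (fun n => poch a n / n.factorial * x ^ n) ((1 - x) ^ (-a)) := by
  have h := (Real.one_div_one_sub_rpow_hasFPowerSeriesOnBall_zero a).hasSum (y := x)
    (by simpa [enorm_eq_nnnorm] using! hx)
  have h1 : (0 : ℝ) ≤ 1 - x := by have := (abs_lt.mp hx).2; linarith
  rw [zero_add, one_div, ← Real.rpow_neg h1] at h
  refine h.congr_fun fun n => ?_
  simp [← Ring.multichoose_eq, multichoose_eq_poch, mul_comm]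

lemma summable_abs_binomial {x : ℝ} (a : ℝ) (hx : |x| < 1) :
    Summable fun n => ‖poch a n / n.factorial * x ^ n‖ := by
  simpa only [hypCoeff_self one_pos] using summable_abs_hypCoeff a 1 one_pos hx

/-- The Chu-Vandermonde identity for rising factorials. -/
lemma sum_poch_antidiagonal (a b : ℝ) (n : ℕ) :
    ∑ k ∈ Finset.HasAntidiagonal.antidiagonal n,
      poch a k.1 / k.1.factorial * (poch b k.2 / k.2.factorial) = poch (a + b) n / n.factorial := by
  -- At `-a` the binomial coefficient is a rising factorial up to the sign `(-1)^n`, so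
  -- Vandermonde's identity for `-a` and `-b` is the claim.
  have h : ∀ (a : ℝ) (n : ℕ), Ring.choose (-a) n = (-1) ^ n * (poch a n / n.factorial) := by
    intro a n
    rw [Ring.choose_neg, ← Ring.multichoose_eq, multichoose_eq_poch, Units.smul_def,
      zsmul_eq_mul]
    simp
  have h1 := Ring.add_choose_eq n (Commute.all (-a) (-b))
  rw [← neg_add, h] at h1
  have h2 : ((-1 : ℝ) ^ n) * (-1) ^ n = 1 := by rw [← mul_pow]; simp
  calc _ = (-1 : ℝ) ^ n * ∑ k ∈ Finset.HasAntidiagonal.antidiagonal n,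
        Ring.choose (-a) k.1 * Ring.choose (-b) k.2 := by
        rw [Finset.mul_sum]
        refine Finset.sum_congr rfl fun k hk => ?_
        rw [h, h, ← Finset.HasAntidiagonal.mem_antidiagonal.mp hk]
        rw [← Finset.HasAntidiagonal.mem_antidiagonal.mp hk] at h2
        rw [pow_add] at h2 ⊢
        linear_combination (-(poch a k.1 / k.1.factorial * (poch b k.2 / k.2.factorial))) * h2
    _ = _ := by rw [← h1, ← mul_assoc, h2, one_mul]

/-! ### Euler's transformation through the hypergeometric differential equation -/

section Euler

open PowerSeries

/-- The recursion `hypCoeff_succ`, read as a differential equation between formal power series. -/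
lemma hyp_ode {c : ℝ} (hc : 0 < c) (a b : ℝ) (y : PowerSeries ℝ)
    (hy : y = PowerSeries.mk (hypCoeff a b c)) :
    X * (1 - X) * derivative ℝ (derivative ℝ y) +
      (C c - C (a + b + 1) * X) * derivative ℝ y - C (a * b) * y = 0 := by
  subst hy
  obtain ⟨s, hs⟩ : ∃ s, s = a + b + 1 := ⟨_, rfl⟩
  rw [← hs]
  ext n
  have h := hypCoeff_succ hc a b n
  have e1 : X * (1 - X) * derivative ℝ (derivative ℝ (PowerSeries.mk (hypCoeff a b c))) =
    derivative ℝ (derivative ℝ (PowerSeries.mk (hypCoeff a b c))) * X -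
    derivative ℝ (derivative ℝ (PowerSeries.mk (hypCoeff a b c))) * X * X := by ring
  have e2 : (C c - C s * X) * derivative ℝ (PowerSeries.mk (hypCoeff a b c)) =
    C c * derivative ℝ (PowerSeries.mk (hypCoeff a b c)) -
    C s * (derivative ℝ (PowerSeries.mk (hypCoeff a b c)) * X) := by ring
  rw [e1, e2]
  simp only [map_sub, map_add, coeff_C_mul]
  rcases n with _ | _ | n
  · simp [coeff_zero_mul_X, coeff_derivative] at h ⊢
    linarith
  · simp [coeff_succ_mul_X, coeff_derivative, coeff_zero_mul_X] at h ⊢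
    norm_num at h ⊢
    rw [hs]; linear_combination h
  · simp only [coeff_succ_mul_X, coeff_derivative, coeff_mk] at h ⊢
    push_cast at h ⊢
    simp only [map_zero]
    rw [hs]; linear_combination h

/-- The coefficients of the equation give back the recursion, and `(n + 1)(n + c) ≠ 0` because `c >
0`, so the constant term determines the solution. -/
lemma hyp_ode_unique {c : ℝ} (hc : 0 < c) (a b : ℝ) (y : PowerSeries ℝ)
    (h0 : constantCoeff y = 1)
    (hy : X * (1 - X) * derivative ℝ (derivative ℝ y) +
      (C c - C (a + b + 1) * X) * derivative ℝ y - C (a * b) * y = 0) :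
    y = PowerSeries.mk (hypCoeff a b c) := by
  have key : ∀ n : ℕ, ((n : ℝ) + 1) * (n + c) * coeff (n + 1) y =
      (n + a) * (n + b) * coeff n y := by
    obtain ⟨s, hs⟩ : ∃ s, s = a + b + 1 := ⟨_, rfl⟩
    rw [← hs] at hy
    intro n
    have e : derivative ℝ (derivative ℝ y) * X - derivative ℝ (derivative ℝ y) * X * X +
      (C c * derivative ℝ y - C s * (derivative ℝ y * X)) - C (a * b) * y = 0 := by
      rw [← hy]; ring
    have e' := congrArg (coeff n) e
    simp only [map_sub, map_add, coeff_C_mul] at e'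
    rcases n with _ | _ | n
    · simp [coeff_zero_mul_X, coeff_derivative] at e' ⊢
      linarith
    · simp [coeff_succ_mul_X, coeff_derivative, coeff_zero_mul_X] at e' ⊢
      norm_num at e' ⊢
      rw [hs] at e'; linear_combination e'
    · simp only [coeff_succ_mul_X, coeff_derivative] at e'
      push_cast at e' ⊢
      simp only [map_zero] at e'
      rw [hs] at e'; linear_combination e'
  ext n
  rw [coeff_mk]
  induction n with
  | zero => simpa using h0
  | succ n ih =>
    have h1 := key n
    rw [ih, ← hypCoeff_succ hc] at h1
    exact mul_left_cancel₀ (by positivity) h1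

/-- The series of `(1 - X)^(c-a-b)` times that of `₂F₁(c-a, c-b; c)` solves the equation with
parameters `a, b, c` and has constant term `1`; uniqueness does the rest. -/
lemma euler_coeff {c : ℝ} (hc : 0 < c) (a b : ℝ) :
    PowerSeries.mk (hypCoeff a b c) = PowerSeries.mk (fun n => poch (-(c - a - b)) n / n.factorial) *
      PowerSeries.mk (hypCoeff (c - a) (c - b) c) := by
  symm
  set e := c - a - b with he
  set s : PowerSeries ℝ := PowerSeries.mk (fun n => poch (-e) n / n.factorial) with hs
  set g : PowerSeries ℝ := PowerSeries.mk (hypCoeff (c - a) (c - b) c) with hg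
  have hs1 : (1 - X) * derivative ℝ s = - (C e * s) := by
    ext n
    rw [show (1 - X) * derivative ℝ s = derivative ℝ s - derivative ℝ s * X by ring]
    simp only [map_sub, map_neg, coeff_C_mul]
    rcases n with _ | n
    · simp [coeff_zero_mul_X, coeff_derivative, hs, poch_succ]
    · simp only [coeff_succ_mul_X, coeff_derivative, hs, coeff_mk, poch_succ, Nat.factorial_succ]
      push_cast
      have : (n.factorial : ℝ) ≠ 0 := by positivity
      field_simp
      ring
  have hs2 : (1 - X) * derivative ℝ (derivative ℝ s) = C (1 - e) * derivative ℝ s := by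
    have := congrArg (derivative ℝ) hs1
    simp only [Derivation.leibniz, map_sub, map_neg, smul_eq_mul, Derivation.map_one_eq_zero,
      derivative_X, derivative_C] at this
    rw [map_sub, map_one]
    linear_combination this
  have hG := hyp_ode hc (c - a) (c - b) g hg
  apply hyp_ode_unique hc a b
  · simp [hs, hg]
  · have hne : (1 - X : PowerSeries ℝ) ≠ 0 := by
      intro h
      have := congrArg (constantCoeff) h
      simp at this
    -- The power `s` is known only through `(1 - X) s' = -e s`. The equation is therefore checked
    -- after multiplication by `1 - X`, which cancels in a domain.
    refine (mul_eq_zero.mp ?_).resolve_left hne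
    simp only [Derivation.leibniz, smul_eq_mul, map_add]
    simp only [he, map_sub, map_add, map_one, map_mul] at hs1 hs2 hG ⊢
    linear_combination (X * (1 - X) * g) * hs2 + ((C c - (C a + C b + 1) * X) * g
      + (1 - (C c - C a - C b)) * X * g + 2 * X * (1 - X) * derivative ℝ g) * hs1
      + s * (1 - X) * hG

end Euler

/-- Euler's transformation of the Gauss hypergeometric function. -/
lemma hyp_euler {c t : ℝ} (hc : 0 < c) (a b : ℝ) (ht : |t| < 1) :
    ordinaryHypergeometric a b c t =
      (1 - t) ^ (c - a - b) * ordinaryHypergeometric (c - a) (c - b) c t := by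
  have h1 := hasSum_binomial (-(c - a - b)) ht
  rw [neg_neg] at h1
  rw [← h1.tsum_eq, hyp_eq_tsum, hyp_eq_tsum,
    tsum_mul_tsum_eq_tsum_sum_antidiagonal_of_summable_norm (summable_abs_binomial _ ht)
      (summable_abs_hypCoeff _ _ hc ht)]
  refine tsum_congr fun n => ?_
  have h2 := congrArg (PowerSeries.coeff n) (euler_coeff hc a b)
  rw [PowerSeries.coeff_mul] at h2
  simp only [PowerSeries.coeff_mk] at h2
  rw [h2, Finset.sum_mul]
  refine Finset.sum_congr rfl fun k hk => ?_
  rw [← Finset.HasAntidiagonal.mem_antidiagonal.mp hk, pow_add]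
  ring

/-- A contiguous relation of the Gauss hypergeometric function. -/
lemma hyp_contiguous {c t : ℝ} (hc : 0 < c) (a b : ℝ) (ht : |t| < 1) :
    a / c * ordinaryHypergeometric (a + 1) b (c + 1) t =
      ordinaryHypergeometric a b c t + (a - c) / c * ordinaryHypergeometric a b (c + 1) t := by
  have h1 := (hasSum_hyp (a + 1) b (by positivity : 0 < c + 1) ht).mul_left (a / c)
  have h2 := (hasSum_hyp a b (by positivity : 0 < c + 1) ht).mul_left ((a - c) / c)
  have h3 := (hasSum_hyp a b hc ht).add h2
  refine h1.unique (h3.congr_fun fun n => ?_)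
  -- With these two shifts the coefficient identity reduces to `a + n = (c + n) + (a - c)`.
  have e1 : a * poch (a + 1) n = poch a n * (a + n) := by rw [← poch_succ_left, poch_succ]
  have e2 : c * poch (c + 1) n = poch c n * (c + n) := by rw [← poch_succ_left, poch_succ]
  have p1 := (poch_pos hc n).ne'
  have p2 := (poch_pos (by positivity : 0 < c + 1) n).ne'
  have p3 : (n.factorial : ℝ) ≠ 0 := by positivity
  have p4 : c + n ≠ 0 := by positivity
  have e3 : poch (c + 1) n = poch c n * (c + n) / c := by field_simp; linarith
  simp only [hypCoeff, e3]
  field_simp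
  linear_combination poch b n * t ^ n * e1

end FracLap

/-! ### Averaging hypergeometric functions against Dirichlet moments -/

namespace FracLap

open MeasureTheory Filter Topology Set

lemma hasSum_sum_antidiagonal {f : ℕ × ℕ → ℝ} {s : ℝ} (h : HasSum f s) :
    HasSum (fun n => ∑ x ∈ Finset.HasAntidiagonal.antidiagonal n, f x) s := by
  have h1 := (Finset.HasAntidiagonal.sigmaAntidiagonalEquivProd (A := ℕ)).hasSum_iff.mpr h
  refine h1.sigma fun n => ?_
  convert hasSum_fintype _ using 1
  exact (Finset.sum_coe_sort _ f).symm

lemma summable_of_sum_antidiagonal {f : ℕ × ℕ → ℝ} (hf : ∀ x, 0 ≤ f x)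
    (h : Summable fun n => ∑ x ∈ Finset.HasAntidiagonal.antidiagonal n, f x) : Summable f := by
  rw [← (Finset.HasAntidiagonal.sigmaAntidiagonalEquivProd (A := ℕ)).summable_iff]
  refine (summable_sigma_of_nonneg fun x => hf _).mpr ⟨fun n => (hasSum_fintype _).summable, ?_⟩
  convert h using 1
  funext n
  rw [tsum_fintype]
  exact Finset.sum_coe_sort _ f

/-- The terms of the double expansion of `(1 - y)^(-β) ₂F₁(A, β; a; x / (1 - y))`. -/
noncomputable def mixTerm (A β a : ℝ) (x y : ℝ) (i : ℕ × ℕ) : ℝ :=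
  poch A i.1 / (poch a i.1 * i.1.factorial) * (poch β (i.1 + i.2) / i.2.factorial) *
    x ^ i.1 * y ^ i.2

/-- As `(β)_(k+j) = (β)_k (β + k)_j`, the sum over `j` is the binomial series of exponent `-(β +
k)`. -/
lemma hasSum_mixTerm_snd (A β a x : ℝ) {y : ℝ} (hy0 : 0 ≤ y) (hy : y < 1) (k : ℕ) :
    HasSum (fun j => mixTerm A β a x y (k, j))
      ((1 - y) ^ (-β) * (hypCoeff A β a k * (x / (1 - y)) ^ k)) := by
  have h := (hasSum_binomial (β + k) (x := y) (abs_lt.mpr ⟨by linarith, hy⟩)).mul_left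
    (hypCoeff A β a k * x ^ k)
  have h1 : hypCoeff A β a k * x ^ k * (1 - y) ^ (-(β + k)) =
      (1 - y) ^ (-β) * (hypCoeff A β a k * (x / (1 - y)) ^ k) := by
    have : 0 < 1 - y := by linarith
    rw [neg_add, Real.rpow_add this, Real.rpow_neg this.le (k : ℝ), Real.rpow_natCast, div_pow]
    ring
  rw [h1] at h
  refine h.congr_fun fun j => ?_
  simp only [mixTerm, hypCoeff, poch_add]
  ring

lemma mixTerm_nonneg {A β a x y : ℝ} (hA : 0 < A) (hβ : 0 ≤ β) (ha : 0 < a) (hx : 0 ≤ x)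
    (hy : 0 ≤ y) (i : ℕ × ℕ) : 0 ≤ mixTerm A β a x y i := by
  have := poch_pos hA i.1
  have := poch_pos ha i.1
  have := poch_nonneg hβ (i.1 + i.2)
  unfold mixTerm
  positivity

lemma abs_mixTerm_le {A β a x y : ℝ} (hA : 0 < A) (ha : 0 < a) (hx : 0 ≤ x)
    (hy : 0 ≤ y) (i : ℕ × ℕ) : ‖mixTerm A β a x y i‖ ≤ mixTerm A |β| a x y i := by
  have h1 := poch_pos hA i.1
  have h2 := poch_pos ha i.1
  unfold mixTerm
  rw [norm_mul, norm_mul, norm_mul, norm_pow, norm_pow, Real.norm_of_nonneg hx,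
    Real.norm_of_nonneg hy, norm_div, Real.norm_of_nonneg h1.le,
    Real.norm_of_nonneg (by positivity : 0 ≤ poch a i.1 * i.1.factorial), norm_div,
    Real.norm_eq_abs, Real.norm_of_nonneg (by positivity : (0 : ℝ) ≤ i.2.factorial)]
  gcongr
  exact abs_poch_le le_rfl _

/-- Summability over pairs is checked on the majorant with `|β|` in place of `β`, whose terms are
nonnegative, so that iterated sums suffice. -/
lemma hasSum_mixTerm {A a x y : ℝ} (β : ℝ) (hA : 0 < A) (ha : 0 < a) (hx : 0 ≤ x)
    (hy : 0 ≤ y) (hxy : x + y < 1) :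
    HasSum (mixTerm A β a x y) ((1 - y) ^ (-β) * ordinaryHypergeometric A β a (x / (1 - y))) := by
  have hy1 : y < 1 := by linarith
  have hz : |x / (1 - y)| < 1 := by
    rw [abs_of_nonneg (div_nonneg hx (by linarith)), div_lt_one (by linarith)]; linarith
  have hsum : Summable (mixTerm A β a x y) := by
    refine Summable.of_norm_bounded ?_ (abs_mixTerm_le hA ha hx hy)
    refine (summable_prod_of_nonneg (mixTerm_nonneg hA (abs_nonneg β) ha hx hy)).mpr
      ⟨fun k => (hasSum_mixTerm_snd A |β| a x hy hy1 k).summable, ?_⟩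
    simp_rw [(hasSum_mixTerm_snd A |β| a x hy hy1 _).tsum_eq]
    exact (hasSum_hyp A |β| ha hz).summable.mul_left _
  have h1 := hsum.hasSum.prod_fiberwise (hasSum_mixTerm_snd A β a x hy hy1)
  have h2 := (hasSum_hyp A β ha hz).mul_left ((1 - y) ^ (-β))
  rw [← h1.unique h2]
  exact hsum.hasSum

/-- Averaging a hypergeometric function against a measure with Dirichlet moments. -/
lemma integral_mixture {Ω : Type*} [MeasurableSpace Ω] (ν : Measure Ω) (w s : Ω → ℝ)
    (hw : ∀ ω, 0 ≤ w ω) (hs0 : ∀ ω, 0 ≤ s ω) (hs1 : ∀ ω, s ω ≤ 1) {A a b N t : ℝ} (β : ℝ)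
    (hA : 0 < A) (ha : 0 < a) (hb : 0 ≤ b) (ht0 : 0 ≤ t) (ht : t < 1)
    (hint : ∀ k j : ℕ, Integrable (fun ω => w ω * (s ω ^ k * (1 - s ω) ^ j)) ν)
    (hmom : ∀ k j : ℕ, ∫ ω, w ω * (s ω ^ k * (1 - s ω) ^ j) ∂ν =
      N * (poch a k * poch b j / poch (a + b) (k + j))) :
    ∫ ω, w ω * ((1 - t * (1 - s ω)) ^ (-β) *
      ordinaryHypergeometric A β a (t * s ω / (1 - t * (1 - s ω)))) ∂ν =
      N * ordinaryHypergeometric (A + b) β (a + b) t := by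
  have hab : 0 < a + b := by positivity
  have htt : |t| < 1 := by rwa [abs_of_nonneg ht0]
  set F : ℝ → ℕ × ℕ → Ω → ℝ := fun β i ω => w ω * mixTerm A β a (t * s ω) (t * (1 - s ω)) i with hF
  have hFeq : ∀ β i, F β i = fun ω => (poch A i.1 / (poch a i.1 * i.1.factorial) *
      (poch β (i.1 + i.2) / i.2.factorial) * t ^ (i.1 + i.2)) *
      (w ω * (s ω ^ i.1 * (1 - s ω) ^ i.2)) := by
    intro β i
    funext ω
    simp only [hF, mixTerm, mul_pow, pow_add]
    ring
  have hFint : ∀ β i, Integrable (F β i) ν := fun β i => by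
    rw [hFeq]; exact (hint _ _).const_mul _
  have hFval : ∀ β i, ∫ ω, F β i ω ∂ν = N * (poch β (i.1 + i.2) / poch (a + b) (i.1 + i.2) *
      t ^ (i.1 + i.2) * (poch A i.1 / i.1.factorial * (poch b i.2 / i.2.factorial))) := by
    intro β i
    rw [hFeq, integral_const_mul, hmom]
    have := (poch_pos ha i.1).ne'
    field_simp
  -- On an antidiagonal `(β)_n / (a+b)_n` is constant, and Chu-Vandermonde sums the remaining
  -- factors to `(A + b)_n / n!`. This is where `A` becomes `A + b`.
  have hdiag : ∀ β n, ∑ i ∈ Finset.HasAntidiagonal.antidiagonal n, ∫ ω, F β i ω ∂ν =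
      N * (hypCoeff (A + b) β (a + b) n * t ^ n) := by
    intro β n
    have h1 : ∀ i ∈ Finset.HasAntidiagonal.antidiagonal n, ∫ ω, F β i ω ∂ν =
        N * (poch β n / poch (a + b) n * t ^ n) *
          (poch A i.1 / i.1.factorial * (poch b i.2 / i.2.factorial)) := by
      intro i hi
      rw [hFval, Finset.HasAntidiagonal.mem_antidiagonal.mp hi]
      ring
    rw [Finset.sum_congr rfl h1, ← Finset.mul_sum, sum_poch_antidiagonal]
    have := (poch_pos hab n).ne'
    simp only [hypCoeff]
    field_simp
  have hFnonneg : ∀ i ω, 0 ≤ F |β| i ω := fun i ω => mul_nonneg (hw ω)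
    (mixTerm_nonneg hA (abs_nonneg β) ha (mul_nonneg ht0 (hs0 ω))
      (mul_nonneg ht0 (by linarith [hs1 ω])) i)
  have hle : ∀ i ω, ‖F β i ω‖ ≤ F |β| i ω := by
    intro i ω
    simp only [hF]
    rw [norm_mul, Real.norm_of_nonneg (hw ω)]
    exact mul_le_mul_of_nonneg_left (abs_mixTerm_le hA ha (mul_nonneg ht0 (hs0 ω))
      (mul_nonneg ht0 (by linarith [hs1 ω])) i) (hw ω)
  -- The majorant with `|β|` is nonnegative, so it may be summed along antidiagonals, where `hdiag`
  -- identifies it with a convergent hypergeometric series.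
  have hsum : Summable fun i => ∫ ω, ‖F β i ω‖ ∂ν := by
    refine Summable.of_nonneg_of_le (fun i => integral_nonneg fun ω => norm_nonneg _)
      (fun i => integral_mono (hFint β i).norm (hFint |β| i) (hle i)) ?_
    refine summable_of_sum_antidiagonal (fun i => integral_nonneg (hFnonneg i)) ?_
    simp_rw [hdiag]
    exact (hasSum_hyp _ _ hab htt).summable.mul_left N
  have h1 := hasSum_integral_of_summable_integral_norm (hFint β) hsum
  have h2 := hasSum_sum_antidiagonal h1
  simp_rw [hdiag] at h2
  rw [← h2.unique ((hasSum_hyp _ _ hab htt).mul_left N)]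
  refine integral_congr_ae (Eventually.of_forall fun ω => ?_)
  have h3 := (hasSum_mixTerm (a := a) β hA ha (mul_nonneg ht0 (hs0 ω))
      (mul_nonneg ht0 (by linarith [hs1 ω] : 0 ≤ 1 - s ω)) (by linarith)).mul_left (w ω)
  exact h3.tsum_eq.symm

end FracLap

/-! ### Beta integrals and Taylor estimates for powers -/

namespace FracLap

open MeasureTheory Filter Topology Set

lemma integrableOn_beta {a b : ℝ} (ha : 0 < a) (hb : 0 < b) :
    IntegrableOn (fun v : ℝ => v ^ (a - 1) * (1 - v) ^ (b - 1)) (Ioo 0 1) := by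
  have h := Complex.betaIntegral_convergent (u := a) (v := b) (by simpa) (by simpa)
  rw [intervalIntegrable_iff_integrableOn_Ioo_of_le zero_le_one] at h
  refine h.re.congr ?_
  filter_upwards [ae_restrict_mem measurableSet_Ioo] with x hx
  norm_cast
  rw [← Complex.ofReal_cpow, ← Complex.ofReal_cpow, RCLike.re_to_complex,
    Complex.re_mul_ofReal, Complex.ofReal_re]
  · linarith [hx.2]
  · exact hx.1.le

lemma integral_beta {a b : ℝ} (ha : 0 < a) (hb : 0 < b) :
    ∫ v in Ioo (0 : ℝ) 1, v ^ (a - 1) * (1 - v) ^ (b - 1) = ProbabilityTheory.beta a b := by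
  have h := Complex.betaIntegral_convergent (u := a) (v := b) (by simpa) (by simpa)
  rw [intervalIntegrable_iff_integrableOn_Ioo_of_le zero_le_one] at h
  rw [ProbabilityTheory.beta_eq_betaIntegralReal a b ha hb, Complex.betaIntegral,
    intervalIntegral.integral_of_le zero_le_one, integral_Ioc_eq_integral_Ioo,
    ← RCLike.re_to_complex, ← integral_re h]
  refine setIntegral_congr_fun measurableSet_Ioo fun x hx ↦ ?_
  norm_cast
  rw [← Complex.ofReal_cpow, ← Complex.ofReal_cpow, RCLike.re_to_complex,
    Complex.re_mul_ofReal, Complex.ofReal_re]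
  · linarith [hx.2]
  · exact hx.1.le

lemma image_sq_Ioo : (fun w : ℝ => w ^ 2) '' Ioo 0 1 = Ioo 0 1 := by
  ext v
  constructor
  · rintro ⟨w, ⟨h0, h1⟩, rfl⟩
    exact ⟨by positivity, by nlinarith⟩
  · rintro ⟨h0, h1⟩
    exact ⟨√v, ⟨Real.sqrt_pos.mpr h0, by rw [Real.sqrt_lt' one_pos]; simpa using h1⟩,
      Real.sq_sqrt h0.le⟩

lemma injOn_sq_Ioo : InjOn (fun w : ℝ => w ^ 2) (Ioo 0 1) := by
  intro a ha b hb h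
  exact (pow_left_inj₀ ha.1.le hb.1.le two_ne_zero).mp h

lemma beta_subst {σ p w : ℝ} (hw : w ∈ Ioo (0 : ℝ) 1) :
    |2 * w| • ((w ^ 2) ^ (σ - 1) * (1 - w ^ 2) ^ (p + 1 - 1)) =
      2 * ((1 - w ^ 2) ^ p * w ^ (2 * σ - 1)) := by
  have hw0 := hw.1
  rw [abs_of_pos (by positivity), add_sub_cancel_right, smul_eq_mul, ← Real.rpow_natCast w 2,
    ← Real.rpow_mul hw0.le, show 2 * σ - 1 = ((2 : ℕ) : ℝ) * (σ - 1) + 1 by push_cast; ring,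
    Real.rpow_add hw0, Real.rpow_one]
  ring

lemma hasDerivWithinAt_sq (w : ℝ) (s : Set ℝ) :
    HasDerivWithinAt (fun w : ℝ => w ^ 2) (2 * w) s w := by
  simpa using (hasDerivAt_pow 2 w).hasDerivWithinAt

lemma integrableOn_beta_sq {p s : ℝ} (hs : -1 < s) (hp : -1 < p) :
    IntegrableOn (fun w : ℝ => (1 - w ^ 2) ^ p * w ^ s) (Ioo 0 1) := by
  have h := integrableOn_beta (a := (s + 1) / 2) (b := p + 1) (by linarith) (by linarith)
  rw [← image_sq_Ioo, integrableOn_image_iff_integrableOn_abs_deriv_smul measurableSet_Ioo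
    (fun w _ => hasDerivWithinAt_sq w _) injOn_sq_Ioo] at h
  have h2 := h.const_mul (1 / 2)
  refine h2.congr ?_
  filter_upwards [ae_restrict_mem measurableSet_Ioo] with w hw
  rw [beta_subst hw, show 2 * ((s + 1) / 2) - 1 = s by ring]
  ring

lemma integral_beta_sq {p σ : ℝ} (hσ : 0 < σ) (hp : -1 < p) :
    ∫ w in Ioo (0 : ℝ) 1, (1 - w ^ 2) ^ p * w ^ (2 * σ - 1) =
      ProbabilityTheory.beta σ (p + 1) / 2 := by
  have h := integral_beta (a := σ) (b := p + 1) (by linarith) (by linarith)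
  rw [← image_sq_Ioo, integral_image_eq_integral_abs_deriv_smul measurableSet_Ioo
    (fun w _ => hasDerivWithinAt_sq w _) injOn_sq_Ioo,
    setIntegral_congr_fun measurableSet_Ioo fun w hw => beta_subst hw, integral_const_mul] at h
  linarith

/-- A quadratic bound for the Taylor remainder of `(1 + a)^q` at `0`. -/
lemma exists_rpow_taylor_bound (q : ℝ) {ρ : ℝ} (hρ0 : 0 ≤ ρ) (hρ : ρ < 1) :
    ∃ C, 0 ≤ C ∧ ∀ a : ℝ, |a| ≤ ρ → |(1 + a) ^ q - 1 - q * a| ≤ C * a ^ 2 := by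
  have hpos : ∀ a ∈ Icc (-ρ) ρ, 0 < 1 + a := fun a ha => by linarith [ha.1]
  obtain ⟨M, hM⟩ := (isCompact_Icc (a := -ρ) (b := ρ)).exists_bound_of_continuousOn
    (f := fun a : ℝ => q * ((q - 1) * (1 + a) ^ (q - 2))) (by
      refine continuousOn_const.mul (continuousOn_const.mul ?_)
      exact ContinuousOn.rpow_const (by fun_prop) fun a ha => Or.inl (hpos a ha).ne')
  have h0 : (0 : ℝ) ∈ Icc (-ρ) ρ := ⟨by linarith, hρ0⟩
  have hM0 : 0 ≤ M := (norm_nonneg _).trans (hM 0 h0)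
  have hd2 : ∀ a ∈ Icc (-ρ) ρ, HasDerivWithinAt (fun a : ℝ => q * ((1 + a) ^ (q - 1) - 1))
      (q * ((q - 1) * (1 + a) ^ (q - 2))) (Icc (-ρ) ρ) a := by
    intro a ha
    have h1 : HasDerivAt (fun a : ℝ => 1 + a) 1 a := by simpa using (hasDerivAt_id a).const_add 1
    have h2 := ((h1.rpow_const (p := q - 1) (Or.inl (hpos a ha).ne')).sub_const 1).const_mul q
    refine (h2.congr_deriv ?_).hasDerivWithinAt
    rw [show q - 1 - 1 = q - 2 by ring]; ring
  have hd1 : ∀ a ∈ Icc (-ρ) ρ, HasDerivWithinAt (fun a : ℝ => (1 + a) ^ q - 1 - q * a)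
      (q * ((1 + a) ^ (q - 1) - 1)) (Icc (-ρ) ρ) a := by
    intro a ha
    have h1 : HasDerivAt (fun a : ℝ => 1 + a) 1 a := by simpa using (hasDerivAt_id a).const_add 1
    have h2 := ((h1.rpow_const (p := q) (Or.inl (hpos a ha).ne')).sub_const 1).sub
      ((hasDerivAt_id a).const_mul q)
    refine (h2.congr_deriv ?_).hasDerivWithinAt
    ring
  -- The mean value inequality is used twice: here for the derivative, then for the function on
  -- `[-|a|, |a|]`.
  have hb1 : ∀ a ∈ Icc (-ρ) ρ, ‖q * ((1 + a) ^ (q - 1) - 1)‖ ≤ M * |a| := by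
    intro a ha
    have := (convex_Icc (-ρ) ρ).norm_image_sub_le_of_norm_hasDerivWithin_le hd2 hM h0 ha
    simpa using this
  refine ⟨M, hM0, fun a ha => ?_⟩
  have hsub : Icc (-|a|) |a| ⊆ Icc (-ρ) ρ := Icc_subset_Icc (by linarith) ha
  have := (convex_Icc (-|a|) |a|).norm_image_sub_le_of_norm_hasDerivWithin_le
    (C := M * |a|) (fun b hb => (hd1 b (hsub hb)).mono hsub)
    (fun b hb => (hb1 b (hsub hb)).trans
      (mul_le_mul_of_nonneg_left (abs_le.mpr hb) hM0))
    (⟨by simp, by simp⟩ : (0 : ℝ) ∈ Icc (-|a|) |a|) ⟨neg_abs_le a, le_abs_self a⟩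
  simp only [add_zero, Real.one_rpow, sub_self, mul_zero, sub_zero, Real.norm_eq_abs] at this
  rw [mul_assoc, abs_mul_abs_self, ← sq] at this
  exact this

/-- For `v ≤ 1/2` Taylor's bound gives the constant `C + |p|`; for `v > 1/2` the triangle inequality
and `1 ≤ 2v` give `2`. The term `(1 - v)^p` on the right accounts for the blow-up at `v = 1` when `p
< 0`. -/
lemma exists_one_sub_rpow_bound (p : ℝ) :
    ∃ C, 0 ≤ C ∧ ∀ v ∈ Ico (0 : ℝ) 1, |(1 - v) ^ p - 1| ≤ C * (v * ((1 - v) ^ p + 1)) := by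
  obtain ⟨C, hC0, hC⟩ := exists_rpow_taylor_bound p (ρ := 1 / 2) (by norm_num) (by norm_num)
  refine ⟨C + |p| + 2, by positivity, fun v hv => ?_⟩
  have hv0 := hv.1
  have hp0 : 0 ≤ (1 - v) ^ p := Real.rpow_nonneg (by linarith [hv.2]) p
  rcases le_or_gt v (1 / 2) with h | h
  · have h1 := hC (-v) (by rw [abs_neg, abs_of_nonneg hv0]; exact h)
    rw [← sub_eq_add_neg] at h1
    have h2 : |(1 - v) ^ p - 1| ≤ C * (-v) ^ 2 + |p| * v := by
      have : (1 - v) ^ p - 1 = ((1 - v) ^ p - 1 - p * -v) + -(p * v) := by ring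
      rw [this]
      refine (abs_add_le _ _).trans (add_le_add h1 ?_)
      rw [abs_neg, abs_mul, abs_of_nonneg hv0]
    have h3 : C * (-v) ^ 2 ≤ C * v := by
      refine mul_le_mul_of_nonneg_left ?_ hC0
      nlinarith [hv.2]
    have h4 : v ≤ v * ((1 - v) ^ p + 1) := by nlinarith [mul_nonneg hv0 hp0]
    have h5 : 0 ≤ C + |p| := by positivity
    nlinarith [mul_le_mul_of_nonneg_left h4 h5]
  · have h1 : |(1 - v) ^ p - 1| ≤ (1 - v) ^ p + 1 := by
      rw [abs_le]; constructor <;> linarith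
    have h5 : 0 ≤ C + |p| := by positivity
    have h6 : 0 ≤ v * ((1 - v) ^ p + 1) := by positivity
    nlinarith [mul_nonneg h5 h6]

end FracLap

/-! ### The Möbius kernel and the limits of its truncated integrals -/

namespace FracLap

open MeasureTheory Filter Topology Set

/-- The density `(1 - w²)^p (1 + ξ w)^(-q)` produced by a Möbius change of variables. -/
noncomputable def moebKer (p q ξ w : ℝ) : ℝ := (1 - w ^ 2) ^ p * (1 + ξ * w) ^ (-q)

/-- The remainder of `moebKer` after its first order expansion at `0`. -/
noncomputable def moebRem (p q ξ w : ℝ) : ℝ := moebKer p q ξ w - (1 - q * ξ * w)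

lemma measurable_moebRem (p q ξ : ℝ) : Measurable (moebRem p q ξ) := by
  unfold moebRem moebKer; fun_prop

/-- The linear term of the kernel at `0` comes from `(1 + ξ w)^(-q)` alone, since `(1 - w²)^p`
contributes only from order `w²` on. -/
lemma exists_moebRem_bound (p q : ℝ) {ξ : ℝ} (hξ : |ξ| < 1) :
    ∃ C, 0 ≤ C ∧ ∀ w ∈ Ioo (0 : ℝ) 1, |moebRem p q ξ w| ≤ C * (w ^ 2 * ((1 - w ^ 2) ^ p + 1)) := by
  obtain ⟨C1, hC1, h1⟩ := exists_rpow_taylor_bound (-q) (abs_nonneg ξ) hξ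
  obtain ⟨C2, hC2, h2⟩ := exists_one_sub_rpow_bound p
  refine ⟨C1 + C2 * (1 + |q|), by positivity, fun w hw => ?_⟩
  have hw0 := hw.1
  have hww : w ^ 2 < 1 := by nlinarith [hw.2]
  have hξ2 : |ξ| ≤ 1 := hξ.le
  have hP : 0 ≤ (1 - w ^ 2) ^ p := Real.rpow_nonneg (by linarith) p
  have hξw : |ξ * w| ≤ |ξ| := by
    rw [abs_mul, abs_of_pos hw0]; nlinarith [abs_nonneg ξ, hw.2]
  have e1 := h1 (ξ * w) hξw
  have e2 := h2 (w ^ 2) ⟨by positivity, hww⟩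
  have e3 : |1 - q * (ξ * w)| ≤ 1 + |q| := by
    refine (abs_sub _ _).trans ?_
    rw [abs_one, abs_mul]
    have : |q| * |ξ * w| ≤ |q| * 1 :=
      mul_le_mul_of_nonneg_left (hξw.trans hξ2) (abs_nonneg q)
    linarith
  have e4 : C1 * (ξ * w) ^ 2 ≤ C1 * w ^ 2 := by
    refine mul_le_mul_of_nonneg_left ?_ hC1
    rw [mul_pow]
    have : ξ ^ 2 ≤ 1 := by rw [← sq_abs]; nlinarith [abs_nonneg ξ]
    nlinarith [sq_nonneg w]
  have hsplit : moebRem p q ξ w = (1 - w ^ 2) ^ p * ((1 + ξ * w) ^ (-q) - 1 - -q * (ξ * w)) +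
      ((1 - w ^ 2) ^ p - 1) * (1 - q * (ξ * w)) := by
    unfold moebRem moebKer; ring
  rw [hsplit]
  refine (abs_add_le _ _).trans ?_
  rw [abs_mul, abs_mul, abs_of_nonneg hP]
  have f1 := mul_le_mul_of_nonneg_left (e1.trans e4) hP
  have f2 := mul_le_mul e2 e3 (abs_nonneg _) (by positivity)
  have f3 : 0 ≤ C1 * w ^ 2 := by positivity
  nlinarith [f1, f2, f3]

lemma integrableOn_rpow_Ioo {s : ℝ} (hs : -1 < s) :
    IntegrableOn (fun w : ℝ => w ^ s) (Ioo 0 1) := by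
  simpa using integrableOn_beta_sq (p := 0) hs (by norm_num)

/-- The factor `w²` gained by the remainder lowers the admissible exponents to `s > -3`, which
includes `s = -1 - α` because `α < 2`. -/
lemma integrableOn_moebRem {p q ξ s : ℝ} (hp : -1 < p) (hξ : |ξ| < 1) (hs : -3 < s) :
    IntegrableOn (fun w => moebRem p q ξ w * w ^ s) (Ioo 0 1) := by
  obtain ⟨C, hC, h⟩ := exists_moebRem_bound p q hξ
  have h1 := (integrableOn_beta_sq (p := p) (s := s + 2) (by linarith) hp).add
    (integrableOn_rpow_Ioo (s := s + 2) (by linarith))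
  refine Integrable.mono' (h1.const_mul C)
    ((measurable_moebRem p q ξ).mul (by fun_prop)).aestronglyMeasurable ?_
  filter_upwards [ae_restrict_mem measurableSet_Ioo] with w hw
  have hws : 0 < w ^ s := Real.rpow_pos_of_pos hw.1 s
  rw [norm_mul, Real.norm_of_nonneg hws.le, Real.norm_eq_abs]
  refine (mul_le_mul_of_nonneg_right (h w hw) hws.le).trans (le_of_eq ?_)
  simp only [Pi.add_apply]
  rw [Real.rpow_add hw.1, Real.rpow_two]
  ring

lemma integrableOn_rpow_Ioo_of_pos (s : ℝ) {δ : ℝ} (hδ : 0 < δ) :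
    IntegrableOn (fun w : ℝ => w ^ s) (Ioo δ 1) := by
  refine (ContinuousOn.integrableOn_Icc (a := δ) (b := 1) ?_).mono_set Ioo_subset_Icc_self
  exact ContinuousOn.rpow_const continuousOn_id fun x hx => Or.inl (hδ.trans_le hx.1).ne'

lemma integral_moebKer {p q ξ s δ : ℝ} (hp : -1 < p) (hξ : |ξ| < 1) (hs : -3 < s) (hδ : 0 < δ) :
    ∫ w in Ioo δ 1, moebKer p q ξ w * w ^ s = (∫ w in Ioo δ 1, w ^ s) -
      q * ξ * (∫ w in Ioo δ 1, w ^ (s + 1)) + ∫ w in Ioo δ 1, moebRem p q ξ w * w ^ s := by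
  have h1 := integrableOn_rpow_Ioo_of_pos s hδ
  have h2 := (integrableOn_rpow_Ioo_of_pos (s + 1) hδ).const_mul (q * ξ)
  have h3 := (integrableOn_moebRem (q := q) hp hξ hs).mono_set
    (Ioo_subset_Ioo_left hδ.le : Ioo δ 1 ⊆ Ioo 0 1)
  rw [← integral_const_mul, ← integral_sub' h1 h2, ← integral_add' (h1.sub h2) h3]
  refine setIntegral_congr_fun measurableSet_Ioo fun w hw => ?_
  have hw0 : 0 < w := hδ.trans hw.1
  simp only [moebRem, Pi.sub_apply, Pi.add_apply]
  rw [Real.rpow_add hw0, Real.rpow_one]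
  ring

lemma tendsto_integral_Ioo {g : ℝ → ℝ} (hg : IntegrableOn g (Ioo 0 1)) {δ : ℝ → ℝ} {l : Filter ℝ}
    [l.IsCountablyGenerated] (hδ : Tendsto δ l (𝓝 0)) (hpos : ∀ᶠ η in l, 0 < δ η) :
    Tendsto (fun η => ∫ w in Ioo (δ η) 1, g w) l (𝓝 (∫ w in Ioo 0 1, g w)) := by
  have h := (aecover_Ioo_of_Ioo (μ := volume) hδ
    (tendsto_const_nhds (x := (1 : ℝ)))).integral_tendsto_of_countably_generated hg
  refine h.congr' ?_
  filter_upwards [hpos] with η hη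
  rw [Measure.restrict_restrict_of_subset (Ioo_subset_Ioo_left hη.le)]

lemma tendsto_cutoff (ξ : ℝ) : Tendsto (fun η : ℝ => η / (1 - ξ * η)) (𝓝[>] 0) (𝓝 0) := by
  have : ContinuousAt (fun η : ℝ => η / (1 - ξ * η)) 0 := by
    refine ContinuousAt.div (by fun_prop) (by fun_prop) (by simp)
  have h := this.tendsto
  simp only [mul_zero, sub_zero, zero_div] at h
  exact h.mono_left nhdsWithin_le_nhds

lemma eventually_small : ∀ᶠ η : ℝ in 𝓝[>] 0, 0 < η ∧ η < 1 / 2 :=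
  Ioo_mem_nhdsGT (by norm_num : (0 : ℝ) < 1 / 2)

lemma half_lt_cutoff_denom {ξ η : ℝ} (hξ : |ξ| < 1) (hη : 0 < η ∧ η < 1 / 2) :
    1 / 2 < 1 - ξ * η := by
  have := (abs_lt.mp hξ).2
  nlinarith [hη.1, hη.2]

lemma cutoff_pos {ξ η : ℝ} (hξ : |ξ| < 1) (hη : 0 < η ∧ η < 1 / 2) : 0 < η / (1 - ξ * η) :=
  div_pos hη.1 (by linarith [half_lt_cutoff_denom hξ hη])

lemma tendsto_rpow_nhdsGT_zero {s : ℝ} (hs : 0 < s) :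
    Tendsto (fun η : ℝ => η ^ s) (𝓝[>] 0) (𝓝 0) := by
  have h := (Real.continuousAt_rpow_const 0 s (Or.inr hs.le)).tendsto
  rw [Real.zero_rpow hs.ne'] at h
  exact h.mono_left nhdsWithin_le_nhds

/-- The two cutoffs differ by `O(η²)` and the integrand between them is `O(η^s)`, so the difference
is `O(η^(s+2))`. -/
lemma tendsto_integral_rpow_cutoff_sub {s ξ : ℝ} (hs : -2 < s) (hs0 : s ≤ 0) (hξ : |ξ| < 1) :
    Tendsto (fun η : ℝ => (∫ w in Ioo (η / (1 - ξ * η)) 1, w ^ s) -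
      ∫ w in Ioo (η / (1 - -ξ * η)) 1, w ^ s) (𝓝[>] 0) (𝓝 0) := by
  have hlim : Tendsto (fun η : ℝ => (1 / 2) ^ s * 4 * η ^ (s + 2)) (𝓝[>] 0) (𝓝 0) := by
    have := (tendsto_rpow_nhdsGT_zero (by linarith : 0 < s + 2)).const_mul ((1 / 2 : ℝ) ^ s * 4)
    rwa [mul_zero] at this
  refine squeeze_zero_norm' ?_ hlim
  filter_upwards [eventually_small, (tendsto_cutoff ξ).eventually_lt_const zero_lt_one,
    (tendsto_cutoff (-ξ)).eventually_lt_const zero_lt_one] with η hη ha1 hb1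
  have hξ' : |-ξ| < 1 := by rwa [abs_neg]
  have ha := cutoff_pos hξ hη
  have hb := cutoff_pos hξ' hη
  have da := half_lt_cutoff_denom hξ hη
  have db := half_lt_cutoff_denom hξ' hη
  have hlow : ∀ ζ : ℝ, |ζ| < 1 → η / 2 ≤ η / (1 - ζ * η) := by
    intro ζ hζ
    have := half_lt_cutoff_denom hζ hη
    have h2 := (abs_lt.mp hζ).1
    apply div_le_div_of_nonneg_left hη.1.le (by linarith)
    nlinarith [hη.1, hη.2]
  have hint : ∀ a b : ℝ, 0 < a → 0 < b → IntervalIntegrable (fun w : ℝ => w ^ s) volume a b := by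
    intro a b ha hb
    refine intervalIntegral.intervalIntegrable_rpow (Or.inr ?_)
    exact fun h => by
      have := (lt_min ha hb).trans_le h.1; exact lt_irrefl _ this
  rw [← integral_Ioc_eq_integral_Ioo, ← integral_Ioc_eq_integral_Ioo,
    ← intervalIntegral.integral_of_le ha1.le, ← intervalIntegral.integral_of_le hb1.le,
    intervalIntegral.integral_interval_sub_interval_comm (hint _ _ ha one_pos)
      (hint _ _ hb one_pos) (hint _ _ ha hb), intervalIntegral.integral_same, sub_zero]
  have hbd := intervalIntegral.norm_integral_le_of_norm_le_const
    (a := η / (1 - ξ * η)) (b := η / (1 - -ξ * η)) (f := fun w : ℝ => w ^ s) (C := (η / 2) ^ s) (by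
      intro w hw
      have hw1 : η / 2 ≤ w := (le_min (hlow ξ hξ) (hlow (-ξ) hξ')).trans hw.1.le
      have : 0 < η / 2 := by linarith [hη.1]
      rw [Real.norm_of_nonneg (Real.rpow_nonneg (this.le.trans hw1) s)]
      exact Real.rpow_le_rpow_of_nonpos this hw1 hs0)
  refine hbd.trans ?_
  -- The numerator is at most `2 η²` and the denominator `1 - (ξ η)²` at least `1/2`.
  have e1 : |η / (1 - -ξ * η) - η / (1 - ξ * η)| ≤ 4 * η ^ 2 := by
    rw [div_sub_div _ _ (by linarith) (by linarith), abs_div,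
      abs_of_pos (by nlinarith : 0 < (1 - -ξ * η) * (1 - ξ * η)), div_le_iff₀ (by nlinarith)]
    have : η * (1 - ξ * η) - (1 - -ξ * η) * η = -(2 * ξ * η ^ 2) := by ring
    rw [this, abs_neg, abs_mul, abs_mul, abs_of_nonneg (sq_nonneg η), abs_two]
    have h3 : (1 - -ξ * η) * (1 - ξ * η) = 1 - (ξ * η) ^ 2 := by ring
    have h4 : (ξ * η) ^ 2 ≤ 1 / 2 := by
      rw [mul_pow]
      have : ξ ^ 2 ≤ 1 := by rw [← sq_abs]; nlinarith [abs_nonneg ξ]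
      have : η ^ 2 ≤ 1 / 4 := by nlinarith [hη.1, hη.2]
      nlinarith [sq_nonneg ξ, sq_nonneg η]
    rw [h3]
    nlinarith [sq_nonneg η, abs_nonneg ξ]
  calc (η / 2) ^ s * |η / (1 - -ξ * η) - η / (1 - ξ * η)| ≤ (η / 2) ^ s * (4 * η ^ 2) :=
        mul_le_mul_of_nonneg_left e1 (Real.rpow_nonneg (by linarith [hη.1]) s)
    _ = _ := by
        rw [show η / 2 = (1 / 2) * η by ring, Real.mul_rpow (by norm_num) hη.1.le,
          Real.rpow_add hη.1, Real.rpow_two]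
        ring

/-- The linear terms in `ξ η` cancel, and the quadratic remainder beats `η^(-α)` because `α < 2`. -/
lemma tendsto_rpow_second_difference {α : ℝ} (hα2 : α < 2) {ξ : ℝ} (hξ : |ξ| < 1) :
    Tendsto (fun η : ℝ => η ^ (-α) * ((1 - ξ * η) ^ α + (1 - -ξ * η) ^ α - 2)) (𝓝[>] 0) (𝓝 0) := by
  obtain ⟨C, hC, h⟩ := exists_rpow_taylor_bound α (ρ := 1 / 2) (by norm_num) (by norm_num)
  have hlim : Tendsto (fun η : ℝ => (2 * C) * η ^ (-α + 2)) (𝓝[>] 0) (𝓝 0) := by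
    simpa using (tendsto_rpow_nhdsGT_zero (by linarith : 0 < -α + 2)).const_mul (2 * C)
  refine squeeze_zero_norm' ?_ hlim
  filter_upwards [eventually_small] with η hη
  have hb : |ξ * η| ≤ 1 / 2 := by
    rw [abs_mul, abs_of_pos hη.1]; nlinarith [hη.1, hη.2, abs_nonneg ξ]
  have hξ2 : ξ ^ 2 ≤ 1 := by rw [← sq_abs]; nlinarith [abs_nonneg ξ]
  have h1 := h (ξ * η) hb
  have h2 := h (-(ξ * η)) (by rwa [abs_neg])
  have hpw := Real.rpow_nonneg hη.1.le (-α)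
  have hsq : C * (ξ * η) ^ 2 ≤ C * η ^ 2 := by
    refine mul_le_mul_of_nonneg_left ?_ hC
    rw [mul_pow]; nlinarith [sq_nonneg η]
  rw [norm_mul, Real.norm_of_nonneg hpw, Real.rpow_add hη.1, Real.rpow_two, mul_left_comm]
  refine mul_le_mul_of_nonneg_left ?_ hpw
  have e : (1 - ξ * η) ^ α + (1 - -ξ * η) ^ α - 2 = ((1 + -(ξ * η)) ^ α - 1 - α * -(ξ * η)) +
      ((1 + ξ * η) ^ α - 1 - α * (ξ * η)) := by
    rw [show 1 - -ξ * η = 1 + ξ * η by ring, show 1 - ξ * η = 1 + -(ξ * η) by ring]; ring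
  rw [e, Real.norm_eq_abs]
  refine (abs_add_le _ _).trans ?_
  rw [neg_sq] at h2
  linarith

/-- A common cutoff in the original variable becomes two different cutoffs for `ξ` and `-ξ`; their
mismatch disappears in the limit. The divergence is `2 η^(-α) / α`, and `-2/α` is the contribution
of `w = 1` to the two integrals of `w^(-1-α)`. -/
lemma tendsto_moeb_even {p q α ξ : ℝ} (hp : -1 < p) (hα0 : 0 < α) (hα2 : α < 2) (hξ : |ξ| < 1) :
    Tendsto (fun η : ℝ => (∫ w in Ioo (η / (1 - ξ * η)) 1, moebKer p q ξ w * w ^ (-1 - α)) +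
      (∫ w in Ioo (η / (1 - -ξ * η)) 1, moebKer p q (-ξ) w * w ^ (-1 - α)) -
        2 * η ^ (-α) / α) (𝓝[>] 0)
      (𝓝 (-2 / α + ∫ w in Ioo 0 1, (moebRem p q ξ w + moebRem p q (-ξ) w) * w ^ (-1 - α))) := by
  have hξ' : |-ξ| < 1 := by rwa [abs_neg]
  have hpos : ∀ ζ : ℝ, |ζ| < 1 → ∀ᶠ η : ℝ in 𝓝[>] 0, 0 < η / (1 - ζ * η) := fun ζ hζ => by
    filter_upwards [eventually_small] with η hη using cutoff_pos hζ hη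
  have i1 := integrableOn_moebRem (q := q) hp hξ (by linarith : -3 < -1 - α)
  have i2 := integrableOn_moebRem (q := q) hp hξ' (by linarith : -3 < -1 - α)
  have t1 := tendsto_integral_Ioo i1 (tendsto_cutoff ξ) (hpos ξ hξ)
  have t2 := tendsto_integral_Ioo i2 (tendsto_cutoff (-ξ)) (hpos (-ξ) hξ')
  have t3 := (tendsto_integral_rpow_cutoff_sub (s := -α) (by linarith) (by linarith) hξ).const_mul
    (-(q * ξ))
  have t4 := (tendsto_rpow_second_difference hα2 hξ).const_mul (1 / α)
  have t := (((t1.add t2).add t3).add t4).add_const (-2 / α)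
  have e : (∫ w in Ioo 0 1, moebRem p q ξ w * w ^ (-1 - α)) +
      (∫ w in Ioo 0 1, moebRem p q (-ξ) w * w ^ (-1 - α)) + -(q * ξ) * 0 + 1 / α * 0 + -2 / α =
      -2 / α + ∫ w in Ioo 0 1, (moebRem p q ξ w + moebRem p q (-ξ) w) * w ^ (-1 - α) := by
    simp_rw [add_mul]
    rw [integral_add i1 i2]; ring
  rw [e] at t
  refine t.congr' ?_
  filter_upwards [eventually_small, (tendsto_cutoff ξ).eventually_lt_const zero_lt_one,
    (tendsto_cutoff (-ξ)).eventually_lt_const zero_lt_one] with η hη ha1 hb1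
  have hpw : ∀ ζ : ℝ, |ζ| < 1 → η / (1 - ζ * η) < 1 → ∫ w in Ioo (η / (1 - ζ * η)) 1, w ^ (-1 - α)
      = (η ^ (-α) * (1 - ζ * η) ^ α - 1) / α := by
    intro ζ hζ h1
    have hd := half_lt_cutoff_denom hζ hη
    have h0 := cutoff_pos hζ hη
    rw [← integral_Ioc_eq_integral_Ioo, ← intervalIntegral.integral_of_le h1.le,
      integral_rpow (Or.inr ⟨by linarith, fun h => by
        have := (lt_min h0 one_pos).trans_le h.1; exact lt_irrefl _ this⟩)]
    rw [show -1 - α + 1 = -α by ring, Real.one_rpow, Real.div_rpow hη.1.le (by linarith),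
      Real.rpow_neg (by linarith : 0 ≤ 1 - ζ * η), div_inv_eq_mul]
    field_simp
    ring
  rw [integral_moebKer hp hξ (by linarith) (cutoff_pos hξ hη),
    integral_moebKer hp hξ' (by linarith) (cutoff_pos hξ' hη), hpw ξ hξ ha1, hpw (-ξ) hξ' hb1,
    show -1 - α + 1 = -α by ring]
  field_simp
  ring

/-- The constant terms of the two kernels cancel up to the mismatch of the cutoffs, and the linear
terms are integrable against `w^(-α)`. Hence no counterterm is needed, even for `α ≥ 1`. -/
lemma tendsto_moeb_odd {p q α ξ : ℝ} (hp : -1 < p) (hα0 : 0 < α) (hα2 : α < 2) (hξ : |ξ| < 1) :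
    Tendsto (fun η : ℝ => (∫ w in Ioo (η / (1 - ξ * η)) 1, moebKer p q ξ w * w ^ (-α)) -
      (∫ w in Ioo (η / (1 - -ξ * η)) 1, moebKer p q (-ξ) w * w ^ (-α))) (𝓝[>] 0)
      (𝓝 (∫ w in Ioo 0 1, (moebKer p q ξ w - moebKer p q (-ξ) w) * w ^ (-α))) := by
  have hξ' : |-ξ| < 1 := by rwa [abs_neg]
  have hpos : ∀ ζ : ℝ, |ζ| < 1 → ∀ᶠ η : ℝ in 𝓝[>] 0, 0 < η / (1 - ζ * η) := fun ζ hζ => by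
    filter_upwards [eventually_small] with η hη using cutoff_pos hζ hη
  have i1 := integrableOn_moebRem (q := q) hp hξ (by linarith : -3 < -α)
  have i2 := integrableOn_moebRem (q := q) hp hξ' (by linarith : -3 < -α)
  have i3 := integrableOn_rpow_Ioo (by linarith : -1 < -α + 1)
  have t1 := tendsto_integral_Ioo i1 (tendsto_cutoff ξ) (hpos ξ hξ)
  have t2 := tendsto_integral_Ioo i2 (tendsto_cutoff (-ξ)) (hpos (-ξ) hξ')
  have t3 := (tendsto_integral_Ioo i3 (tendsto_cutoff ξ) (hpos ξ hξ)).const_mul (q * ξ)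
  have t4 := (tendsto_integral_Ioo i3 (tendsto_cutoff (-ξ)) (hpos (-ξ) hξ')).const_mul (q * ξ)
  have t5 := tendsto_integral_rpow_cutoff_sub (s := -α) (by linarith) (by linarith) hξ
  have t := (((t1.sub t2).sub t3).sub t4).add t5
  have e : (∫ w in Ioo 0 1, moebRem p q ξ w * w ^ (-α)) -
      (∫ w in Ioo 0 1, moebRem p q (-ξ) w * w ^ (-α)) -
      q * ξ * (∫ w in Ioo (0 : ℝ) 1, w ^ (-α + 1)) -
      q * ξ * (∫ w in Ioo (0 : ℝ) 1, w ^ (-α + 1)) + 0 =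
      ∫ w in Ioo 0 1, (moebKer p q ξ w - moebKer p q (-ξ) w) * w ^ (-α) := by
    rw [← integral_sub' i1 i2, ← integral_const_mul, ← integral_sub' (i1.sub i2) (i3.const_mul _),
      ← integral_sub' ((i1.sub i2).sub (i3.const_mul _)) (i3.const_mul _), add_zero]
    refine setIntegral_congr_fun measurableSet_Ioo fun w hw => ?_
    simp only [moebRem, Pi.sub_apply]
    rw [Real.rpow_add hw.1, Real.rpow_one]
    ring
  rw [e] at t
  refine t.congr' ?_
  filter_upwards [eventually_small] with η hη
  rw [integral_moebKer hp hξ (by linarith) (cutoff_pos hξ hη),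
    integral_moebKer hp hξ' (by linarith) (cutoff_pos hξ' hη)]
  ring

end FracLap

/-! ### Evaluation of the regularised integrals as hypergeometric series -/

namespace FracLap

open MeasureTheory Filter Topology Set

lemma moebRem_zero_zero (p w : ℝ) : moebRem p 0 0 w = (1 - w ^ 2) ^ p - 1 := by
  simp [moebRem, moebKer]

lemma neg_half_add_ne_zero {α : ℝ} (hα0 : 0 < α) (hα2 : α < 2) (j : ℕ) : -α / 2 + j ≠ 0 := by
  rcases j with _ | j
  · simp only [Nat.cast_zero, add_zero]; intro h; linarith
  · have : (0 : ℝ) ≤ j := j.cast_nonneg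
    push_cast; intro h; linarith

/-- The functional equation of `Γ` in numerator and denominator; it links the regularised beta value
at `-α/2` to a convergent beta integral. -/
lemma beta_shift {α p : ℝ} (hα0 : 0 < α) (hα2 : α < 2) (hp : -1 < p) :
    -(2 * p + 2 - α) / α * ProbabilityTheory.beta (1 - α / 2) (p + 1) =
      ProbabilityTheory.beta (-α / 2) (p + 1) := by
  unfold ProbabilityTheory.beta
  have h1 : Real.Gamma (1 - α / 2) = -α / 2 * Real.Gamma (-α / 2) := by
    rw [← Real.Gamma_add_one (by linarith : -α / 2 ≠ 0)]; congr 1; ring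
  rw [h1]
  by_cases hc : -α / 2 + (p + 1) = 0
  -- If `p + 1 = α/2` the left side vanishes through its factor `2p + 2 - α`, the right side through
  -- the convention `Γ(0) = 0` and division by zero.
  · rw [hc, Real.Gamma_zero, show 2 * p + 2 - α = 0 by linarith]; simp
  · have h2 : Real.Gamma (1 - α / 2 + (p + 1)) =
        (-α / 2 + (p + 1)) * Real.Gamma (-α / 2 + (p + 1)) := by
      rw [← Real.Gamma_add_one hc]; congr 1; ring
    have h3 : Real.Gamma (-α / 2 + (p + 1)) ≠ 0 := by
      intro h
      obtain ⟨m, hm⟩ := (Real.Gamma_eq_zero_iff _).mp h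
      rcases m with _ | m
      · exact hc (by simpa using hm)
      · have : (0 : ℝ) ≤ m := m.cast_nonneg
        push_cast at hm; linarith
    rw [h2, show 2 * p + 2 - α = 2 * (-α / 2 + (p + 1)) by ring]
    generalize Real.Gamma (-α / 2) = x
    generalize -α / 2 + (p + 1) = c at hc h3 ⊢
    generalize Real.Gamma c = y at h3 ⊢
    field_simp

/-- The beta integral at the negative argument `-α / 2`, as a regularised integral. -/
lemma integral_beta_regularized {α p : ℝ} (hα0 : 0 < α) (hα2 : α < 2) (hp : -1 < p) :
    -2 / α + 2 * ∫ w in Ioo (0 : ℝ) 1, moebRem p 0 0 w * w ^ (-1 - α) =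
      ProbabilityTheory.beta (-α / 2) (p + 1) := by
  have i1 : IntegrableOn (fun w => moebRem p 0 0 w * w ^ (-1 - α)) (Ioo 0 1) :=
    integrableOn_moebRem hp (by simp) (by linarith)
  have i2 := integrableOn_beta_sq (p := p) (s := 1 - α) (by linarith) hp
  have hint : IntervalIntegrable (fun w => -α * (moebRem p 0 0 w * w ^ (-1 - α)) -
      (2 * p + 2 - α) * ((1 - w ^ 2) ^ p * w ^ (1 - α))) volume 0 1 := by
    rw [intervalIntegrable_iff_integrableOn_Ioo_of_le zero_le_one]
    exact (i1.const_mul _).sub (i2.const_mul _)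
  -- Integration by parts: this primitive tends to `0` at `0` and to `-1` at `1`, and its derivative
  -- combines the regularised integrand with a convergent beta integrand of parameter `1 - α/2`.
  have hderiv : ∀ w ∈ Ioo (0 : ℝ) 1,
      HasDerivAt (fun w : ℝ => w ^ (-α) * ((1 - w ^ 2) ^ (p + 1) - 1))
        (-α * (moebRem p 0 0 w * w ^ (-1 - α)) -
          (2 * p + 2 - α) * ((1 - w ^ 2) ^ p * w ^ (1 - α))) w := by
    intro w hw
    have hw1 : 0 < 1 - w ^ 2 := by nlinarith [hw.1, hw.2]
    have d1 := Real.hasDerivAt_rpow_const (x := w) (p := -α) (Or.inl hw.1.ne')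
    have d2 : HasDerivAt (fun w : ℝ => 1 - w ^ 2) (-(2 * w)) w := by
      simpa using (hasDerivAt_pow 2 w).const_sub 1
    have d3 := (d2.rpow_const (p := p + 1) (Or.inl hw1.ne')).sub_const 1
    refine (d1.mul d3).congr_deriv ?_
    rw [moebRem_zero_zero, show -α - 1 = -1 - α by ring, show p + 1 - 1 = p by ring,
      Real.rpow_add hw1, Real.rpow_one, show 1 - α = -1 - α + 2 by ring,
      Real.rpow_add hw.1, Real.rpow_two, show -α = -1 - α + 1 by ring, Real.rpow_add hw.1,
      Real.rpow_one]
    ring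
  have lim0 : Tendsto (fun w : ℝ => w ^ (-α) * ((1 - w ^ 2) ^ (p + 1) - 1)) (𝓝[>] 0) (𝓝 0) := by
    obtain ⟨C, hC, h⟩ := exists_one_sub_rpow_bound (p + 1)
    have hlim : Tendsto (fun w : ℝ => (2 * C) * w ^ (-α + 2)) (𝓝[>] 0) (𝓝 0) := by
      simpa using (tendsto_rpow_nhdsGT_zero (by linarith : 0 < -α + 2)).const_mul (2 * C)
    refine squeeze_zero_norm' ?_ hlim
    filter_upwards [Ioo_mem_nhdsGT (zero_lt_one (α := ℝ))] with w hw
    have hw1 : 0 < 1 - w ^ 2 := by nlinarith [hw.1, hw.2]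
    have h1 := h (w ^ 2) ⟨by positivity, by linarith⟩
    have h2 : (1 - w ^ 2) ^ (p + 1) ≤ 1 :=
      Real.rpow_le_one hw1.le (by nlinarith [hw.1]) (by linarith)
    have hpw := Real.rpow_nonneg hw.1.le (-α)
    rw [norm_mul, Real.norm_of_nonneg hpw, Real.norm_eq_abs, Real.rpow_add hw.1, Real.rpow_two,
      mul_left_comm]
    refine mul_le_mul_of_nonneg_left (h1.trans ?_) hpw
    have h3 : 0 ≤ C * w ^ 2 := by positivity
    nlinarith
  have lim1 : Tendsto (fun w : ℝ => w ^ (-α) * ((1 - w ^ 2) ^ (p + 1) - 1)) (𝓝[<] 1)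
      (𝓝 (-1)) := by
    have hc : ContinuousAt (fun w : ℝ => w ^ (-α) * ((1 - w ^ 2) ^ (p + 1) - 1)) 1 := by
      refine ContinuousAt.mul (Real.continuousAt_rpow_const _ _ (Or.inl one_ne_zero))
        (ContinuousAt.sub (ContinuousAt.rpow_const (by fun_prop) (Or.inr (by linarith)))
          continuousAt_const)
    have := hc.tendsto
    simp only [Real.one_rpow, one_pow, sub_self, one_mul,
      Real.zero_rpow (by linarith : p + 1 ≠ 0), zero_sub] at this
    exact this.mono_left nhdsWithin_le_nhds
  have key := intervalIntegral.integral_eq_sub_of_hasDerivAt_of_tendsto zero_lt_one hderiv hint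
    lim0 lim1
  rw [intervalIntegral.integral_of_le zero_le_one, integral_Ioc_eq_integral_Ioo,
    integral_sub (i1.const_mul _) (i2.const_mul _), integral_const_mul, integral_const_mul,
    show (1 : ℝ) - α = 2 * (1 - α / 2) - 1 by ring, integral_beta_sq (by linarith) hp] at key
  rw [← beta_shift hα0 hα2 hp]
  generalize ProbabilityTheory.beta (1 - α / 2) (p + 1) = b at key ⊢
  field_simp
  linarith

/-- Identifies the `n`th term of the even expansion. Duplication splits `(2p-α+1)_(2n)` into two
rising factorials; one of them cancels against the denominator of the beta value. -/
lemma beta_mul_poch_even {α p : ℝ} (hα0 : 0 < α) (hα2 : α < 2) (hp : -1 < p) {n : ℕ}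
    (hn : n ≠ 0) :
    poch (2 * p - α + 1) (2 * n) / (2 * n).factorial *
        ProbabilityTheory.beta (-α / 2 + n) (p + 1) =
      ProbabilityTheory.beta (-α / 2) (p + 1) *
        hypCoeff (-α / 2) (1 / 2 + p - α / 2) (1 / 2) n := by
  unfold ProbabilityTheory.beta hypCoeff
  by_cases hc : -α / 2 + (p + 1) = 0
  -- In this degenerate case `2p - α + 1 = -1`, so a rising factorial with at least two factors
  -- vanishes.
  · have h0 : poch (2 * p - α + 1) (2 * n) = 0 := by
      obtain ⟨k, rfl⟩ := Nat.exists_eq_succ_of_ne_zero hn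
      rw [show 2 * (k + 1) = 2 + 2 * k by ring, poch_add, show 2 * p - α + 1 = -1 by linarith]
      simp [poch_succ]
    rw [h0, hc, Real.Gamma_zero]; simp
  · have hcj : ∀ j : ℕ, -α / 2 + (p + 1) + j ≠ 0 := by
      intro j
      rcases j with _ | j
      · simpa using hc
      · have : (0 : ℝ) ≤ j := j.cast_nonneg
        push_cast; intro h; linarith
    have hG : Real.Gamma (-α / 2 + (p + 1)) ≠ 0 := by
      intro h
      obtain ⟨m, hm⟩ := (Real.Gamma_eq_zero_iff _).mp h
      exact hcj m (by linarith)
    have hP := poch_ne_zero hcj n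
    have hh := (poch_pos (by norm_num : (0 : ℝ) < 1 / 2) n).ne'
    rw [Gamma_add_nat (neg_half_add_ne_zero hα0 hα2),
      show -α / 2 + n + (p + 1) = -α / 2 + (p + 1) + n by ring, Gamma_add_nat hcj,
      show 2 * p - α + 1 = 2 * (1 / 2 + p - α / 2) by ring, poch_double, factorial_double,
      show 1 / 2 + p - α / 2 + 1 / 2 = -α / 2 + (p + 1) by ring]
    generalize 1 / 2 + p - α / 2 = x
    generalize -α / 2 + (p + 1) = c at hP hG ⊢
    generalize -α / 2 = y
    field_simp

lemma beta_mul_poch_odd {α p : ℝ} (hα0 : 0 < α) (hα2 : α < 2) (hp : -1 < p) (n : ℕ) :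
    -(poch (2 * p + 2 - α) (2 * n + 1) / (2 * n + 1).factorial *
        ProbabilityTheory.beta (1 - α / 2 + n) (p + 1)) =
      α * ProbabilityTheory.beta (-α / 2) (p + 1) *
        hypCoeff (1 - α / 2) (3 / 2 + p - α / 2) (3 / 2) n := by
  rw [← beta_shift hα0 hα2 hp]
  unfold ProbabilityTheory.beta hypCoeff
  have hj : ∀ c : ℝ, 0 < c → ∀ j : ℕ, c + j ≠ 0 := fun c hc j => by positivity
  have hc : 0 < 1 - α / 2 + (p + 1) := by linarith
  have hP := poch_ne_zero (hj _ hc) n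
  have hG := (Real.Gamma_pos_of_pos hc).ne'
  have hh := (poch_pos (by norm_num : (0 : ℝ) < 3 / 2) n).ne'
  rw [Gamma_add_nat (hj _ (by linarith : 0 < 1 - α / 2)),
    show 1 - α / 2 + n + (p + 1) = 1 - α / 2 + (p + 1) + n by ring, Gamma_add_nat (hj _ hc),
    poch_succ_left, show 2 * p + 2 - α + 1 = 2 * (3 / 2 + p - α / 2) by ring, poch_double,
    factorial_double_add_one,
    show 3 / 2 + p - α / 2 + 1 / 2 = 1 - α / 2 + (p + 1) by ring]
  generalize 3 / 2 + p - α / 2 = x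
  generalize 1 - α / 2 + (p + 1) = c at hP hG ⊢
  generalize 1 - α / 2 = y
  field_simp

lemma hasSum_binomial_even {x : ℝ} (q : ℝ) (hx : |x| < 1) :
    HasSum (fun k => 2 * (poch q (2 * k) / (2 * k).factorial) * x ^ (2 * k))
      ((1 + x) ^ (-q) + (1 - x) ^ (-q)) := by
  have h1 := hasSum_binomial q hx
  have h2 := hasSum_binomial q (x := -x) (by rwa [abs_neg])
  rw [sub_neg_eq_add] at h2
  have h := h2.add h1
  rw [← (mul_right_injective₀ (two_ne_zero (α := ℕ))).hasSum_iff] at h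
  · refine h.congr_fun fun k => ?_
    simp only [Function.comp_apply]
    rw [(even_two_mul k).neg_pow]
    ring
  · intro n hn
    have : Odd n := by
      rw [← Nat.not_even_iff_odd]
      rintro ⟨k, hk⟩
      exact hn ⟨k, by simp only; omega⟩
    rw [this.neg_pow]; ring

lemma hasSum_binomial_odd {x : ℝ} (q : ℝ) (hx : |x| < 1) :
    HasSum (fun k => -(2 * (poch q (2 * k + 1) / (2 * k + 1).factorial)) * x ^ (2 * k + 1))
      ((1 + x) ^ (-q) - (1 - x) ^ (-q)) := by
  have h1 := hasSum_binomial q hx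
  have h2 := hasSum_binomial q (x := -x) (by rwa [abs_neg])
  rw [sub_neg_eq_add] at h2
  have h := h2.sub h1
  have hinj : Function.Injective fun k : ℕ => 2 * k + 1 := fun a b h => by simp only at h; omega
  rw [← hinj.hasSum_iff] at h
  · refine h.congr_fun fun k => ?_
    simp only [Function.comp_apply]
    rw [(odd_two_mul_add_one k).neg_pow]
    ring
  · intro n hn
    have : Even n := by
      rw [← Nat.not_odd_iff_even]
      rintro ⟨k, hk⟩
      exact hn ⟨k, by simp only; omega⟩
    rw [this.neg_pow]; ring

/-- The sum over `ξ` and `-ξ` has only even powers of `w`. Those with `k ≥ 1` integrate to beta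
values; the power `k = 0` is handled by `integral_beta_regularized`. -/
lemma integral_moebRem_even {α p ξ : ℝ} (hα0 : 0 < α) (hα2 : α < 2) (hp : -1 < p)
    (hξ : |ξ| < 1) :
    -2 / α + ∫ w in Ioo 0 1, (moebRem p (2 * p - α + 1) ξ w +
        moebRem p (2 * p - α + 1) (-ξ) w) * w ^ (-1 - α) =
      ProbabilityTheory.beta (-α / 2) (p + 1) *
        ordinaryHypergeometric (-α / 2) (1 / 2 + p - α / 2) (1 / 2) (ξ ^ 2) := by
  set q := 2 * p - α + 1 with hq
  set B := ProbabilityTheory.beta (-α / 2) (p + 1) with hB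
  have hξ' : |-ξ| < 1 := by rwa [abs_neg]
  have hξ2 : |ξ ^ 2| < 1 := by rw [abs_pow]; exact pow_lt_one₀ (abs_nonneg ξ) hξ two_ne_zero
  have i0 : IntegrableOn (fun w => moebRem p 0 0 w * w ^ (-1 - α)) (Ioo 0 1) :=
    integrableOn_moebRem hp (by simp) (by linarith)
  have i1 : IntegrableOn (fun w => (moebRem p q ξ w + moebRem p q (-ξ) w) * w ^ (-1 - α))
      (Ioo 0 1) := by
    simp_rw [add_mul]
    exact (integrableOn_moebRem hp hξ (by linarith)).add
      (integrableOn_moebRem hp hξ' (by linarith))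
  set T : ℕ → ℝ → ℝ := fun k w => 2 * (poch q (2 * (k + 1)) / (2 * (k + 1)).factorial) *
    ξ ^ (2 * (k + 1)) * ((1 - w ^ 2) ^ p * w ^ (2 * (-α / 2 + ((k + 1 : ℕ) : ℝ)) - 1)) with hT
  have hσ : ∀ k : ℕ, 0 < -α / 2 + ((k + 1 : ℕ) : ℝ) := fun k => by
    have : (0 : ℝ) ≤ k := k.cast_nonneg
    push_cast; linarith
  have iT : ∀ k, IntegrableOn (T k) (Ioo 0 1) := fun k =>
    (integrableOn_beta_sq (by linarith [hσ k]) hp).const_mul _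
  have vT : ∀ k, ∫ w in Ioo 0 1, T k w =
      B * (hypCoeff (-α / 2) (1 / 2 + p - α / 2) (1 / 2) (k + 1) * (ξ ^ 2) ^ (k + 1)) := by
    intro k
    simp only [hT]
    rw [integral_const_mul, integral_beta_sq (hσ k) hp, ← mul_assoc B, hB,
      ← beta_mul_poch_even hα0 hα2 hp k.succ_ne_zero, pow_mul]
    ring
  -- Each term has constant sign on `(0, 1)`, so the summability of the norms follows from the
  -- absolute convergence of the resulting hypergeometric series.
  have vTn : ∀ k, ∫ w in Ioo 0 1, ‖T k w‖ = ‖∫ w in Ioo 0 1, T k w‖ := by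
    intro k
    have hn : ∀ w ∈ Ioo (0 : ℝ) 1, ‖T k w‖ = |2 * (poch q (2 * (k + 1)) / (2 * (k + 1)).factorial) *
        ξ ^ (2 * (k + 1))| * ((1 - w ^ 2) ^ p * w ^ (2 * (-α / 2 + ((k + 1 : ℕ) : ℝ)) - 1)) := by
      intro w hw
      have h1 : 0 ≤ 1 - w ^ 2 := by nlinarith [hw.1, hw.2]
      have h2 := Real.rpow_nonneg h1 p
      have h3 := Real.rpow_nonneg hw.1.le (2 * (-α / 2 + ((k + 1 : ℕ) : ℝ)) - 1)
      simp only [hT]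
      rw [Real.norm_eq_abs, abs_mul, abs_of_nonneg (mul_nonneg h2 h3)]
    rw [setIntegral_congr_fun measurableSet_Ioo hn, integral_const_mul]
    simp only [hT]
    rw [integral_const_mul, norm_mul, Real.norm_eq_abs, integral_beta_sq (hσ k) hp,
      Real.norm_of_nonneg (div_pos (ProbabilityTheory.beta_pos (hσ k) (by linarith)) two_pos).le]
  have hs := (hasSum_hyp (-α / 2) (1 / 2 + p - α / 2) one_half_pos hξ2).mul_left B
  have hs1 := (hasSum_nat_add_iff' 1).mpr hs
  have hsumT : Summable fun k => ∫ w in Ioo 0 1, ‖T k w‖ := by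
    simp_rw [vTn, vT]
    exact hs1.summable.norm
  have hI := hasSum_integral_of_summable_integral_norm iT hsumT
  simp_rw [vT] at hI
  have hval := hI.unique hs1
  -- Removing the `k = 0` term leaves the remainders minus `2 ((1 - w²)^p - 1)`, because each
  -- remainder has already lost its constant `1`.
  have hpt : ∀ w ∈ Ioo (0 : ℝ) 1, ∑' k, T k w =
      (moebRem p q ξ w + moebRem p q (-ξ) w) * w ^ (-1 - α) -
        2 * (moebRem p 0 0 w * w ^ (-1 - α)) := by
    intro w hw
    have hx : |ξ * w| < 1 := by
      rw [abs_mul, abs_of_pos hw.1]; nlinarith [abs_nonneg ξ, hw.2, hw.1]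
    have h := (hasSum_nat_add_iff' 1).mpr (hasSum_binomial_even q hx)
    have h2 := h.mul_left ((1 - w ^ 2) ^ p * w ^ (-1 - α))
    have h3 : HasSum (fun k => T k w) _ := h2.congr_fun fun k => by
      simp only [hT]
      rw [show 2 * (-α / 2 + ((k + 1 : ℕ) : ℝ)) - 1 = -1 - α + ((2 * (k + 1) : ℕ) : ℝ) by
        push_cast; ring, Real.rpow_add hw.1, Real.rpow_natCast, mul_pow]
      ring
    rw [h3.tsum_eq, moebRem_zero_zero]
    simp only [moebRem, moebKer, Finset.sum_range_one]
    simp only [mul_zero, poch_zero, Nat.factorial_zero, Nat.cast_one, pow_zero]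
    rw [show 1 + -ξ * w = 1 - ξ * w by ring]
    ring
  rw [setIntegral_congr_fun measurableSet_Ioo hpt, integral_sub i1 (i0.const_mul 2),
    integral_const_mul] at hval
  have hreg := integral_beta_regularized hα0 hα2 hp
  simp only [Finset.sum_range_one, hypCoeff_zero, pow_zero, mul_one] at hval
  rw [← hB] at hreg
  linarith

/-- Only odd powers of `w` survive. All of them are integrable against `w^(-α)` since `α < 2`, so
nothing has to be regularised. -/
lemma integral_moebKer_odd {α p ξ : ℝ} (hα0 : 0 < α) (hα2 : α < 2) (hp : -1 < p)
    (hξ : |ξ| < 1) :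
    ∫ w in Ioo 0 1, (moebKer p (2 * p + 2 - α) ξ w -
        moebKer p (2 * p + 2 - α) (-ξ) w) * w ^ (-α) =
      α * ξ * ProbabilityTheory.beta (-α / 2) (p + 1) *
        ordinaryHypergeometric (1 - α / 2) (3 / 2 + p - α / 2) (3 / 2) (ξ ^ 2) := by
  set q := 2 * p + 2 - α with hq
  set B := ProbabilityTheory.beta (-α / 2) (p + 1) with hB
  have hξ2 : |ξ ^ 2| < 1 := by rw [abs_pow]; exact pow_lt_one₀ (abs_nonneg ξ) hξ two_ne_zero
  set T : ℕ → ℝ → ℝ := fun k w => -(2 * (poch q (2 * k + 1) / (2 * k + 1).factorial)) *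
    ξ ^ (2 * k + 1) * ((1 - w ^ 2) ^ p * w ^ (2 * (1 - α / 2 + (k : ℝ)) - 1)) with hT
  have hσ : ∀ k : ℕ, 0 < 1 - α / 2 + (k : ℝ) := fun k => by
    have : (0 : ℝ) ≤ k := k.cast_nonneg
    linarith
  have iT : ∀ k, IntegrableOn (T k) (Ioo 0 1) := fun k =>
    (integrableOn_beta_sq (by linarith [hσ k]) hp).const_mul _
  have vT : ∀ k, ∫ w in Ioo 0 1, T k w =
      α * ξ * B * (hypCoeff (1 - α / 2) (3 / 2 + p - α / 2) (3 / 2) k * (ξ ^ 2) ^ k) := by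
    intro k
    simp only [hT]
    have h := beta_mul_poch_odd hα0 hα2 hp k
    rw [integral_const_mul, integral_beta_sq (hσ k) hp, ← pow_mul, pow_succ]
    rw [← hB, ← hq] at h
    linear_combination (ξ ^ (2 * k) * ξ) * h
  have vTn : ∀ k, ∫ w in Ioo 0 1, ‖T k w‖ = ‖∫ w in Ioo 0 1, T k w‖ := by
    intro k
    have hn : ∀ w ∈ Ioo (0 : ℝ) 1, ‖T k w‖ = |-(2 * (poch q (2 * k + 1) / (2 * k + 1).factorial)) *
        ξ ^ (2 * k + 1)| * ((1 - w ^ 2) ^ p * w ^ (2 * (1 - α / 2 + (k : ℝ)) - 1)) := by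
      intro w hw
      have h1 : 0 ≤ 1 - w ^ 2 := by nlinarith [hw.1, hw.2]
      have h2 := Real.rpow_nonneg h1 p
      have h3 := Real.rpow_nonneg hw.1.le (2 * (1 - α / 2 + (k : ℝ)) - 1)
      simp only [hT]
      rw [Real.norm_eq_abs, abs_mul, abs_of_nonneg (mul_nonneg h2 h3)]
    rw [setIntegral_congr_fun measurableSet_Ioo hn, integral_const_mul]
    simp only [hT]
    rw [integral_const_mul, norm_mul, Real.norm_eq_abs, integral_beta_sq (hσ k) hp,
      Real.norm_of_nonneg (div_pos (ProbabilityTheory.beta_pos (hσ k) (by linarith)) two_pos).le]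
  have hs := (hasSum_hyp (1 - α / 2) (3 / 2 + p - α / 2) (by norm_num : (0 : ℝ) < 3 / 2)
    hξ2).mul_left (α * ξ * B)
  have hsumT : Summable fun k => ∫ w in Ioo 0 1, ‖T k w‖ := by
    simp_rw [vTn, vT]
    exact hs.summable.norm
  have hI := hasSum_integral_of_summable_integral_norm iT hsumT
  simp_rw [vT] at hI
  rw [← hI.unique hs]
  refine setIntegral_congr_fun measurableSet_Ioo fun w hw => ?_
  have hx : |ξ * w| < 1 := by
    rw [abs_mul, abs_of_pos hw.1]; nlinarith [abs_nonneg ξ, hw.2, hw.1]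
  have h2 := (hasSum_binomial_odd q hx).mul_left ((1 - w ^ 2) ^ p * w ^ (-α))
  have h3 : HasSum (fun k => T k w) _ := h2.congr_fun fun k => by
    simp only [hT]
    rw [show 2 * (1 - α / 2 + (k : ℝ)) - 1 = -α + ((2 * k + 1 : ℕ) : ℝ) by
      push_cast; ring, Real.rpow_add hw.1, Real.rpow_natCast, mul_pow]
    ring
  rw [h3.tsum_eq]
  simp only [moebKer]
  rw [show 1 + -ξ * w = 1 - ξ * w by ring]
  ring

end FracLap

/-! ### The one-dimensional integrals, by a Möbius change of variables -/

namespace FracLap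

open MeasureTheory Filter Topology Set

open scoped Classical in
/-- The function `(1 - y²)_+^p` of one real variable. -/
noncomputable def ballPow (p y : ℝ) : ℝ := if |y| < 1 then (1 - y ^ 2) ^ p else 0

lemma ballPow_neg (p y : ℝ) : ballPow p (-y) = ballPow p y := by simp [ballPow]

lemma ballPow_of_lt {p y : ℝ} (h : |y| < 1) : ballPow p y = (1 - y ^ 2) ^ p := by simp [ballPow, h]

lemma ballPow_of_le {p y : ℝ} (h : 1 ≤ |y|) : ballPow p y = 0 := by simp [ballPow, h]

lemma ballPow_nonneg (p y : ℝ) : 0 ≤ ballPow p y := by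
  rcases lt_or_ge |y| 1 with h | h
  · rw [ballPow_of_lt h]
    refine Real.rpow_nonneg ?_ p
    have := (sq_lt_one_iff_abs_lt_one y).mpr h
    linarith
  · rw [ballPow_of_le h]

lemma measurable_ballPow (p : ℝ) : Measurable (ballPow p) := by
  unfold ballPow
  refine Measurable.ite ?_ (by fun_prop) measurable_const
  exact measurableSet_lt (by fun_prop) measurable_const

lemma integrable_ballPow {p : ℝ} (hp : -1 < p) : Integrable (ballPow p) := by
  have h1 : IntegrableOn (ballPow p) (Ioo 0 1) := by
    refine (integrableOn_beta_sq (s := 0) (by norm_num) hp).congr_fun ?_ measurableSet_Ioo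
    intro w hw
    simp only [Real.rpow_zero, mul_one]
    rw [ballPow_of_lt (by rw [abs_of_pos hw.1]; exact hw.2)]
  have h2 : IntegrableOn (ballPow p) (Ioo (-1) 0) := by
    have h := h1.comp_neg
    simp only [ballPow_neg] at h
    convert h using 1
    ext w; simp only [Set.mem_neg, mem_Ioo]; constructor <;> rintro ⟨a, b⟩ <;> constructor <;> linarith
  have h3 : IntegrableOn (ballPow p) (Ioo (-1) 0 ∪ Ioo 0 1 ∪ {0}) :=
    (h2.union h1).union (integrableOn_singleton (by simp) (by simp))
  rw [← integrableOn_univ]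
  refine h3.of_forall_sdiff_eq_zero MeasurableSet.univ fun y hy => ?_
  refine ballPow_of_le ?_
  by_contra hlt
  have hlt := abs_lt.mp (not_le.mp hlt)
  apply hy.2
  rcases lt_trichotomy y 0 with h | h | h
  · exact Or.inl (Or.inl ⟨hlt.1, h⟩)
  · exact Or.inr h
  · exact Or.inl (Or.inr ⟨h, hlt.2⟩)

lemma integrableOn_ballPow_add_mul_rpow {p s ε : ℝ} (ξ : ℝ) (hp : -1 < p) (hs : s ≤ 0)
    (hε : 0 < ε) : IntegrableOn (fun r => ballPow p (ξ + r) * r ^ s) (Ioi ε) := by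
  have h := ((integrable_ballPow hp).comp_add_left ξ).integrableOn (s := Ioi ε)
  refine Integrable.mono' (h.mul_const (ε ^ s))
    (((measurable_ballPow p).comp (measurable_const_add ξ)).mul (by fun_prop)).aestronglyMeasurable
    ?_
  filter_upwards [ae_restrict_mem measurableSet_Ioi] with r hr
  have hr : ε < r := hr
  have h0 := Real.rpow_nonneg (hε.trans hr).le s
  rw [Real.norm_of_nonneg (mul_nonneg (ballPow_nonneg _ _) h0)]
  exact mul_le_mul_of_nonneg_left (Real.rpow_le_rpow_of_nonpos hε hr.le hs) (ballPow_nonneg _ _)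

/-- The map is `w ↦ (w + ξ)/(1 + ξ w) - ξ`, the displacement from `ξ` under the automorphism of
`(-1, 1)` that sends `0` to `ξ` and fixes `1`. -/
lemma moebius_image {ξ η : ℝ} (hξ : |ξ| < 1) (hη : 0 < η) (hδ : 0 < 1 - ξ * η) :
    (fun w : ℝ => (1 - ξ ^ 2) * w / (1 + ξ * w)) '' Ioo (η / (1 - ξ * η)) 1 =
      Ioo ((1 - ξ ^ 2) * η) (1 - ξ) := by
  obtain ⟨h1, h2⟩ := abs_lt.mp hξ
  have hm : 0 < 1 - ξ ^ 2 := by nlinarith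
  ext r
  constructor
  · rintro ⟨w, ⟨hw1, hw2⟩, rfl⟩
    have hw0 : 0 < w := (div_pos hη hδ).trans hw1
    have hd : 0 < 1 + ξ * w := by nlinarith
    rw [div_lt_iff₀ hδ] at hw1
    simp only
    constructor
    · rw [lt_div_iff₀ hd]
      have : η * (1 + ξ * w) < w := by nlinarith
      nlinarith
    · rw [div_lt_iff₀ hd]
      nlinarith
  · rintro ⟨hr1, hr2⟩
    have hr0 : 0 < r := (mul_pos hm hη).trans hr1
    have hd : 0 < 1 - ξ ^ 2 - ξ * r := by
      rcases le_or_gt 0 ξ with h | h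
      · nlinarith
      · nlinarith
    refine ⟨r / (1 - ξ ^ 2 - ξ * r), ⟨?_, ?_⟩, ?_⟩
    · rw [div_lt_div_iff₀ hδ hd]; nlinarith
    · rw [div_lt_one hd]; nlinarith
    · have e : 1 + ξ * (r / (1 - ξ ^ 2 - ξ * r)) = (1 - ξ ^ 2) / (1 - ξ ^ 2 - ξ * r) := by
        field_simp; ring
      simp only
      rw [e]
      field_simp

/-- Under the map `1 - y²` becomes `(1 - ξ²)(1 - w²)/(1 + ξ w)²`, and the derivative is `(1 - ξ²)/(1
+ ξ w)²`; collecting powers gives both exponents. -/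
lemma integral_ballPow_moebius {p s ξ η : ℝ} (hξ : |ξ| < 1) (hη : 0 < η) (hδ : 0 < 1 - ξ * η) :
    ∫ r in Ioi ((1 - ξ ^ 2) * η), ballPow p (ξ + r) * r ^ s =
      (1 - ξ ^ 2) ^ (p + s + 1) *
        ∫ w in Ioo (η / (1 - ξ * η)) 1, moebKer p (2 * p + s + 2) ξ w * w ^ s := by
  obtain ⟨h1, h2⟩ := abs_lt.mp hξ
  have hm : 0 < 1 - ξ ^ 2 := by nlinarith
  have e1 : ∫ r in Ioi ((1 - ξ ^ 2) * η), ballPow p (ξ + r) * r ^ s =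
      ∫ r in Ioo ((1 - ξ ^ 2) * η) (1 - ξ), (1 - (ξ + r) ^ 2) ^ p * r ^ s := by
    refine (setIntegral_eq_of_subset_of_forall_sdiff_eq_zero (s := Ioo ((1 - ξ ^ 2) * η) (1 - ξ))
      measurableSet_Ioi (fun r hr => hr.1) ?_).trans
        (setIntegral_congr_fun measurableSet_Ioo fun r hr => ?_)
    rotate_left
    · have hr0 : 0 < r := (mul_pos hm hη).trans hr.1
      rw [ballPow_of_lt (abs_lt.mpr ⟨by linarith, by linarith [hr.2]⟩)]
    · rintro r ⟨hr1, hr2⟩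
      have hr : 1 - ξ ≤ r := not_lt.mp fun h => hr2 ⟨hr1, h⟩
      rw [ballPow_of_le (by rw [abs_of_nonneg] <;> linarith), zero_mul]
  have hd : ∀ w ∈ Ioo (η / (1 - ξ * η)) 1, 0 < w ∧ 0 < 1 + ξ * w := by
    intro w hw
    have hw0 : 0 < w := (div_pos hη hδ).trans hw.1
    exact ⟨hw0, by nlinarith [hw.2]⟩
  have hderiv : ∀ w ∈ Ioo (η / (1 - ξ * η)) 1,
      HasDerivWithinAt (fun w : ℝ => (1 - ξ ^ 2) * w / (1 + ξ * w))
        ((1 - ξ ^ 2) / (1 + ξ * w) ^ 2) (Ioo (η / (1 - ξ * η)) 1) w := by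
    intro w hw
    obtain ⟨hw0, hw1⟩ := hd w hw
    have d1 := (hasDerivAt_id w).const_mul (1 - ξ ^ 2)
    have d2 := ((hasDerivAt_id w).const_mul ξ).const_add 1
    refine ((d1.div d2 hw1.ne').congr_deriv ?_).hasDerivWithinAt
    simp only [id]
    congr 1
    ring
  have hinj : InjOn (fun w : ℝ => (1 - ξ ^ 2) * w / (1 + ξ * w)) (Ioo (η / (1 - ξ * η)) 1) := by
    intro a ha b hb h
    simp only at h
    rw [div_eq_div_iff (hd a ha).2.ne' (hd b hb).2.ne'] at h
    have : (1 - ξ ^ 2) * (a - b) = 0 := by linear_combination h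
    rcases mul_eq_zero.mp this with h | h
    · exact absurd h hm.ne'
    · linarith
  rw [e1, ← moebius_image hξ hη hδ, integral_image_eq_integral_abs_deriv_smul measurableSet_Ioo
    hderiv hinj, ← integral_const_mul]
  refine setIntegral_congr_fun measurableSet_Ioo fun w hw => ?_
  obtain ⟨hw0, hw1⟩ := hd w hw
  have hww : 0 < 1 - w ^ 2 := by nlinarith [hw.2]
  have e2 : 1 - (ξ + (1 - ξ ^ 2) * w / (1 + ξ * w)) ^ 2 =
      (1 - ξ ^ 2) * (1 - w ^ 2) / (1 + ξ * w) ^ 2 := by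
    field_simp; ring
  simp only [smul_eq_mul, moebKer]
  rw [e2, abs_of_pos (by positivity), Real.div_rpow (by positivity) (by positivity),
    Real.mul_rpow hm.le hww.le, Real.div_rpow (by positivity) hw1.le, Real.mul_rpow hm.le hw0.le,
    Real.rpow_add hm, Real.rpow_add hm, Real.rpow_one, neg_add, neg_add, Real.rpow_add hw1,
    Real.rpow_add hw1, Real.rpow_neg hw1.le, Real.rpow_neg hw1.le, Real.rpow_neg hw1.le,
    Real.rpow_two, ← Real.rpow_natCast (1 + ξ * w) 2, ← Real.rpow_mul hw1.le]
  push_cast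
  have := (Real.rpow_pos_of_pos hw1 (2 * p)).ne'
  have := (Real.rpow_pos_of_pos hw1 s).ne'
  rw [Real.rpow_two]
  field_simp

lemma tendsto_integral_Ioi {g : ℝ → ℝ} (hg : IntegrableOn g (Ioi 0)) {m : ℝ} (hm : 0 < m) :
    Tendsto (fun η => ∫ r in Ioi (m * η), g r) (𝓝[>] 0) (𝓝 (∫ r in Ioi 0, g r)) := by
  have hδ : Tendsto (fun η : ℝ => m * η) (𝓝[>] 0) (𝓝 0) := by
    have : Tendsto (fun η : ℝ => m * η) (𝓝 0) (𝓝 (m * 0)) := (continuous_const_mul m).tendsto 0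
    rw [mul_zero] at this
    exact this.mono_left nhdsWithin_le_nhds
  have h := (aecover_Ioi_of_Ioi (μ := volume) hδ).integral_tendsto_of_countably_generated hg
  refine h.congr' ?_
  filter_upwards [eventually_small] with η hη
  rw [Measure.restrict_restrict_of_subset (Ioi_subset_Ioi (mul_pos hm hη.1).le)]

/-- The one-dimensional fractional Laplacian of `(1 - y²)_+^p`, symmetrised. -/
theorem integral_ballPow_even {α p ξ : ℝ} (hα0 : 0 < α) (hα2 : α < 2) (hp : -1 < p)
    (hξ : |ξ| < 1)
    (hI : IntegrableOn (fun r => (ballPow p (ξ + r) + ballPow p (ξ - r) - 2 * ballPow p ξ) *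
      r ^ (-1 - α)) (Ioi 0)) :
    ∫ r in Ioi 0, (ballPow p (ξ + r) + ballPow p (ξ - r) - 2 * ballPow p ξ) * r ^ (-1 - α) =
      ProbabilityTheory.beta (-α / 2) (p + 1) *
        ordinaryHypergeometric ((1 + α) / 2) (α / 2 - p) (1 / 2) (ξ ^ 2) := by
  obtain ⟨h1, h2⟩ := abs_lt.mp hξ
  have hm : 0 < 1 - ξ ^ 2 := by nlinarith
  have hξ' : |-ξ| < 1 := by rwa [abs_neg]
  have hξ2 : |ξ ^ 2| < 1 := by rw [abs_pow]; exact pow_lt_one₀ (abs_nonneg ξ) hξ two_ne_zero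
  refine tendsto_nhds_unique (tendsto_integral_Ioi hI hm) ?_
  -- Euler's transformation extracts `(1 - ξ²)^(p-α)`, precisely the power produced by the change of
  -- variables.
  rw [hyp_euler one_half_pos _ _ hξ2, show 1 / 2 - (1 + α) / 2 = -α / 2 by ring,
    show -α / 2 - (α / 2 - p) = p - α by ring,
    show 1 / 2 - (α / 2 - p) = 1 / 2 + p - α / 2 by ring, mul_left_comm,
    ← integral_moebRem_even hα0 hα2 hp hξ]
  refine ((tendsto_moeb_even (q := 2 * p - α + 1) hp hα0 hα2 hξ).const_mul
    ((1 - ξ ^ 2) ^ (p - α))).congr' ?_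
  filter_upwards [eventually_small] with η hη
  have hd1 : 0 < 1 - ξ * η := by linarith [half_lt_cutoff_denom hξ hη]
  have hd2 : 0 < 1 - -ξ * η := by linarith [half_lt_cutoff_denom hξ' hη]
  have hε : 0 < (1 - ξ ^ 2) * η := mul_pos hm hη.1
  have i1 := integrableOn_ballPow_add_mul_rpow ξ hp (by linarith : -1 - α ≤ 0) hε
  have i2 := integrableOn_ballPow_add_mul_rpow (-ξ) hp (by linarith : -1 - α ≤ 0) hε
  have i3 := (integrableOn_Ioi_rpow_of_lt (by linarith : -1 - α < -1) hε).const_mul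
    (2 * ballPow p ξ)
  have e : (fun r => (ballPow p (ξ + r) + ballPow p (ξ - r) - 2 * ballPow p ξ) * r ^ (-1 - α)) =
      fun r => ballPow p (ξ + r) * r ^ (-1 - α) + ballPow p (-ξ + r) * r ^ (-1 - α) -
        2 * ballPow p ξ * r ^ (-1 - α) := by
    funext r
    rw [← ballPow_neg p (ξ - r), show -(ξ - r) = -ξ + r by ring]; ring
  have i12 : IntegrableOn (fun r => ballPow p (ξ + r) * r ^ (-1 - α) +
      ballPow p (-ξ + r) * r ^ (-1 - α)) (Ioi ((1 - ξ ^ 2) * η)) := i1.add i2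
  have c1 := integral_ballPow_moebius (p := p) (s := -1 - α) hξ hη.1 hd1
  have c2 := integral_ballPow_moebius (p := p) (s := -1 - α) hξ' hη.1 hd2
  rw [neg_sq] at c2
  -- The subtracted value contributes `2 (1-ξ²)^p ((1-ξ²) η)^(-α) / α`, which is `(1-ξ²)^(p-α)`
  -- times the counterterm of `tendsto_moeb_even`.
  rw [e, integral_sub i12 i3, integral_add i1 i2, integral_const_mul, c1, c2,
    integral_Ioi_rpow_of_lt (by linarith) hε, ballPow_of_lt hξ,
    show p + (-1 - α) + 1 = p - α by ring, show 2 * p + (-1 - α) + 2 = 2 * p - α + 1 by ring,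
    show -1 - α + 1 = -α by ring, Real.mul_rpow hm.le hη.1.le, sub_eq_add_neg p α,
    Real.rpow_add hm]
  field_simp

/-- The one-dimensional integral behind the fractional Laplacian of `y (1 - y²)_+^p`. -/
theorem integral_ballPow_odd {α p ξ : ℝ} (hα0 : 0 < α) (hα2 : α < 2) (hp : -1 < p)
    (hξ : |ξ| < 1)
    (hI : IntegrableOn (fun r => (ballPow p (ξ + r) - ballPow p (ξ - r)) * r ^ (-α)) (Ioi 0)) :
    ∫ r in Ioi 0, (ballPow p (ξ + r) - ballPow p (ξ - r)) * r ^ (-α) =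
      α * ξ * ProbabilityTheory.beta (-α / 2) (p + 1) *
        ordinaryHypergeometric ((1 + α) / 2) (α / 2 - p) (3 / 2) (ξ ^ 2) := by
  obtain ⟨h1, h2⟩ := abs_lt.mp hξ
  have hm : 0 < 1 - ξ ^ 2 := by nlinarith
  have hξ' : |-ξ| < 1 := by rwa [abs_neg]
  have hξ2 : |ξ ^ 2| < 1 := by rw [abs_pow]; exact pow_lt_one₀ (abs_nonneg ξ) hξ two_ne_zero
  refine tendsto_nhds_unique (tendsto_integral_Ioi hI hm) ?_
  rw [hyp_euler (by norm_num) _ _ hξ2, show 3 / 2 - (1 + α) / 2 = 1 - α / 2 by ring,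
    show 1 - α / 2 - (α / 2 - p) = p - α + 1 by ring,
    show 3 / 2 - (α / 2 - p) = 3 / 2 + p - α / 2 by ring, mul_left_comm,
    ← integral_moebKer_odd hα0 hα2 hp hξ]
  refine ((tendsto_moeb_odd (q := 2 * p + 2 - α) hp hα0 hα2 hξ).const_mul
    ((1 - ξ ^ 2) ^ (p - α + 1))).congr' ?_
  filter_upwards [eventually_small] with η hη
  have hd1 : 0 < 1 - ξ * η := by linarith [half_lt_cutoff_denom hξ hη]
  have hd2 : 0 < 1 - -ξ * η := by linarith [half_lt_cutoff_denom hξ' hη]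
  have hε : 0 < (1 - ξ ^ 2) * η := mul_pos hm hη.1
  have i1 := integrableOn_ballPow_add_mul_rpow ξ hp (by linarith : -α ≤ 0) hε
  have i2 := integrableOn_ballPow_add_mul_rpow (-ξ) hp (by linarith : -α ≤ 0) hε
  have e : (fun r => (ballPow p (ξ + r) - ballPow p (ξ - r)) * r ^ (-α)) =
      fun r => ballPow p (ξ + r) * r ^ (-α) - ballPow p (-ξ + r) * r ^ (-α) := by
    funext r
    rw [← ballPow_neg p (ξ - r), show -(ξ - r) = -ξ + r by ring]; ring
  have c1 := integral_ballPow_moebius (p := p) (s := -α) hξ hη.1 hd1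
  have c2 := integral_ballPow_moebius (p := p) (s := -α) hξ' hη.1 hd2
  rw [neg_sq] at c2
  rw [e, integral_sub i1 i2, c1, c2, show p + -α + 1 = p - α + 1 by ring,
    show 2 * p + -α + 2 = 2 * p + 2 - α by ring]
  ring

end FracLap

/-! ### Polar coordinates and moments on the unit sphere -/

namespace FracLap

open MeasureTheory Filter Topology Set

section Polar

variable {E : Type*} [NormedAddCommGroup E] [InnerProductSpace ℝ E]

lemma exists_orthonormalBasis_apply_zero [FiniteDimensional ℝ E] {n : ℕ} (hn : Module.finrank ℝ E = n + 1) {e : E}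
    (he : ‖e‖ = 1) : ∃ b : OrthonormalBasis (Fin (n + 1)) ℝ E, b 0 = e := by
  have hv : Orthonormal ℝ (({0} : Set (Fin (n + 1))).domRestrict fun _ => e) := by
    refine ⟨fun _ => he, fun i j hij => ?_⟩
    exact absurd (Subtype.ext (i.2.trans j.2.symm)) hij
  obtain ⟨b, hb⟩ := hv.exists_orthonormalBasis_extension_of_card_eq (by simpa using hn)
  exact ⟨b, hb 0 rfl⟩

/-- In an orthonormal basis whose first vector is the chosen direction, the weighted Gaussian is a
product of functions of one coordinate. -/
lemma gaussian_factor {n : ℕ} (b : OrthonormalBasis (Fin (n + 1)) ℝ E) (k : ℕ) (y : E) :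
    (inner ℝ (b 0) y ^ 2) ^ k * Real.exp (-‖y‖ ^ 2) =
      ∏ i, ((fun i (s : ℝ) => (s ^ 2) ^ (if i = 0 then k else 0) * Real.exp (-s ^ 2)) :
        Fin (n + 1) → ℝ → ℝ) i ((b.repr y).ofLp i) := by
  rw [← b.repr.norm_map y, EuclideanSpace.norm_sq_eq, ← Finset.sum_neg_distrib, Real.exp_sum,
    Finset.prod_mul_distrib, Fin.prod_univ_succ (fun i => (_ : ℝ) ^ (if i = 0 then k else 0))]
  simp [Fin.succ_ne_zero, b.repr_apply_apply]

variable [MeasurableSpace E] [BorelSpace E]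

lemma measurableEmbedding_coords {n : ℕ} (b : OrthonormalBasis (Fin (n + 1)) ℝ E) :
    MeasurableEmbedding (fun y : E => (b.repr y).ofLp) :=
  (MeasurableEquiv.toLp 2 (Fin (n + 1) → ℝ)).symm.measurableEmbedding.comp
    b.repr.toHomeomorph.measurableEmbedding

variable [FiniteDimensional ℝ E]

lemma measurePreserving_coords {n : ℕ} (b : OrthonormalBasis (Fin (n + 1)) ℝ E) :
    MeasurePreserving (fun y : E => (b.repr y).ofLp) volume volume :=
  (PiLp.volume_preserving_ofLp (Fin (n + 1))).comp b.measurePreserving_repr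

lemma integrable_sphere_prod {g : E → ℝ} (hg : Integrable g) :
    Integrable (fun z : Metric.sphere (0 : E) 1 × Ioi (0 : ℝ) => g (z.2.1 • z.1.1))
      ((volume : Measure E).toSphere.prod
        (Measure.volumeIoiPow (Module.finrank ℝ E - 1))) := by
  rw [← (volume : Measure E).measurePreserving_homeomorphUnitSphereProd.integrable_comp_emb
    (Homeomorph.measurableEmbedding _)]
  have h1 : IntegrableOn g ({0}ᶜ : Set E) := hg.integrableOn
  rw [integrableOn_iff_comap_subtypeVal (by measurability)] at h1
  refine h1.congr (Eventually.of_forall fun y => ?_)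
  simp only [Function.comp_apply]
  rw [← homeomorphUnitSphereProd_symm_apply_coe, Homeomorph.symm_apply_apply]

lemma volumeIoiPow_eq (n : ℕ) : Measure.volumeIoiPow n =
    (Measure.comap Subtype.val volume : Measure (Ioi (0 : ℝ))).withDensity
      fun r => ((Real.toNNReal (r.1 ^ n) : NNReal) : ENNReal) := rfl

lemma integral_volumeIoiPow (n : ℕ) (f : ℝ → ℝ) :
    ∫ r : Ioi (0 : ℝ), f r ∂Measure.volumeIoiPow n = ∫ r in Ioi (0 : ℝ), r ^ n * f r := by
  rw [volumeIoiPow_eq, integral_withDensity_eq_integral_smul (by fun_prop),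
    integral_subtype_comap measurableSet_Ioi fun a ↦ Real.toNNReal (a ^ n) • f a]
  refine setIntegral_congr_fun measurableSet_Ioi fun r hr => ?_
  have hr : 0 < r := hr
  simp only [NNReal.smul_def, smul_eq_mul]
  rw [Real.coe_toNNReal _ (pow_nonneg hr.le _)]

lemma integrable_volumeIoiPow {n : ℕ} {f : ℝ → ℝ}
    (h : Integrable (fun r : Ioi (0 : ℝ) => f r) (Measure.volumeIoiPow n)) :
    IntegrableOn (fun r => r ^ n * f r) (Ioi 0) := by
  rw [volumeIoiPow_eq, integrable_withDensity_iff_integrable_smul' (by fun_prop) (by simp)] at h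
  rw [integrableOn_iff_comap_subtypeVal measurableSet_Ioi]
  refine h.congr (Eventually.of_forall fun r => ?_)
  have hr : 0 < r.1 := r.2
  simp only [Function.comp_apply, smul_eq_mul, ENNReal.coe_toReal]
  rw [Real.coe_toNNReal _ (pow_nonneg hr.le _)]

/-- Almost every ray restriction of an integrable function is integrable in polar coordinates. -/
lemma ae_integrableOn_polar {g : E → ℝ} (hg : Integrable g) :
    ∀ᵐ ω : Metric.sphere (0 : E) 1 ∂(volume : Measure E).toSphere,
      IntegrableOn (fun r : ℝ => r ^ (Module.finrank ℝ E - 1) * g (r • ω.1)) (Ioi 0) := by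
  filter_upwards [(integrable_sphere_prod hg).prod_right_ae] with ω hω
  exact integrable_volumeIoiPow (f := fun r => g (r • ω.1)) hω

variable [Nontrivial E]

/-- Integration in polar coordinates. -/
lemma integral_polar {g : E → ℝ} (hg : Integrable g) :
    ∫ y, g y = ∫ ω : Metric.sphere (0 : E) 1,
      (∫ r in Ioi (0 : ℝ), r ^ (Module.finrank ℝ E - 1) * g (r • ω.1))
        ∂(volume : Measure E).toSphere := by
  calc ∫ y, g y = ∫ y : ({(0)}ᶜ : Set E), g y.1 ∂(Measure.comap Subtype.val volume) := by
        rw [integral_subtype_comap (measurableSet_singleton _).compl g,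
          restrict_compl_singleton]
    _ = ∫ z : Metric.sphere (0 : E) 1 × Ioi (0 : ℝ), g (z.2.1 • z.1.1)
        ∂((volume : Measure E).toSphere.prod
          (Measure.volumeIoiPow (Module.finrank ℝ E - 1))) := by
        rw [← (volume : Measure E).measurePreserving_homeomorphUnitSphereProd.integral_comp
          (Homeomorph.measurableEmbedding _)]
        refine integral_congr_ae (Eventually.of_forall fun y => ?_)
        simp only
        rw [← homeomorphUnitSphereProd_symm_apply_coe, Homeomorph.symm_apply_apply]
    _ = _ := by
        rw [integral_prod _ (integrable_sphere_prod hg)]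
        refine integral_congr_ae (Eventually.of_forall fun ω => ?_)
        exact integral_volumeIoiPow _ fun r => g (r • ω.1)

lemma integrable_even_pow_mul_exp (k : ℕ) :
    Integrable fun y : ℝ => (y ^ 2) ^ k * Real.exp (-y ^ 2) := by
  have h := integrable_rpow_mul_exp_neg_mul_sq (b := 1) one_pos (s := ((2 * k : ℕ) : ℝ))
    (by have : (0 : ℝ) ≤ ((2 * k : ℕ) : ℝ) := Nat.cast_nonneg _; linarith)
  refine h.congr (Eventually.of_forall fun y => ?_)
  simp only [Real.rpow_natCast, pow_mul, neg_mul, one_mul]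

lemma integral_Ioi_pow_mul_exp (n : ℕ) :
    ∫ r in Ioi (0 : ℝ), r ^ n * Real.exp (-r ^ 2) = Real.Gamma ((n + 1) / 2) / 2 := by
  have h := integral_rpow_mul_exp_neg_rpow (p := 2) (q := n) two_pos
    (by have : (0 : ℝ) ≤ n := Nat.cast_nonneg _; linarith)
  simp only [Real.rpow_natCast, Real.rpow_two] at h
  rw [h]; ring

lemma integral_even_pow_mul_exp (k : ℕ) :
    ∫ y : ℝ, (y ^ 2) ^ k * Real.exp (-y ^ 2) = poch (1 / 2) k * √Real.pi := by
  have h := integral_comp_abs (f := fun y : ℝ => (y ^ 2) ^ k * Real.exp (-y ^ 2))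
  simp only [sq_abs] at h
  have h2 := integral_Ioi_pow_mul_exp (2 * k)
  simp only [pow_mul] at h2
  rw [h, h2, show (((2 * k : ℕ) : ℝ) + 1) / 2 = 1 / 2 + k by push_cast; ring,
    Gamma_add_nat (fun j => by positivity), Real.Gamma_one_half_eq]
  ring

lemma integrable_gaussian_moment {e : E} (he : ‖e‖ = 1) (k : ℕ) :
    Integrable fun y : E => (inner ℝ e y ^ 2) ^ k * Real.exp (-‖y‖ ^ 2) := by
  obtain ⟨n, hn⟩ := Nat.exists_eq_succ_of_ne_zero (Module.finrank_pos (R := ℝ) (M := E)).ne'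
  obtain ⟨b, rfl⟩ := exists_orthonormalBasis_apply_zero hn he
  simp_rw [gaussian_factor b k]
  exact ((measurePreserving_coords b).integrable_comp_emb (measurableEmbedding_coords b)).mpr
    (Integrable.fintype_prod fun i => integrable_even_pow_mul_exp _)

lemma integral_gaussian_moment {e : E} (he : ‖e‖ = 1) (k : ℕ) :
    ∫ y : E, (inner ℝ e y ^ 2) ^ k * Real.exp (-‖y‖ ^ 2) =
      poch (1 / 2) k * √Real.pi ^ Module.finrank ℝ E := by
  obtain ⟨n, hn⟩ := Nat.exists_eq_succ_of_ne_zero (Module.finrank_pos (R := ℝ) (M := E)).ne'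
  obtain ⟨b, rfl⟩ := exists_orthonormalBasis_apply_zero hn he
  simp_rw [gaussian_factor b k]
  refine ((measurePreserving_coords b).integral_comp (measurableEmbedding_coords b)
    (fun z => ∏ i, ((fun i (s : ℝ) => (s ^ 2) ^ (if i = 0 then k else 0) * Real.exp (-s ^ 2)) :
        Fin (n + 1) → ℝ → ℝ) i (z i))).trans ?_
  refine (integral_fintype_prod_volume_eq_prod (E := fun _ : Fin (n + 1) => ℝ)
    fun i (s : ℝ) => (s ^ 2) ^ (if i = 0 then k else 0) * Real.exp (-s ^ 2)).trans ?_
  rw [hn]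
  simp_rw [integral_even_pow_mul_exp]
  rw [Fin.prod_univ_succ]
  simp [Fin.succ_ne_zero, pow_succ]
  ring

variable (E) in
/-- The surface area `2 π^(d/2) / Γ(d/2)` of the unit sphere. -/
noncomputable def sphereArea : ℝ :=
  2 * √Real.pi ^ Module.finrank ℝ E / Real.Gamma ((Module.finrank ℝ E : ℝ) / 2)

/-- Even moments of a coordinate on the unit sphere. -/
lemma integral_sphere_moment {e : E} (he : ‖e‖ = 1) (k : ℕ) :
    ∫ ω : Metric.sphere (0 : E) 1, (inner ℝ e ω.1 ^ 2) ^ k ∂(volume : Measure E).toSphere =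
      sphereArea E * (poch (1 / 2) k / poch ((Module.finrank ℝ E : ℝ) / 2) k) := by
  -- The Gaussian moment is computed twice, by coordinates and by polar coordinates; the radial
  -- factor `Γ(d/2 + k)/2` is divided out.
  have h := integral_polar (integrable_gaussian_moment he k)
  rw [integral_gaussian_moment he k] at h
  have hd : 0 < Module.finrank ℝ E := Module.finrank_pos
  have hd' : (0 : ℝ) < (Module.finrank ℝ E : ℝ) / 2 := by positivity
  have e1 : ∀ ω : Metric.sphere (0 : E) 1, ∫ r in Ioi (0 : ℝ), r ^ (Module.finrank ℝ E - 1) *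
      ((inner ℝ e (r • ω.1) ^ 2) ^ k * Real.exp (-‖r • ω.1‖ ^ 2)) =
      (inner ℝ e ω.1 ^ 2) ^ k *
        (poch ((Module.finrank ℝ E : ℝ) / 2) k * Real.Gamma ((Module.finrank ℝ E : ℝ) / 2) / 2) := by
    intro ω
    have hω : ‖ω.1‖ = 1 := by simp
    rw [← Gamma_add_nat (fun j => by positivity),
      show (Module.finrank ℝ E : ℝ) / 2 + k =
        (((Module.finrank ℝ E - 1 + 2 * k : ℕ) : ℝ) + 1) / 2 by
        push_cast [Nat.cast_sub hd]; ring, ← integral_Ioi_pow_mul_exp, ← integral_const_mul]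
    refine setIntegral_congr_fun measurableSet_Ioi fun r hr => ?_
    rw [inner_smul_right, norm_smul, hω, mul_one, Real.norm_eq_abs, sq_abs, pow_add, pow_mul]
    ring
  simp_rw [e1] at h
  rw [integral_mul_const] at h
  have hp := (poch_pos hd' k).ne'
  have hG := (Real.Gamma_pos_of_pos hd').ne'
  unfold sphereArea
  field_simp at h ⊢
  linarith

end Polar

lemma integrable_dirichlet {Ω : Type*} [MeasurableSpace Ω] (ν : Measure Ω) [IsFiniteMeasure ν]
    {s : Ω → ℝ} (hs : Measurable s) (hs0 : ∀ ω, 0 ≤ s ω) (hs1 : ∀ ω, s ω ≤ 1) (k j : ℕ) :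
    Integrable (fun ω => s ω ^ k * (1 - s ω) ^ j) ν := by
  refine Integrable.of_bound (C := 1) (by fun_prop) (Eventually.of_forall fun ω => ?_)
  have h0 := hs0 ω
  have h1 := hs1 ω
  rw [norm_mul, norm_pow, norm_pow, Real.norm_of_nonneg h0,
    Real.norm_of_nonneg (by linarith : 0 ≤ 1 - s ω)]
  exact mul_le_one₀ (pow_le_one₀ h0 h1) (by have : 0 ≤ 1 - s ω := by linarith
                                            positivity)
    (pow_le_one₀ (by linarith) (by linarith))

/-- Mixed moments of a Dirichlet type variable follow from its pure moments. -/
lemma integral_dirichlet {Ω : Type*} [MeasurableSpace Ω] (ν : Measure Ω) [IsFiniteMeasure ν]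
    {s : Ω → ℝ} (hs : Measurable s) (hs0 : ∀ ω, 0 ≤ s ω) (hs1 : ∀ ω, s ω ≤ 1) {N a b : ℝ}
    (ha : 0 < a) (hb : 0 ≤ b) (h : ∀ k, ∫ ω, s ω ^ k ∂ν = N * (poch a k / poch (a + b) k))
    (k j : ℕ) : ∫ ω, s ω ^ k * (1 - s ω) ^ j ∂ν =
      N * (poch a k * poch b j / poch (a + b) (k + j)) := by
  induction j generalizing k with
  | zero => simpa using h k
  | succ j ih =>
    have i1 := integrable_dirichlet ν hs hs0 hs1 k j
    have i2 := integrable_dirichlet ν hs hs0 hs1 (k + 1) j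
    -- One factor `1 - s` is expanded; the induction closes because `(a + b + k + j) - (a + k) = b +
    -- j`.
    have e : (fun ω => s ω ^ k * (1 - s ω) ^ (j + 1)) =
        fun ω => s ω ^ k * (1 - s ω) ^ j - s ω ^ (k + 1) * (1 - s ω) ^ j := by
      funext ω; ring
    have hab : 0 < a + b := by positivity
    have p1 := (poch_pos hab (k + j)).ne'
    have p2 : a + b + ((k + j : ℕ) : ℝ) ≠ 0 := by positivity
    rw [e, integral_sub i1 i2, ih, ih, show k + 1 + j = k + j + 1 by ring,
      show k + (j + 1) = k + j + 1 by ring, poch_succ (a + b), poch_succ a, poch_succ b]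
    push_cast at p2 ⊢
    field_simp
    ring

end FracLap

/-! ### From the principal value to second differences, and local bounds -/

namespace FracLap

open MeasureTheory Filter Topology Set

lemma powFun_eq_ballPow (d : ℕ) (p : ℝ) (y : EuclideanSpace ℝ (Fin d)) :
    powFun d p y = ballPow p ‖y‖ := by simp [powFun, ballPow]

lemma measurable_powFun (d : ℕ) (p : ℝ) : Measurable (powFun d p) := by
  have : powFun d p = fun y => ballPow p ‖y‖ := funext (powFun_eq_ballPow d p)
  rw [this]
  exact (measurable_ballPow p).comp measurable_norm

lemma nontrivial_euclidean {d : ℕ} (hd : 1 ≤ d) : Nontrivial (EuclideanSpace ℝ (Fin d)) :=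
  Module.nontrivial_of_finrank_pos (R := ℝ) (by simp; omega)

lemma integrable_powFun {d : ℕ} (hd : 1 ≤ d) {p : ℝ} (hp : -1 < p) : Integrable (powFun d p) := by
  have := nontrivial_euclidean hd
  have e : powFun d p = fun y => ballPow p ‖y‖ := funext (powFun_eq_ballPow d p)
  rw [e, integrable_fun_norm_addHaar]
  have h1 : IntegrableOn (fun y : ℝ => y ^ (Module.finrank ℝ (EuclideanSpace ℝ (Fin d)) - 1) •
      ballPow p y) (Ioo 0 1) := by
    refine (integrableOn_beta_sq (s := ((d - 1 : ℕ) : ℝ)) (lt_of_lt_of_le (by norm_num)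
      (Nat.cast_nonneg _)) hp).congr_fun ?_ measurableSet_Ioo
    intro w hw
    simp only [Real.rpow_natCast, finrank_euclideanSpace, Fintype.card_fin, smul_eq_mul]
    rw [ballPow_of_lt (by rw [abs_of_pos hw.1]; exact hw.2), mul_comm]
  refine h1.of_forall_sdiff_eq_zero measurableSet_Ioi fun y hy => ?_
  have hy0 : 0 < y := hy.1
  have hy1 : 1 ≤ y := not_lt.mp fun h => hy.2 ⟨hy0, h⟩
  rw [ballPow_of_le (by rwa [abs_of_pos hy0]), smul_zero]

lemma integrable_powFunLast {d : ℕ} (hd : 1 ≤ d) {p : ℝ} (hp : -1 < p) :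
    Integrable (powFunLast d hd p) := by
  refine Integrable.mono' (integrable_powFun hd hp)
    ((measurable_powFun d p).mul (by fun_prop)).aestronglyMeasurable (Eventually.of_forall fun y => ?_)
  simp only [powFunLast]
  have h0 : 0 ≤ powFun d p y := by rw [powFun_eq_ballPow]; exact ballPow_nonneg _ _
  rw [norm_mul, Real.norm_of_nonneg h0]
  rcases lt_or_ge ‖y‖ 1 with h | h
  · exact mul_le_of_le_one_right h0 ((PiLp.norm_apply_le y _).trans h.le)
  · rw [powFun_eq_ballPow, ballPow_of_le (by rwa [abs_norm]), zero_mul]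

section Kernel

variable {d : ℕ} {α : ℝ}

lemma integrableOn_norm_rpow_compl (hd : 1 ≤ d) (hα0 : 0 < α) {ε : ℝ} (hε : 0 < ε) :
    IntegrableOn (fun y : EuclideanSpace ℝ (Fin d) => (‖y‖ ^ ((d : ℝ) + α))⁻¹) {y | ε < ‖y‖} := by
  have := nontrivial_euclidean hd
  have hm : MeasurableSet {y : EuclideanSpace ℝ (Fin d) | ε < ‖y‖} :=
    measurableSet_lt measurable_const measurable_norm
  rw [← integrable_indicator_iff hm]
  have e : ({y : EuclideanSpace ℝ (Fin d) | ε < ‖y‖}.indicator fun y => (‖y‖ ^ ((d : ℝ) + α))⁻¹) =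
      fun y => (Ioi ε).indicator (fun r => (r ^ ((d : ℝ) + α))⁻¹) ‖y‖ := by
    funext y; simp [indicator]
  rw [e, integrable_fun_norm_addHaar]
  have h := (integrableOn_Ioi_rpow_of_lt (by linarith : -1 - α < -1) hε)
  have h' : IntegrableOn ((Ioi ε).indicator fun r => r ^ (-1 - α)) (Ioi 0) :=
    (h.integrable_indicator measurableSet_Ioi).integrableOn
  refine h'.congr_fun ?_ measurableSet_Ioi
  intro r hr
  have hr : 0 < r := hr
  by_cases h : ε < r
  · simp only [mem_Ioi, h, indicator_of_mem, finrank_euclideanSpace, Fintype.card_fin, smul_eq_mul]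
    rw [← Real.rpow_natCast, ← Real.rpow_neg hr.le, ← Real.rpow_add hr]
    congr 1
    push_cast [Nat.cast_sub hd]; ring
  · simp [h]

/-- The radial integrand is `r^(d-1) r² r^(-d-α) = r^(1-α)`, integrable at `0` because `α < 2`. -/
lemma integrableOn_norm_rpow_ball (hd : 1 ≤ d) (hα2 : α < 2) {ε : ℝ} :
    IntegrableOn (fun y : EuclideanSpace ℝ (Fin d) => ‖y‖ ^ 2 * (‖y‖ ^ ((d : ℝ) + α))⁻¹)
      (Metric.ball 0 ε) := by
  have := nontrivial_euclidean hd
  rw [integrableOn_fun_norm_addHaar volume (f := fun r => r ^ 2 * (r ^ ((d : ℝ) + α))⁻¹)]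
  rcases le_or_gt ε 0 with h0 | h0
  · rw [Ioo_eq_empty (by linarith)]; exact integrableOn_empty
  have h : IntervalIntegrable (fun r : ℝ => r ^ (1 - α)) volume 0 ε :=
    intervalIntegral.intervalIntegrable_rpow' (by linarith)
  rw [intervalIntegrable_iff_integrableOn_Ioo_of_le h0.le] at h
  refine h.congr_fun ?_ measurableSet_Ioo
  intro r hr
  simp only [finrank_euclideanSpace, Fintype.card_fin, smul_eq_mul]
  rw [← Real.rpow_natCast, ← Real.rpow_neg hr.1.le, ← Real.rpow_natCast r 2, ← Real.rpow_add hr.1,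
    ← Real.rpow_add hr.1]
  congr 1
  push_cast [Nat.cast_sub hd]; ring

lemma integrableOn_mul_norm_rpow_compl (hα0 : 0 < α) {ε : ℝ} (hε : 0 < ε)
    {g : EuclideanSpace ℝ (Fin d) → ℝ} (hg : Integrable g) :
    IntegrableOn (fun y => g y * (‖y‖ ^ ((d : ℝ) + α))⁻¹) {y | ε < ‖y‖} := by
  have hm : MeasurableSet {y : EuclideanSpace ℝ (Fin d) | ε < ‖y‖} :=
    measurableSet_lt measurable_const measurable_norm
  refine Integrable.mono' ((hg.norm.mul_const (ε ^ ((d : ℝ) + α))⁻¹).integrableOn)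
    (hg.aestronglyMeasurable.restrict.mul
      ((measurable_norm.pow_const _).inv).aestronglyMeasurable) ?_
  filter_upwards [ae_restrict_mem hm] with y hy
  have hy : ε < ‖y‖ := hy
  rw [norm_mul, Real.norm_of_nonneg (inv_nonneg.mpr (Real.rpow_nonneg (norm_nonneg y) _))]
  gcongr

lemma integrableOn_integrand_translate (hd : 1 ≤ d) (hα0 : 0 < α)
    {w : EuclideanSpace ℝ (Fin d) → ℝ} (hw : Integrable w) (x : EuclideanSpace ℝ (Fin d)) {ε : ℝ}
    (hε : 0 < ε) :
    IntegrableOn (fun y => (w (x + y) - w x) / ‖y‖ ^ ((d : ℝ) + α)) {y | ε < ‖y‖} := by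
  have h1 := integrableOn_mul_norm_rpow_compl hα0 hε (hw.comp_add_left x)
  have h2 := (integrableOn_norm_rpow_compl hd hα0 hε).const_mul (w x)
  refine (h1.sub h2).congr (Eventually.of_forall fun y => ?_)
  simp only [Pi.sub_apply]
  ring

lemma measurableSet_norm_gt (ε : ℝ) : MeasurableSet {y : EuclideanSpace ℝ (Fin d) | ε < ‖y‖} :=
  measurableSet_lt measurable_const measurable_norm

lemma indicator_integrand (w : EuclideanSpace ℝ (Fin d) → ℝ) (x : EuclideanSpace ℝ (Fin d))
    (ε : ℝ) (y : EuclideanSpace ℝ (Fin d)) :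
    {y | ε < ‖y - x‖}.indicator (integrand d α w x) (x + y) =
      {y | ε < ‖y‖}.indicator (fun y => (w (x + y) - w x) / ‖y‖ ^ ((d : ℝ) + α)) y := by
  simp [indicator, integrand]

/-- The fractional Laplacian as an absolutely convergent integral of second differences. -/
lemma hasFracLaplacianAt_of_integrable_symm (hd : 1 ≤ d) (hα0 : 0 < α)
    {w : EuclideanSpace ℝ (Fin d) → ℝ} (hw : Integrable w) (x : EuclideanSpace ℝ (Fin d))
    (hS : Integrable fun y => (w (x + y) + w (x - y) - 2 * w x) / ‖y‖ ^ ((d : ℝ) + α)) :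
    HasFracLaplacianAt d α w x (normConst d α *
      ((∫ y, (w (x + y) + w (x - y) - 2 * w x) / ‖y‖ ^ ((d : ℝ) + α)) / 2)) := by
  have hm : ∀ ε : ℝ, MeasurableSet {y : EuclideanSpace ℝ (Fin d) | ε < ‖y - x‖} := fun ε =>
    measurableSet_lt measurable_const (by fun_prop)
  constructor
  · intro ε hε
    rw [← integrable_indicator_iff (hm ε)]
    have h := integrableOn_integrand_translate hd hα0 hw x hε
    rw [← integrable_indicator_iff (measurableSet_norm_gt ε)] at h
    have h2 := h.comp_add_left (-x)
    refine h2.congr (Eventually.of_forall fun y => ?_)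
    simp only
    rw [← indicator_integrand, add_neg_cancel_left]
  · refine Tendsto.const_mul _ ?_
    have hcov : AECover (volume : Measure (EuclideanSpace ℝ (Fin d))) (𝓝[>] (0 : ℝ))
        fun ε => {y | ε < ‖y‖} := by
      have := nontrivial_euclidean hd
      refine ⟨?_, fun ε => measurableSet_norm_gt ε⟩
      have h0 : ∀ᵐ y : EuclideanSpace ℝ (Fin d), y ≠ 0 := by
        simp [ae_iff]
      filter_upwards [h0] with y hy
      exact (eventually_lt_nhds (norm_pos_iff.mpr hy)).filter_mono nhdsWithin_le_nhds
    have ht := (hcov.integral_tendsto_of_countably_generated hS).div_const 2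
    refine ht.congr' ?_
    filter_upwards [self_mem_nhdsWithin] with ε hε
    have hε : 0 < ε := hε
    have i1 := integrableOn_integrand_translate hd hα0 hw x hε
    have e1 : ∫ y in {y | ε < ‖y - x‖}, integrand d α w x y =
        ∫ y in {y | ε < ‖y‖}, (w (x + y) - w x) / ‖y‖ ^ ((d : ℝ) + α) := by
      rw [← integral_indicator (hm ε), ← integral_indicator (measurableSet_norm_gt ε),
        ← integral_add_left_eq_self _ x]
      exact integral_congr_ae (Eventually.of_forall fun y => indicator_integrand w x ε y)
    have hneg : ∀ y, {y | ε < ‖y‖}.indicator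
        (fun y => (w (x + y) - w x) / ‖y‖ ^ ((d : ℝ) + α)) (-y) =
        {y | ε < ‖y‖}.indicator (fun y => (w (x - y) - w x) / ‖y‖ ^ ((d : ℝ) + α)) y := by
      intro y; simp [indicator, sub_eq_add_neg]
    have i2 : IntegrableOn (fun y => (w (x - y) - w x) / ‖y‖ ^ ((d : ℝ) + α)) {y | ε < ‖y‖} := by
      rw [← integrable_indicator_iff (measurableSet_norm_gt ε)] at i1 ⊢
      exact i1.comp_neg.congr (Eventually.of_forall hneg)
    -- The truncated region and the kernel are invariant under `y ↦ -y`, so both one-sided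
    -- differences have the same integral.
    have e2 : ∫ y in {y | ε < ‖y‖}, (w (x - y) - w x) / ‖y‖ ^ ((d : ℝ) + α) =
        ∫ y in {y | ε < ‖y‖}, (w (x + y) - w x) / ‖y‖ ^ ((d : ℝ) + α) := by
      rw [← integral_indicator (measurableSet_norm_gt ε),
        ← integral_indicator (measurableSet_norm_gt ε), ← integral_neg_eq_self]
      refine integral_congr_ae (Eventually.of_forall fun y => ?_)
      simp only
      rw [← hneg, neg_neg]
    have e3 : ∫ y in {y | ε < ‖y‖}, (w (x + y) + w (x - y) - 2 * w x) / ‖y‖ ^ ((d : ℝ) + α) =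
        (∫ y in {y | ε < ‖y‖}, (w (x + y) - w x) / ‖y‖ ^ ((d : ℝ) + α)) +
          ∫ y in {y | ε < ‖y‖}, (w (x - y) - w x) / ‖y‖ ^ ((d : ℝ) + α) := by
      rw [← integral_add i1 i2]
      refine integral_congr_ae (Eventually.of_forall fun y => ?_)
      simp only
      ring
    rw [e1, e3, e2]; ring

end Kernel

section LocalBounds

variable {d : ℕ}

/-- Rests on `1 - ‖x + y‖² = (1 - ‖x‖²)(1 + a)` with `a` the displayed quotient; the radius `(1 -
‖x‖²)/6` forces `|a| ≤ 1/2`, the range of the Taylor bound used later. -/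
lemma powFun_add_of_small {p : ℝ} {x y : EuclideanSpace ℝ (Fin d)} (hx : ‖x‖ < 1)
    (hy : ‖y‖ < (1 - ‖x‖ ^ 2) / 6) :
    |(-2 * inner ℝ x y - ‖y‖ ^ 2) / (1 - ‖x‖ ^ 2)| ≤ 3 * ‖y‖ / (1 - ‖x‖ ^ 2) ∧
      3 * ‖y‖ / (1 - ‖x‖ ^ 2) ≤ 1 / 2 ∧
      powFun d p (x + y) = (1 - ‖x‖ ^ 2) ^ p *
        (1 + (-2 * inner ℝ x y - ‖y‖ ^ 2) / (1 - ‖x‖ ^ 2)) ^ p := by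
  have hm : 0 < 1 - ‖x‖ ^ 2 := by nlinarith [norm_nonneg x]
  have hy0 := norm_nonneg y
  have hy1 : ‖y‖ ≤ 1 := by nlinarith [sq_nonneg ‖x‖]
  have hi : |inner ℝ x y| ≤ ‖y‖ := (abs_real_inner_le_norm x y).trans
    (mul_le_of_le_one_left hy0 hx.le)
  have h1 : |(-2 * inner ℝ x y - ‖y‖ ^ 2) / (1 - ‖x‖ ^ 2)| ≤ 3 * ‖y‖ / (1 - ‖x‖ ^ 2) := by
    rw [abs_div, abs_of_pos hm]
    gcongr
    obtain ⟨h1, h2⟩ := abs_le.mp hi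
    rw [abs_le]
    constructor <;> nlinarith
  have h2 : 3 * ‖y‖ / (1 - ‖x‖ ^ 2) ≤ 1 / 2 := by
    rw [div_le_iff₀ hm]; linarith
  refine ⟨h1, h2, ?_⟩
  set a := (-2 * inner ℝ x y - ‖y‖ ^ 2) / (1 - ‖x‖ ^ 2) with ha
  have ha1 : 0 < 1 + a := by linarith [(abs_le.mp (h1.trans h2)).1]
  have hma : (1 - ‖x‖ ^ 2) * (1 + a) = 1 - ‖x + y‖ ^ 2 := by
    rw [norm_add_sq_real, ha]; field_simp; ring
  have hlt : ‖x + y‖ < 1 := by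
    have : 0 < 1 - ‖x + y‖ ^ 2 := hma ▸ mul_pos hm ha1
    nlinarith [norm_nonneg (x + y)]
  rw [powFun_eq_ballPow, ballPow_of_lt (by rwa [abs_norm]), ← hma, Real.mul_rpow hm.le ha1.le]

/-- Second and first order difference bounds of `powFun` at an interior point. -/
lemma exists_powFun_bounds (p : ℝ) {x : EuclideanSpace ℝ (Fin d)} (hx : ‖x‖ < 1) :
    ∃ C ε, 0 ≤ C ∧ 0 < ε ∧ ∀ y : EuclideanSpace ℝ (Fin d), ‖y‖ < ε →
      |powFun d p (x + y) + powFun d p (x - y) - 2 * powFun d p x| ≤ C * ‖y‖ ^ 2 ∧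
      |powFun d p (x + y) - powFun d p (x - y)| ≤ C * ‖y‖ := by
  obtain ⟨C, hC, h⟩ := exists_rpow_taylor_bound p (ρ := 1 / 2) (by norm_num) (by norm_num)
  have hm : 0 < 1 - ‖x‖ ^ 2 := by nlinarith [norm_nonneg x]
  have hP : 0 < (1 - ‖x‖ ^ 2) ^ p := Real.rpow_pos_of_pos hm p
  set m := 1 - ‖x‖ ^ 2 with hmdef
  -- The part `18 C / m²` is `2 C (3/m)²`, from two Taylor remainders; `4 |p| / m` covers the linear
  -- parts, as `a + b = -2‖y‖²/m` and `a - b = -4⟨x, y⟩/m`.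
  refine ⟨m ^ p * (18 * C / m ^ 2 + 4 * |p| / m), m / 6, by positivity, by positivity,
    fun y hy => ?_⟩
  have hy0 := norm_nonneg y
  obtain ⟨a1, a2, a3⟩ := powFun_add_of_small (p := p) hx hy
  obtain ⟨b1, b2, b3⟩ := powFun_add_of_small (p := p) (y := -y) hx (by rwa [norm_neg])
  rw [norm_neg] at b1 b2
  rw [← sub_eq_add_neg] at b3
  rw [inner_neg_right] at b1
  rw [inner_neg_right, norm_neg] at b3
  rw [← hmdef] at a1 a2 a3 b1 b2 b3
  set a := (-2 * inner ℝ x y - ‖y‖ ^ 2) / m with ha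
  set b := (-2 * -inner ℝ x y - ‖y‖ ^ 2) / m with hb
  have hx0 : powFun d p x = m ^ p := by
    rw [powFun_eq_ballPow, ballPow_of_lt (by rwa [abs_norm])]
  have Ta := h a (a1.trans a2)
  have Tb := h b (b1.trans b2)
  have hsq : ∀ c : ℝ, |c| ≤ 3 * ‖y‖ / m → C * c ^ 2 ≤ 9 * C / m ^ 2 * ‖y‖ ^ 2 := by
    intro c hc
    have : c ^ 2 ≤ (3 * ‖y‖ / m) ^ 2 := by
      rw [← sq_abs]; exact pow_le_pow_left₀ (abs_nonneg c) hc 2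
    calc C * c ^ 2 ≤ C * (3 * ‖y‖ / m) ^ 2 := mul_le_mul_of_nonneg_left this hC
      _ = _ := by rw [div_pow, mul_pow]; ring
  have Ta' := Ta.trans (hsq a a1)
  have Tb' := Tb.trans (hsq b b1)
  have hi : |inner ℝ x y| ≤ ‖y‖ := (abs_real_inner_le_norm x y).trans
    (mul_le_of_le_one_left hy0 hx.le)
  have hm1 : m ≤ 1 := by rw [hmdef]; nlinarith [sq_nonneg ‖x‖]
  have hy1 : ‖y‖ ≤ 1 := by linarith
  have hyy : ‖y‖ ^ 2 ≤ ‖y‖ := by nlinarith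
  have hCm : 0 ≤ 18 * C / m ^ 2 := by positivity
  have hpm : 0 ≤ |p| / m := by positivity
  rw [a3, b3, hx0]
  constructor
  · have e : m ^ p * (1 + a) ^ p + m ^ p * (1 + b) ^ p - 2 * m ^ p =
        m ^ p * (((1 + a) ^ p - 1 - p * a) + ((1 + b) ^ p - 1 - p * b) + p * (a + b)) := by ring
    have hab : |p * (a + b)| = 2 * |p| / m * ‖y‖ ^ 2 := by
      rw [show a + b = -(2 * ‖y‖ ^ 2 / m) by rw [ha, hb]; ring, abs_mul, abs_neg,
        abs_of_nonneg (by positivity : 0 ≤ 2 * ‖y‖ ^ 2 / m)]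
      ring
    rw [e, abs_mul, abs_of_pos hP, mul_assoc]
    refine mul_le_mul_of_nonneg_left ?_ hP.le
    refine (abs_add_le _ _).trans ((add_le_add (abs_add_le _ _) le_rfl).trans ?_)
    rw [hab]
    have : 0 ≤ |p| / m * ‖y‖ ^ 2 := by positivity
    have e2 : (18 * C / m ^ 2 + 4 * |p| / m) * ‖y‖ ^ 2 = 9 * C / m ^ 2 * ‖y‖ ^ 2 +
      9 * C / m ^ 2 * ‖y‖ ^ 2 + 2 * |p| / m * ‖y‖ ^ 2 + 2 * (|p| / m * ‖y‖ ^ 2) := by ring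
    rw [e2]
    linarith
  · have e : m ^ p * (1 + a) ^ p - m ^ p * (1 + b) ^ p =
        m ^ p * (((1 + a) ^ p - 1 - p * a) - ((1 + b) ^ p - 1 - p * b) + p * (a - b)) := by ring
    have hab : |p * (a - b)| ≤ 4 * |p| / m * ‖y‖ := by
      rw [show a - b = -(4 * inner ℝ x y / m) by rw [ha, hb]; ring, abs_mul, abs_neg, abs_div,
        abs_mul, abs_of_pos hm]
      have : |p| * (|4| * |inner ℝ x y| / m) = 4 * |p| / m * |inner ℝ x y| := by
        rw [abs_of_pos (by norm_num : (0 : ℝ) < 4)]; ring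
      rw [this]
      exact mul_le_mul_of_nonneg_left hi (by positivity)
    rw [e, abs_mul, abs_of_pos hP, mul_assoc]
    refine mul_le_mul_of_nonneg_left ?_ hP.le
    refine (abs_add_le _ _).trans ((add_le_add (abs_sub _ _) hab).trans ?_)
    have h3 := mul_le_mul_of_nonneg_left hyy hCm
    have e2 : (18 * C / m ^ 2 + 4 * |p| / m) * ‖y‖ = 18 * C / m ^ 2 * ‖y‖ + 4 * |p| / m * ‖y‖ := by
      ring
    have e3 : 18 * C / m ^ 2 * ‖y‖ ^ 2 = 9 * C / m ^ 2 * ‖y‖ ^ 2 + 9 * C / m ^ 2 * ‖y‖ ^ 2 := by ring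
    rw [e2]
    linarith

end LocalBounds

end FracLap

/-! ### Integrability of the difference quotients -/

namespace FracLap

open MeasureTheory Filter Topology Set

section Integrability

variable {d : ℕ} {α : ℝ}

lemma integrable_of_ball_of_compl {g : EuclideanSpace ℝ (Fin d) → ℝ} {ε : ℝ} (hε : 0 < ε)
    (h1 : IntegrableOn g (Metric.ball 0 ε)) (h2 : ∀ δ, 0 < δ → IntegrableOn g {y | δ < ‖y‖}) :
    Integrable g := by
  rw [← integrableOn_univ]
  refine (h1.union (h2 (ε / 2) (by positivity))).mono_set fun y _ => ?_
  rcases lt_or_ge ‖y‖ ε with h | h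
  · left; simpa using h
  · right
    have : ε / 2 < ‖y‖ := by linarith
    exact this

/-- Integrability of the second difference quotient of `powFun`. -/
lemma integrable_second_difference (hd : 1 ≤ d) (hα0 : 0 < α) (hα2 : α < 2) {p : ℝ} (hp : -1 < p)
    {x : EuclideanSpace ℝ (Fin d)} (hx : ‖x‖ < 1) :
    Integrable fun y => (powFun d p (x + y) + powFun d p (x - y) - 2 * powFun d p x) /
      ‖y‖ ^ ((d : ℝ) + α) := by
  obtain ⟨C, ε, hC, hε, h⟩ := exists_powFun_bounds p hx
  have hm := measurable_powFun d p
  refine integrable_of_ball_of_compl hε ?_ fun δ hδ => ?_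
  · refine Integrable.mono' ((integrableOn_norm_rpow_ball hd hα2).const_mul C)
      (Measurable.aestronglyMeasurable ?_) ?_
    · exact (((hm.comp (by fun_prop)).add (hm.comp (by fun_prop))).sub_const _).div
        (measurable_norm.pow_const _)
    · filter_upwards [ae_restrict_mem Metric.isOpen_ball.measurableSet] with y hy
      have hn : 0 ≤ (‖y‖ ^ ((d : ℝ) + α))⁻¹ := inv_nonneg.mpr (Real.rpow_nonneg (norm_nonneg y) _)
      rw [div_eq_mul_inv, norm_mul, Real.norm_of_nonneg hn, ← mul_assoc]
      exact mul_le_mul_of_nonneg_right (h y (by simpa using hy)).1 hn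
  · have hu := integrable_powFun hd hp
    have h1 := integrableOn_mul_norm_rpow_compl hα0 hδ (hu.comp_add_left x)
    have h2 := integrableOn_mul_norm_rpow_compl hα0 hδ (hu.comp_sub_left x)
    have h3 := (integrableOn_norm_rpow_compl hd hα0 hδ).const_mul (2 * powFun d p x)
    refine ((h1.add h2).sub h3).congr (Eventually.of_forall fun y => ?_)
    simp only [Pi.sub_apply, Pi.add_apply]
    ring

/-- Integrability of the weighted first difference quotient of `powFun`. -/
lemma integrable_first_difference (hd : 1 ≤ d) (hα0 : 0 < α) (hα2 : α < 2) {p : ℝ} (hp : -1 < p)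
    {x : EuclideanSpace ℝ (Fin d)} (hx : ‖x‖ < 1) (a : EuclideanSpace ℝ (Fin d)) :
    Integrable fun y => inner ℝ a y * (powFun d p (x + y) - powFun d p (x - y)) /
      ‖y‖ ^ ((d : ℝ) + α) := by
  obtain ⟨C, ε, hC, hε, h⟩ := exists_powFun_bounds p hx
  have hm := measurable_powFun d p
  have hmeas : Measurable fun y => inner ℝ a y * (powFun d p (x + y) - powFun d p (x - y)) /
      ‖y‖ ^ ((d : ℝ) + α) :=
    ((by fun_prop : Measurable fun y => inner ℝ a y).mul
      ((hm.comp (by fun_prop)).sub (hm.comp (by fun_prop)))).div (measurable_norm.pow_const _)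
  refine integrable_of_ball_of_compl hε ?_ fun δ hδ => ?_
  · refine Integrable.mono' ((integrableOn_norm_rpow_ball hd hα2).const_mul (‖a‖ * C))
      hmeas.aestronglyMeasurable ?_
    filter_upwards [ae_restrict_mem Metric.isOpen_ball.measurableSet] with y hy
    have hn : 0 ≤ (‖y‖ ^ ((d : ℝ) + α))⁻¹ := inv_nonneg.mpr (Real.rpow_nonneg (norm_nonneg y) _)
    rw [div_eq_mul_inv, norm_mul, Real.norm_of_nonneg hn, ← mul_assoc, norm_mul]
    refine mul_le_mul_of_nonneg_right ?_ hn
    calc ‖inner ℝ a y‖ * ‖powFun d p (x + y) - powFun d p (x - y)‖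
        ≤ (‖a‖ * ‖y‖) * (C * ‖y‖) := mul_le_mul (norm_inner_le_norm a y)
          (h y (by simpa using hy)).2 (norm_nonneg _) (by positivity)
      _ = _ := by ring
  -- Away from the origin the growth of `⟨a, y⟩` is absorbed by the kernel: `‖y‖^(-(d+α-1))` stays
  -- bounded as `d + α - 1 > 0`.
  · have hu := integrable_powFun hd hp
    refine Integrable.mono' ((((hu.comp_add_left x).norm.add
      (hu.comp_sub_left x).norm).const_mul
      (‖a‖ * (δ ^ ((d : ℝ) + α - 1))⁻¹)).integrableOn) hmeas.aestronglyMeasurable ?_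
    filter_upwards [ae_restrict_mem (measurableSet_norm_gt δ)] with y hy
    have hy : δ < ‖y‖ := hy
    have hy0 : 0 < ‖y‖ := hδ.trans hy
    have hd' : (1 : ℝ) ≤ d := by exact_mod_cast hd
    have hn : 0 ≤ (‖y‖ ^ ((d : ℝ) + α))⁻¹ := inv_nonneg.mpr (Real.rpow_nonneg hy0.le _)
    rw [div_eq_mul_inv, norm_mul, Real.norm_of_nonneg hn, norm_mul]
    simp only [Pi.add_apply]
    calc ‖inner ℝ a y‖ * ‖powFun d p (x + y) - powFun d p (x - y)‖ * (‖y‖ ^ ((d : ℝ) + α))⁻¹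
        ≤ (‖a‖ * ‖y‖) * (‖powFun d p (x + y)‖ + ‖powFun d p (x - y)‖) *
            (‖y‖ ^ ((d : ℝ) + α))⁻¹ := by
          gcongr
          · exact norm_inner_le_norm a y
          · exact norm_sub_le _ _
      _ = ‖a‖ * (‖y‖ ^ ((d : ℝ) + α - 1))⁻¹ *
            (‖powFun d p (x + y)‖ + ‖powFun d p (x - y)‖) := by
          rw [Real.rpow_sub_one hy0.ne']
          field_simp
      _ ≤ _ := by
          gcongr
          linarith

end Integrability

/-! ### Restriction to lines and the radial integrals -/

section Line

variable {d : ℕ}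

lemma chord_sq_pos {x ω : EuclideanSpace ℝ (Fin d)} (hx : ‖x‖ < 1) :
    0 < 1 - ‖x‖ ^ 2 + inner ℝ x ω ^ 2 := by
  have : 0 < 1 - ‖x‖ ^ 2 := by nlinarith [norm_nonneg x]
  positivity

/-- The restriction of `powFun` to a line is a rescaled `ballPow`. -/
lemma powFun_line (p : ℝ) {x ω : EuclideanSpace ℝ (Fin d)} (hx : ‖x‖ < 1) (hω : ‖ω‖ = 1) (r : ℝ) :
    powFun d p (x + r • ω) = (1 - ‖x‖ ^ 2 + inner ℝ x ω ^ 2) ^ p *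
      ballPow p (inner ℝ x ω / √(1 - ‖x‖ ^ 2 + inner ℝ x ω ^ 2) +
        (√(1 - ‖x‖ ^ 2 + inner ℝ x ω ^ 2))⁻¹ * r) := by
  have hm := chord_sq_pos (ω := ω) hx
  set s := inner ℝ x ω with hs
  set m := 1 - ‖x‖ ^ 2 + s ^ 2 with hmdef
  have hh := Real.sqrt_pos.mpr hm
  have hsq := Real.sq_sqrt hm.le
  -- Completing the square: `1 - ‖x + r ω‖² = m - (s + r)²`, so the line cuts the ball in a chord of
  -- half-length `√m` centred at `r = -s`.
  have hn : 1 - ‖x + r • ω‖ ^ 2 = m * (1 - (s / √m + (√m)⁻¹ * r) ^ 2) := by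
    have h2 : m * (s / √m + (√m)⁻¹ * r) ^ 2 = (s + r) ^ 2 := by
      rw [show s / √m + (√m)⁻¹ * r = (s + r) / √m by field_simp, div_pow, hsq]
      field_simp
    rw [mul_sub, h2, norm_add_sq_real, inner_smul_right, norm_smul, hω, mul_one,
      Real.norm_eq_abs, sq_abs, ← hs, hmdef]
    ring
  rw [powFun_eq_ballPow]
  by_cases h : |s / √m + (√m)⁻¹ * r| < 1
  · have h1 : 0 < 1 - (s / √m + (√m)⁻¹ * r) ^ 2 := by
      have := (sq_lt_one_iff_abs_lt_one _).mpr h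
      linarith
    have h2 : |‖x + r • ω‖| < 1 := by
      rw [← sq_lt_one_iff_abs_lt_one]
      nlinarith [mul_pos hm h1]
    rw [ballPow_of_lt h, ballPow_of_lt h2, hn, Real.mul_rpow hm.le h1.le]
  · have h1 : 1 - (s / √m + (√m)⁻¹ * r) ^ 2 ≤ 0 := by
      have := (sq_lt_one_iff_abs_lt_one _).not.mpr h
      linarith
    have h2 : ¬ |‖x + r • ω‖| < 1 := by
      rw [← sq_lt_one_iff_abs_lt_one]
      nlinarith [mul_nonpos_of_nonneg_of_nonpos hm.le h1]
    rw [ballPow_of_le (not_lt.mp h), ballPow_of_le (not_lt.mp h2), mul_zero]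

lemma chord_center_sq_lt {x ω : EuclideanSpace ℝ (Fin d)} (hx : ‖x‖ < 1) :
    |inner ℝ x ω / √(1 - ‖x‖ ^ 2 + inner ℝ x ω ^ 2)| < 1 := by
  have hm := chord_sq_pos (ω := ω) hx
  rw [← sq_lt_one_iff_abs_lt_one, div_pow, Real.sq_sqrt hm.le, div_lt_one hm]
  nlinarith [norm_nonneg x]

/-- Scaling in a half line integral against a power weight. -/
lemma integral_rescale {D : ℝ → ℝ} {h K q : ℝ} (hh : 0 < h) (hK : 0 < K)
    (hI : IntegrableOn (fun r => K * D (h⁻¹ * r) * r ^ q) (Ioi 0)) :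
    IntegrableOn (fun r => D r * r ^ q) (Ioi 0) ∧
      ∫ r in Ioi 0, K * D (h⁻¹ * r) * r ^ q = K * h ^ (q + 1) * ∫ r in Ioi 0, D r * r ^ q := by
  have e : EqOn (fun r => K * D (h⁻¹ * r) * r ^ q)
      (fun r => (K * h ^ q) * (fun r => D r * r ^ q) (h⁻¹ * r)) (Ioi 0) := by
    intro r hr
    have hr : 0 < r := hr
    simp only
    rw [Real.mul_rpow (inv_nonneg.mpr hh.le) hr.le, Real.inv_rpow hh.le]
    have := (Real.rpow_pos_of_pos hh q).ne'
    field_simp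
  have hKq : K * h ^ q ≠ 0 := (mul_pos hK (Real.rpow_pos_of_pos hh q)).ne'
  constructor
  · have h1 : IntegrableOn (fun r => (K * h ^ q) * (fun r => D r * r ^ q) (h⁻¹ * r)) (Ioi 0) :=
      hI.congr_fun e measurableSet_Ioi
    have h2 : IntegrableOn (fun r => (fun r => D r * r ^ q) (h⁻¹ * r)) (Ioi 0) := by
      refine (h1.const_mul (K * h ^ q)⁻¹).congr (Eventually.of_forall fun r => ?_)
      simp only
      rw [inv_mul_cancel_left₀ hKq]
    have h3 := (integrableOn_Ioi_comp_mul_left_iff (fun r => D r * r ^ q) 0 (inv_pos.mpr hh)).mp h2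
    rwa [mul_zero] at h3
  · rw [setIntegral_congr_fun measurableSet_Ioi e, integral_const_mul,
      integral_comp_mul_left_Ioi (fun r => D r * r ^ q) 0 (inv_pos.mpr hh), mul_zero, inv_inv, smul_eq_mul,
      Real.rpow_add_one hh.ne']
    ring

variable {α : ℝ}

lemma radial_weight (hd : 1 ≤ d) {ω : EuclideanSpace ℝ (Fin d)} (hω : ‖ω‖ = 1) {r : ℝ} (hr : 0 < r) :
    r ^ (d - 1) * (‖r • ω‖ ^ ((d : ℝ) + α))⁻¹ = r ^ (-1 - α) := by
  rw [norm_smul, hω, mul_one, Real.norm_of_nonneg hr.le, ← Real.rpow_natCast, ← Real.rpow_neg hr.le,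
    ← Real.rpow_add hr]
  congr 1
  push_cast [Nat.cast_sub hd]; ring

/-- The radial integral of the second difference of `powFun`. -/
lemma radial_even (hd : 1 ≤ d) (hα0 : 0 < α) (hα2 : α < 2) {p : ℝ} (hp : -1 < p)
    {x ω : EuclideanSpace ℝ (Fin d)} (hx : ‖x‖ < 1) (hω : ‖ω‖ = 1)
    (hI : IntegrableOn (fun r : ℝ => r ^ (d - 1) * ((powFun d p (x + r • ω) +
      powFun d p (x - r • ω) - 2 * powFun d p x) / ‖r • ω‖ ^ ((d : ℝ) + α))) (Ioi 0)) :
    ∫ r in Ioi (0 : ℝ), r ^ (d - 1) * ((powFun d p (x + r • ω) +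
      powFun d p (x - r • ω) - 2 * powFun d p x) / ‖r • ω‖ ^ ((d : ℝ) + α)) =
      ProbabilityTheory.beta (-α / 2) (p + 1) *
        ((1 - ‖x‖ ^ 2 + inner ℝ x ω ^ 2) ^ (-(α / 2 - p)) *
          ordinaryHypergeometric ((1 + α) / 2) (α / 2 - p) (1 / 2)
            (inner ℝ x ω ^ 2 / (1 - ‖x‖ ^ 2 + inner ℝ x ω ^ 2))) := by
  have hm := chord_sq_pos (ω := ω) hx
  have hl := powFun_line p hx hω
  have hξ := chord_center_sq_lt (ω := ω) hx
  set m := 1 - ‖x‖ ^ 2 + inner ℝ x ω ^ 2 with hmdef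
  have hh := Real.sqrt_pos.mpr hm
  set ξ := inner ℝ x ω / √m with hξdef
  have hK := Real.rpow_pos_of_pos hm p
  have e : EqOn (fun r : ℝ => r ^ (d - 1) * ((powFun d p (x + r • ω) +
      powFun d p (x - r • ω) - 2 * powFun d p x) / ‖r • ω‖ ^ ((d : ℝ) + α)))
      (fun r => m ^ p * (fun r => ballPow p (ξ + r) + ballPow p (ξ - r) - 2 * ballPow p ξ)
        ((√m)⁻¹ * r) * r ^ (-1 - α)) (Ioi 0) := by
    intro r hr
    have h0 := hl 0
    have h1 := hl (-r)
    rw [zero_smul, mul_zero, add_zero, add_zero] at h0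
    rw [neg_smul, ← sub_eq_add_neg, mul_neg, ← sub_eq_add_neg] at h1
    simp only
    rw [h0, h1, hl r, ← radial_weight hd hω hr]
    ring
  have hI2 := hI.congr_fun e measurableSet_Ioi
  obtain ⟨h1, h2⟩ := integral_rescale
    (D := fun r => ballPow p (ξ + r) + ballPow p (ξ - r) - 2 * ballPow p ξ) hh hK hI2
  rw [setIntegral_congr_fun measurableSet_Ioi e, h2, integral_ballPow_even hα0 hα2 hp hξ h1,
    hξdef, div_pow, Real.sq_sqrt hm.le, Real.sqrt_eq_rpow, ← Real.rpow_mul hm.le,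
    ← Real.rpow_add hm, show p + 1 / 2 * (-1 - α + 1) = -(α / 2 - p) by ring]
  ring

/-- The radial integral of the weighted first difference of `powFun`. -/
lemma radial_odd (hd : 1 ≤ d) (hα0 : 0 < α) (hα2 : α < 2) {p : ℝ} (hp : -1 < p)
    {x ω : EuclideanSpace ℝ (Fin d)} (hx : ‖x‖ < 1) (hω : ‖ω‖ = 1) (e : EuclideanSpace ℝ (Fin d))
    (hI : IntegrableOn (fun r : ℝ => r ^ (d - 1) * (inner ℝ e (r • ω) * (powFun d p (x + r • ω) -
      powFun d p (x - r • ω)) / ‖r • ω‖ ^ ((d : ℝ) + α))) (Ioi 0)) :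
    ∫ r in Ioi (0 : ℝ), r ^ (d - 1) * (inner ℝ e (r • ω) * (powFun d p (x + r • ω) -
      powFun d p (x - r • ω)) / ‖r • ω‖ ^ ((d : ℝ) + α)) =
      α * ProbabilityTheory.beta (-α / 2) (p + 1) * (inner ℝ e ω * inner ℝ x ω *
        ((1 - ‖x‖ ^ 2 + inner ℝ x ω ^ 2) ^ (-(α / 2 - p)) *
          ordinaryHypergeometric ((1 + α) / 2) (α / 2 - p) (3 / 2)
            (inner ℝ x ω ^ 2 / (1 - ‖x‖ ^ 2 + inner ℝ x ω ^ 2)))) := by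
  have hm := chord_sq_pos (ω := ω) hx
  have hl := powFun_line p hx hω
  have hξ := chord_center_sq_lt (ω := ω) hx
  set m := 1 - ‖x‖ ^ 2 + inner ℝ x ω ^ 2 with hmdef
  have hh := Real.sqrt_pos.mpr hm
  set ξ := inner ℝ x ω / √m with hξdef
  have hK := Real.rpow_pos_of_pos hm p
  have key : EqOn (fun r : ℝ => r ^ (d - 1) * (inner ℝ e (r • ω) * (powFun d p (x + r • ω) -
      powFun d p (x - r • ω)) / ‖r • ω‖ ^ ((d : ℝ) + α)))
      (fun r => inner ℝ e ω * (m ^ p * (fun r => ballPow p (ξ + r) - ballPow p (ξ - r))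
        ((√m)⁻¹ * r) * r ^ (-α))) (Ioi 0) := by
    intro r hr
    have hr : 0 < r := hr
    have h1 := hl (-r)
    rw [neg_smul, ← sub_eq_add_neg, mul_neg, ← sub_eq_add_neg] at h1
    simp only
    rw [h1, hl r, show -α = -1 - α + 1 by ring, Real.rpow_add_one hr.ne',
      ← radial_weight hd hω hr, inner_smul_right]
    ring
  rw [setIntegral_congr_fun measurableSet_Ioi key, integral_const_mul]
  -- Integrability of the line integrand follows from `hI` only after division by `⟨e, ω⟩`; where
  -- this vanishes both sides are zero.
  rcases eq_or_ne (inner ℝ e ω) 0 with h0 | h0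
  · rw [h0]; ring
  have hI1 := (hI.congr_fun key measurableSet_Ioi).const_mul (inner ℝ e ω)⁻¹
  have hI2 : IntegrableOn (fun r => m ^ p * (fun r => ballPow p (ξ + r) - ballPow p (ξ - r))
        ((√m)⁻¹ * r) * r ^ (-α)) (Ioi 0) := by
    refine hI1.congr (Eventually.of_forall fun r => ?_)
    simp only
    rw [inv_mul_cancel_left₀ h0]
  obtain ⟨h1, h2⟩ := integral_rescale
    (D := fun r => ballPow p (ξ + r) - ballPow p (ξ - r)) hh hK hI2
  have hs : inner ℝ x ω = ξ * √m := by rw [hξdef]; field_simp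
  rw [h2, integral_ballPow_odd hα0 hα2 hp hξ h1, Real.rpow_add_one hh.ne']
  rw [show inner ℝ x ω ^ 2 / m = ξ ^ 2 by rw [hξdef, div_pow, Real.sq_sqrt hm.le], hs,
    show -(α / 2 - p) = p + 1 / 2 * -α by ring, Real.rpow_add hm, Real.rpow_mul hm.le,
    ← Real.sqrt_eq_rpow]
  ring

end Line

end FracLap

/-! ### Averaging the radial integrals over directions -/

namespace FracLap

open MeasureTheory Filter Topology Set

section SphereAverages

variable {d : ℕ} {α p : ℝ} {e : EuclideanSpace ℝ (Fin d)} {ρ : ℝ}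

lemma inner_sq_le_one {e ω : EuclideanSpace ℝ (Fin d)} (he : ‖e‖ = 1) (hω : ‖ω‖ = 1) :
    inner ℝ e ω ^ 2 ≤ 1 := by
  rw [sq_le_one_iff_abs_le_one]
  simpa [he, hω] using abs_real_inner_le_norm e ω

/-- Gives the squared half-chord the form `1 - t(1 - s)` of `integral_mixture`, with `t = ρ²` and `s
= ⟨e, ω⟩²`. -/
lemma chord_eq (e ω : EuclideanSpace ℝ (Fin d)) (he : ‖e‖ = 1) (ρ : ℝ) :
    1 - ‖ρ • e‖ ^ 2 + inner ℝ (ρ • e) ω ^ 2 = 1 - ρ ^ 2 * (1 - inner ℝ e ω ^ 2) := by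
  rw [norm_smul, he, mul_one, Real.norm_eq_abs, sq_abs, real_inner_smul_left]
  ring

/-- The full integral of the second difference quotient of `powFun`. -/
lemma integral_second_difference (hd : 1 ≤ d) (hα0 : 0 < α) (hα2 : α < 2) (hp : -1 < p)
    (he : ‖e‖ = 1) (hρ0 : 0 ≤ ρ) (hρ1 : ρ < 1) :
    ∫ y, (powFun d p (ρ • e + y) + powFun d p (ρ • e - y) - 2 * powFun d p (ρ • e)) /
      ‖y‖ ^ ((d : ℝ) + α) = sphereArea (EuclideanSpace ℝ (Fin d)) *
        ProbabilityTheory.beta (-α / 2) (p + 1) *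
        ordinaryHypergeometric ((α + d) / 2) (α / 2 - p) ((d : ℝ) / 2) (ρ ^ 2) := by
  have := nontrivial_euclidean hd
  have hx : ‖ρ • e‖ < 1 := by rwa [norm_smul, he, mul_one, Real.norm_of_nonneg hρ0]
  have hd' : (1 : ℝ) ≤ d := by exact_mod_cast hd
  have hS := integrable_second_difference hd hα0 hα2 hp hx
  have hae := ae_integrableOn_polar hS
  have hmeas : Measurable fun ω : Metric.sphere (0 : EuclideanSpace ℝ (Fin d)) 1 =>
    inner ℝ e ω.1 ^ 2 := by fun_prop
  have hs0 : ∀ ω : Metric.sphere (0 : EuclideanSpace ℝ (Fin d)) 1, 0 ≤ inner ℝ e ω.1 ^ 2 :=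
    fun ω => sq_nonneg _
  have hs1 : ∀ ω : Metric.sphere (0 : EuclideanSpace ℝ (Fin d)) 1, inner ℝ e ω.1 ^ 2 ≤ 1 :=
    fun ω => inner_sq_le_one he (by simp)
  -- The variable `⟨e, ω⟩²` has Dirichlet parameters `1/2` and `(d-1)/2`; the second is `0` when `d
  -- = 1`.
  have hmix := integral_mixture (volume : Measure (EuclideanSpace ℝ (Fin d))).toSphere
    (fun _ => 1) (fun ω => inner ℝ e ω.1 ^ 2) (fun _ => zero_le_one) hs0 hs1
    (A := (1 + α) / 2) (a := 1 / 2) (b := ((d : ℝ) - 1) / 2)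
    (N := sphereArea (EuclideanSpace ℝ (Fin d))) (t := ρ ^ 2) (α / 2 - p) (by positivity)
    (by norm_num) (by linarith) (by positivity) (by nlinarith)
    (fun k j => by simpa using integrable_dirichlet _ hmeas hs0 hs1 k j)
    (fun k j => by
      simp only [one_mul]
      refine integral_dirichlet _ hmeas hs0 hs1 (by norm_num) (by linarith) (fun k => ?_) k j
      rw [integral_sphere_moment he, finrank_euclideanSpace, Fintype.card_fin,
        show (1 : ℝ) / 2 + ((d : ℝ) - 1) / 2 = (d : ℝ) / 2 by ring])
  rw [show (1 + α) / 2 + ((d : ℝ) - 1) / 2 = (α + d) / 2 by ring,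
    show (1 : ℝ) / 2 + ((d : ℝ) - 1) / 2 = (d : ℝ) / 2 by ring] at hmix
  rw [integral_polar hS, mul_comm (sphereArea _), mul_assoc, ← hmix, ← integral_const_mul]
  refine integral_congr_ae ?_
  filter_upwards [hae] with ω hω
  rw [finrank_euclideanSpace, Fintype.card_fin] at hω ⊢
  rw [radial_even hd hα0 hα2 hp hx (by simp) hω, chord_eq e ω.1 he, real_inner_smul_left, mul_pow,
    one_mul]

/-- The full integral of the axially weighted first difference quotient of `powFun`. -/
lemma integral_first_difference_axis (hd : 1 ≤ d) (hα0 : 0 < α) (hα2 : α < 2) (hp : -1 < p)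
    (he : ‖e‖ = 1) (hρ0 : 0 ≤ ρ) (hρ1 : ρ < 1) :
    ∫ y, inner ℝ e y * (powFun d p (ρ • e + y) - powFun d p (ρ • e - y)) /
      ‖y‖ ^ ((d : ℝ) + α) = ρ * α / d * sphereArea (EuclideanSpace ℝ (Fin d)) *
        ProbabilityTheory.beta (-α / 2) (p + 1) *
        ordinaryHypergeometric ((α + d) / 2) (α / 2 - p) ((d : ℝ) / 2 + 1) (ρ ^ 2) := by
  have := nontrivial_euclidean hd
  have hx : ‖ρ • e‖ < 1 := by rwa [norm_smul, he, mul_one, Real.norm_of_nonneg hρ0]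
  have hd' : (1 : ℝ) ≤ d := by exact_mod_cast hd
  have hS := integrable_first_difference hd hα0 hα2 hp hx e
  have hae := ae_integrableOn_polar hS
  have hmeas : Measurable fun ω : Metric.sphere (0 : EuclideanSpace ℝ (Fin d)) 1 =>
    inner ℝ e ω.1 ^ 2 := by fun_prop
  have hs0 : ∀ ω : Metric.sphere (0 : EuclideanSpace ℝ (Fin d)) 1, 0 ≤ inner ℝ e ω.1 ^ 2 :=
    fun ω => sq_nonneg _
  have hs1 : ∀ ω : Metric.sphere (0 : EuclideanSpace ℝ (Fin d)) 1, inner ℝ e ω.1 ^ 2 ≤ 1 :=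
    fun ω => inner_sq_le_one he (by simp)
  -- The extra weight `⟨e, ω⟩²` shifts the first Dirichlet parameter from `1/2` to `3/2` and
  -- multiplies the total mass by `(1/2)/(d/2) = 1/d`.
  have hmix := integral_mixture (volume : Measure (EuclideanSpace ℝ (Fin d))).toSphere
    (fun ω => inner ℝ e ω.1 ^ 2) (fun ω => inner ℝ e ω.1 ^ 2) hs0 hs0 hs1
    (A := (1 + α) / 2) (a := 3 / 2) (b := ((d : ℝ) - 1) / 2)
    (N := sphereArea (EuclideanSpace ℝ (Fin d)) / d) (t := ρ ^ 2) (α / 2 - p) (by positivity)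
    (by norm_num) (by linarith) (by positivity) (by nlinarith)
    (fun k j => by
      simpa only [← mul_assoc, ← pow_succ'] using integrable_dirichlet _ hmeas hs0 hs1 (k + 1) j)
    (fun k j => by
      simp only [← mul_assoc, ← pow_succ']
      have h := integral_dirichlet (volume : Measure (EuclideanSpace ℝ (Fin d))).toSphere
        hmeas hs0 hs1 (N := sphereArea (EuclideanSpace ℝ (Fin d))) (a := 1 / 2)
        (b := ((d : ℝ) - 1) / 2) (by norm_num) (by linarith) (fun k => by
          rw [integral_sphere_moment he, finrank_euclideanSpace, Fintype.card_fin,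
            show (1 : ℝ) / 2 + ((d : ℝ) - 1) / 2 = (d : ℝ) / 2 by ring]) (k + 1) j
      rw [h, show k + 1 + j = k + j + 1 by ring, poch_succ_left, poch_succ_left,
        show (1 : ℝ) / 2 + 1 = 3 / 2 by norm_num,
        show (1 : ℝ) / 2 + ((d : ℝ) - 1) / 2 = (d : ℝ) / 2 by ring,
        show (3 : ℝ) / 2 + ((d : ℝ) - 1) / 2 = (d : ℝ) / 2 + 1 by ring]
      have := (poch_pos (by positivity : (0 : ℝ) < (d : ℝ) / 2 + 1) (k + j)).ne'
      field_simp)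
  rw [show (1 + α) / 2 + ((d : ℝ) - 1) / 2 = (α + d) / 2 by ring,
    show (3 : ℝ) / 2 + ((d : ℝ) - 1) / 2 = (d : ℝ) / 2 + 1 by ring] at hmix
  have hc : ρ * α / d * sphereArea (EuclideanSpace ℝ (Fin d)) *
        ProbabilityTheory.beta (-α / 2) (p + 1) *
        ordinaryHypergeometric ((α + d) / 2) (α / 2 - p) ((d : ℝ) / 2 + 1) (ρ ^ 2) =
      (α * ProbabilityTheory.beta (-α / 2) (p + 1) * ρ) *
        (sphereArea (EuclideanSpace ℝ (Fin d)) / d *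
        ordinaryHypergeometric ((α + d) / 2) (α / 2 - p) ((d : ℝ) / 2 + 1) (ρ ^ 2)) := by ring
  rw [integral_polar hS, hc, ← hmix, ← integral_const_mul]
  refine integral_congr_ae ?_
  filter_upwards [hae] with ω hω
  rw [finrank_euclideanSpace, Fintype.card_fin] at hω ⊢
  rw [radial_odd hd hα0 hα2 hp hx (by simp) e hω, chord_eq e ω.1 he, real_inner_smul_left, mul_pow]
  ring

/-- Off axis components of the weighted first difference integral vanish. -/
lemma integral_first_difference (hd : 1 ≤ d) (hα0 : 0 < α) (hα2 : α < 2) (hp : -1 < p)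
    (he : ‖e‖ = 1) (hρ0 : 0 ≤ ρ) (hρ1 : ρ < 1) (a : EuclideanSpace ℝ (Fin d)) :
    ∫ y, inner ℝ a y * (powFun d p (ρ • e + y) - powFun d p (ρ • e - y)) / ‖y‖ ^ ((d : ℝ) + α) =
      inner ℝ a e * ∫ y, inner ℝ e y * (powFun d p (ρ • e + y) - powFun d p (ρ • e - y)) /
        ‖y‖ ^ ((d : ℝ) + α) := by
  have hx : ‖ρ • e‖ < 1 := by rwa [norm_smul, he, mul_one, Real.norm_of_nonneg hρ0]
  -- The reflection fixes `e` and negates its orthogonal complement, so it preserves the difference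
  -- of `powFun` at `ρ e ± y`; averaging `y` with `R y` leaves only the component along `e`.
  set R := (ℝ ∙ e).reflection with hR
  have hRy : ∀ y, y + R y = (2 * inner ℝ e y) • e := by
    intro y
    rw [hR, Submodule.reflection_singleton_apply]
    simp [he, two_smul, mul_smul]
  have hRe : R (ρ • e) = ρ • e := by
    rw [hR]
    exact Submodule.reflection_mem_subspace_eq_self (Submodule.smul_mem _ _
      (Submodule.mem_span_singleton_self e))
  set g : EuclideanSpace ℝ (Fin d) → ℝ := fun y =>
    (powFun d p (ρ • e + y) - powFun d p (ρ • e - y)) / ‖y‖ ^ ((d : ℝ) + α) with hg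
  have hgR : ∀ y, g (R y) = g y := by
    intro y
    have h1 : ‖ρ • e + R y‖ = ‖ρ • e + y‖ := by
      rw [← LinearIsometryEquiv.norm_map R (ρ • e + y), map_add, hRe]
    have h2 : ‖ρ • e - R y‖ = ‖ρ • e - y‖ := by
      rw [← LinearIsometryEquiv.norm_map R (ρ • e - y), map_sub, hRe]
    simp only [hg, powFun_eq_ballPow, h1, h2, LinearIsometryEquiv.norm_map]
  have i1 : Integrable fun y => inner ℝ a y * g y :=
    (integrable_first_difference hd hα0 hα2 hp hx a).congr
      (Eventually.of_forall fun y => by simp only [hg]; ring)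
  have i2 : Integrable fun y => inner ℝ a (R y) * g y := by
    have := (LinearIsometryEquiv.measurePreserving R).integrable_comp_of_integrable i1
    exact this.congr (Eventually.of_forall fun y => by simp only [Function.comp_apply, hgR])
  have e1 : ∫ y, inner ℝ a (R y) * g y = ∫ y, inner ℝ a y * g y := by
    rw [← (LinearIsometryEquiv.measurePreserving R).integral_comp
      R.toHomeomorph.measurableEmbedding fun y => inner ℝ a y * g y]
    simp only [hgR]
  have e2 : (∫ y, inner ℝ a y * g y) + ∫ y, inner ℝ a (R y) * g y =
      2 * inner ℝ a e * ∫ y, inner ℝ e y * g y := by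
    rw [← integral_add i1 i2, ← integral_const_mul]
    refine integral_congr_ae (Eventually.of_forall fun y => ?_)
    simp only
    rw [← add_mul, ← inner_add_right, hRy, inner_smul_right]
    ring
  simp only [mul_div_assoc]
  change ∫ y, inner ℝ a y * g y = inner ℝ a e * ∫ y, inner ℝ e y * g y
  linarith

end SphereAverages

end FracLap

/-! ### Constants, the contiguous relation and the conclusion -/

namespace FracLap

open MeasureTheory Filter Topology Set

/-- Any unit vector serves at the origin, so `x = 0` needs no separate treatment. -/
lemma exists_unit_smul {d : ℕ} (hd : 1 ≤ d) (x : EuclideanSpace ℝ (Fin d)) :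
    ∃ e : EuclideanSpace ℝ (Fin d), ‖e‖ = 1 ∧ ‖x‖ • e = x := by
  have := nontrivial_euclidean hd
  rcases eq_or_ne x 0 with rfl | hx
  · obtain ⟨e, he⟩ := exists_norm_eq (EuclideanSpace ℝ (Fin d)) zero_le_one
    exact ⟨e, he, by simp⟩
  · have hn := norm_ne_zero_iff.mpr hx
    exact ⟨‖x‖⁻¹ • x, norm_smul_inv_norm hx, smul_inv_smul₀ hn x⟩

lemma sphereArea_euclidean (d : ℕ) : sphereArea (EuclideanSpace ℝ (Fin d)) =
    2 * Real.pi ^ ((d : ℝ) / 2) / Real.Gamma ((d : ℝ) / 2) := by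
  rw [sphereArea, finrank_euclideanSpace, Fintype.card_fin, Real.sqrt_eq_rpow, ← Real.rpow_natCast,
    ← Real.rpow_mul Real.pi_pos.le, one_div_mul_eq_div]

lemma normConst_mul_sphereArea (d : ℕ) (p α t : ℝ) :
    normConst d α * (sphereArea (EuclideanSpace ℝ (Fin d)) *
      ProbabilityTheory.beta (-α / 2) (p + 1) *
      ordinaryHypergeometric ((α + d) / 2) (α / 2 - p) ((d : ℝ) / 2) t / 2) = Phi d p α t := by
  rw [sphereArea_euclidean, Phi, show -p + α / 2 = α / 2 - p by ring]
  ring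

/-- The powers of `π` cancel, and the two Gamma factors contribute `(α+d)/2` and `d/2`. Their
quotient is the prefactor `a / c` of `hyp_contiguous`. -/
lemma normConst_add_two {d : ℕ} (hd : 1 ≤ d) {α : ℝ} (hα0 : 0 < α) :
    normConst (d + 2) α * Real.pi ^ (((d + 2 : ℕ) : ℝ) / 2) / Real.Gamma (((d + 2 : ℕ) : ℝ) / 2) =
      ((α + d) / 2) / ((d : ℝ) / 2) *
        (normConst d α * Real.pi ^ ((d : ℝ) / 2) / Real.Gamma ((d : ℝ) / 2)) := by
  have hd' : (0 : ℝ) < d := by exact_mod_cast hd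
  have h1 : (((d + 2 : ℕ) : ℝ) / 2) = (d : ℝ) / 2 + 1 := by push_cast; ring
  have h2 : (α + ((d + 2 : ℕ) : ℝ)) / 2 = (α + d) / 2 + 1 := by push_cast; ring
  have hπ (s : ℝ) : Real.pi ^ s ≠ 0 := (Real.rpow_pos_of_pos Real.pi_pos s).ne'
  rw [normConst, normConst, h2, h1, Real.Gamma_add_one (by positivity),
    Real.Gamma_add_one (by positivity)]
  have := (Real.Gamma_pos_of_pos (by positivity : 0 < (d : ℝ) / 2)).ne'
  have e : ∀ a b c s : ℝ, s ≠ 0 → a / (s * b) * s / c = a / b / c := by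
    intro a b c s hs
    rw [← div_div, div_right_comm, div_mul_cancel₀ _ hs]
  rw [e _ _ _ _ (hπ _), e _ _ _ _ (hπ _)]
  simp only [div_eq_mul_inv, mul_inv]
  ring

/-- This is `hyp_contiguous` with `a = (α+d)/2` and `c = d/2`, for which `(a - c)/c = α/d`. -/
lemma Phi_add_two {d : ℕ} (hd : 1 ≤ d) {α p t : ℝ} (hα0 : 0 < α) (ht : |t| < 1) :
    Phi (d + 2) p α t = normConst d α * (sphereArea (EuclideanSpace ℝ (Fin d)) *
      ProbabilityTheory.beta (-α / 2) (p + 1) *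
      (ordinaryHypergeometric ((α + d) / 2) (α / 2 - p) ((d : ℝ) / 2) t + α / d *
        ordinaryHypergeometric ((α + d) / 2) (α / 2 - p) ((d : ℝ) / 2 + 1) t) / 2) := by
  have hd' : (0 : ℝ) < d := by exact_mod_cast hd
  have hc := hyp_contiguous (by positivity : 0 < (d : ℝ) / 2) ((α + d) / 2) (α / 2 - p) ht
  rw [show ((α + d) / 2 - (d : ℝ) / 2) / ((d : ℝ) / 2) = α / d by field_simp; ring] at hc
  have hn := normConst_add_two hd hα0
  rw [← hc, Phi, sphereArea_euclidean, mul_right_comm (normConst (d + 2) α),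
    mul_div_right_comm _ (ProbabilityTheory.beta _ _), hn,
    show (α + ((d + 2 : ℕ) : ℝ)) / 2 = (α + d) / 2 + 1 by push_cast; ring,
    show (((d + 2 : ℕ) : ℝ) / 2) = (d : ℝ) / 2 + 1 by push_cast; ring,
    show -p + α / 2 = α / 2 - p by ring]
  ring

/-- A discrete product rule: the linear factor at `x ± y` is `x_d ± y_d`, and its odd part meets the
odd difference of `powFun`. -/
lemma powFunLast_second_difference {d : ℕ} (hd : 1 ≤ d) (p α : ℝ)
    (x y : EuclideanSpace ℝ (Fin d)) :
    (powFunLast d hd p (x + y) + powFunLast d hd p (x - y) - 2 * powFunLast d hd p x) /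
      ‖y‖ ^ ((d : ℝ) + α) =
    x (lastIndex d hd) * ((powFun d p (x + y) + powFun d p (x - y) - 2 * powFun d p x) /
      ‖y‖ ^ ((d : ℝ) + α)) +
    inner ℝ (EuclideanSpace.single (lastIndex d hd) 1) y *
      (powFun d p (x + y) - powFun d p (x - y)) / ‖y‖ ^ ((d : ℝ) + α) := by
  simp only [powFunLast, EuclideanSpace.inner_single_left, PiLp.add_apply, PiLp.sub_apply, map_one,
    one_mul]
  ring

end FracLap

theorem theorem1 (d : ℕ) (hd : 1 ≤ d) (α : ℝ) (hα0 : 0 < α) (hα2 : α < 2)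
    (p : ℝ) (hp : -1 < p) (x : EuclideanSpace ℝ (Fin d)) (hx : ‖x‖ < 1) :
    FracLap.HasFracLaplacianAt d α (FracLap.powFun d p) x (FracLap.Phi d p α (‖x‖ ^ 2)) ∧
    FracLap.HasFracLaplacianAt d α (FracLap.powFunLast d hd p) x
      (x (FracLap.lastIndex d hd) * FracLap.Phi (d + 2) p α (‖x‖ ^ 2)) := by
  obtain ⟨e, he, hxe⟩ := FracLap.exists_unit_smul hd x
  have hS := FracLap.integrable_second_difference hd hα0 hα2 hp hx
  have hO := FracLap.integrable_first_difference hd hα0 hα2 hp hx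
    (EuclideanSpace.single (FracLap.lastIndex d hd) 1)
  have iS := FracLap.integral_second_difference hd hα0 hα2 hp he (norm_nonneg x) hx
  have iA := FracLap.integral_first_difference_axis hd hα0 hα2 hp he (norm_nonneg x) hx
  have iO := FracLap.integral_first_difference hd hα0 hα2 hp he (norm_nonneg x) hx
    (EuclideanSpace.single (FracLap.lastIndex d hd) 1)
  rw [hxe] at iS iA iO
  constructor
  · rw [← FracLap.normConst_mul_sphereArea, ← iS]
    exact FracLap.hasFracLaplacianAt_of_integrable_symm hd hα0 (FracLap.integrable_powFun hd hp) x hS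
  · have hx2 : |‖x‖ ^ 2| < 1 := by
      rw [abs_pow, abs_norm]
      exact pow_lt_one₀ (norm_nonneg x) hx two_ne_zero
    -- The radial factor `‖x‖` of the axial integral and the last coordinate of `e` recombine into
    -- `x_d`.
    have hxi : ‖x‖ * inner ℝ (EuclideanSpace.single (FracLap.lastIndex d hd) 1) e =
        x (FracLap.lastIndex d hd) := by
      rw [← inner_smul_right, hxe]
      simp [EuclideanSpace.inner_single_left]
    convert FracLap.hasFracLaplacianAt_of_integrable_symm hd hα0
      (FracLap.integrable_powFunLast hd hp) x ?_ using 1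
    · simp_rw [FracLap.powFunLast_second_difference]
      rw [MeasureTheory.integral_add (hS.const_mul _) hO, MeasureTheory.integral_const_mul, iS, iO,
        iA, FracLap.Phi_add_two hd hα0 hx2, ← hxi]
      ring
    · simp_rw [FracLap.powFunLast_second_difference]
      exact (hS.const_mul _).add hO
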